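/- **Notation.** For $u:\mathbb R\times\mathbb T\to\mathbb C$ ($\mathbb T=\mathbb R/2\pi\mathbb Z$) let $\widehat u(t,\xi)=\frac1{\sqrt{2\pi}}\int_0^{2\pi}u(t,x)e^{-ix\xi}\,dx$ $(\xi\in\mathbb Z)$, $\mathcal F_tf(\tau)=\frac1{\sqrt{2\pi}}\int_{\mathbb R}f(t)e^{-it\tau}\,dt$, $\mathcal Fu(\xi,\tau)=\mathcal F_t[\widehat u(\cdot,\xi)](\tau)$, and $\langle a\rangle=(1+a^2)^{1/2}$. Let $\mathcal S(\mathbb R\times\mathbb T)$ be the space of smooth functions that are $2\pi$-periodic in $x$ and satisfy $\sup_{t,x}|t^\alpha\partial_t^\beta\partial_x^\gamma u|<\infty$ for all $\alpha,\beta,\gamma\in\mathbb N_0$. For $s,b\in\mathbb R$ and $1\le r,p\le\infty$ with dual exponents $r',p'$, the space $X^{s,b}_{r,p}$ is the completion of $\mathcal S(\mathbb R\times\mathbb T)$ under $$\|u\|_{X^{s,b}_{r,p}}=\big\|\langle\tau+\xi^2\rangle^b\langle\xi\rangle^s\,\mathcal Fu(\xi,\tau)\big\|_{\ell^{r'}_\xi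 L^{p'}_\tau};$$ for $r,p>1$ it is identified through $\mathcal F$ with the space of all measurable functions of $(\xi,\tau)$ for which the weighted norm is finite. The trilinear operator $\mathcal T$ is defined by $$\widehat{\mathcal T(u_1,u_2,u_3)}(t,\xi)=\frac1{2\pi}\sum_{\substack{\xi_1+\xi_2+\xi_3=\xi\\ \xi_1\ne\xi,\ \xi_2\ne\xi}}\widehat u_1(t,\xi_1)\,\widehat u_2(t,\xi_2)\,i\xi_3\,\widehat{\overline{u}_3}(t,\xi_3)+\frac1{2\pi}\,\widehat u_1(t,\xi)\,\widehat u_2(t,\xi)\,i\xi\,\widehat{\overline{u}_3}(t,-\xi)$$ for $u_i\in\mathcal S(\mathbb R\times\mathbb T)$; for rough $u_i$, $\mathcal F\mathcal T(u_1,u_2,u_3)(\xi,\tau)$ is defined by the same series with $\mathcal F_t$ applied to each summand. **Theorem.** Let $\frac43<q\le r\le2$ and $0\le\delta<\frac1{q'}$, where $\frac1q+\frac1{q'}=1$. There is a constant $C$ depending only on $q,r,\delta$ such that, for every $0<T\le1$, $$\|\mathcal T(u_1,u_2,u_3)\|_{X^{1/2,-1/2}_{r,2}}\le C\,T^\delta\,\|u_1\|_{X^{1/2,1/2}_{q,2}}\|u_2\|_{X^{1/2,1/2}_{q,2}}\|u_3\|_{X^{1/2,1/2}_{r,2}}\qquad(*)$$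 in each of the following two situations. 1. $u_1,u_2,u_3\in\mathcal S(\mathbb R\times\mathbb T)$ with $\operatorname{supp}u_i\subset\{|t|\le T\}$. In this case the series defining $\widehat{\mathcal T(u_1,u_2,u_3)}(t,\xi)$ converges absolutely for all $t,\xi$, and $\mathcal F_t$ may be applied to it term by term, so that the two definitions of $\mathcal T$ agree. 2. $u_1,u_2\in X^{1/2,1/2}_{q,2}$ and $u_3\in X^{1/2,1/2}_{r,2}$ are arbitrary with $\operatorname{supp}u_i\subset\{|t|\le T\}$ (all such $u_i$ are functions in $L^2(\mathbb R\times\mathbb T)$). In this case each summand is integrable in $t$, for every $\xi$ the series of the time Fourier transforms converges absolutely for almost every $\tau$, and $\mathcal T(u_1,u_2,u_3)\in X^{1/2,-1/2}_{r,2}$. -/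

import Mathlib

open MeasureTheory
open scoped ENNReal NNReal

noncomputable section

namespace DNLS

/-- The Japanese bracket `⟨a⟩ = (1 + a²)^{1/2}`. -/
def bracket (a : ℝ) : ℝ := Real.sqrt (1 + a ^ 2)

/-- `ℱ_x`: the Fourier coefficients in the (periodic) space variable of `u(t, x)`,
`û(t, ξ) = (2π)^{-1/2} ∫_0^{2π} u(t, x) e^{-ixξ} dx`. -/
def fourierX (u : ℝ × ℝ → ℂ) (t : ℝ) (ξ : ℤ) : ℂ :=
  ((Real.sqrt (2 * Real.pi))⁻¹ : ℂ) *
    ∫ x in (0 : ℝ)..(2 * Real.pi), u (t, x) * Complex.exp (-(Complex.I * x * ξ))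

/-- `ℱ_t`: the Fourier transform in the time variable,
`(2π)^{-1/2} ∫ f(t) e^{-itτ} dt`. -/
def fourierT (f : ℝ → ℂ) (τ : ℝ) : ℂ :=
  ((Real.sqrt (2 * Real.pi))⁻¹ : ℂ) * ∫ t : ℝ, f t * Complex.exp (-(Complex.I * t * τ))

/-- `ℱ = ℱ_t ℱ_x`: the space-time Fourier transform. -/
def fourierTX (u : ℝ × ℝ → ℂ) (ξ : ℤ) (τ : ℝ) : ℂ :=
  fourierT (fun t => fourierX u t ξ) τ

/-- The norm `‖⟨τ + ξ²⟩^b ⟨ξ⟩^s f‖_{ℓ^{r'}_ξ L^{p'}_τ}` of a function `f(ξ, τ)` on the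
space-time Fourier side. The `X^{s,b}_{r,p}`-norm of `u` is the value at `f = ℱ u`. -/
def xNorm (s b : ℝ) (r p : ℝ≥0∞) (f : ℤ → ℝ → ℂ) : ℝ≥0∞ :=
  eLpNorm
    (fun ξ : ℤ =>
      eLpNorm
        (fun τ : ℝ => ((bracket (τ + (ξ : ℝ) ^ 2) ^ b * bracket (ξ : ℝ) ^ s : ℝ) : ℂ) * f ξ τ)
        p.conjExponent volume)
    r.conjExponent Measure.count

/-- `f(ξ, τ)` is the space-time Fourier transform of an element of `X^{s,b}_{r,p}`.
For `1 < r` and `1 < p` the exponents `r'`, `p'` are finite, and the completion of the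
Schwartz functions under the norm is, via `ℱ`, precisely this weighted space
`ℓ^{r'}_ξ L^{p'}_τ`. -/
def MemX (s b : ℝ) (r p : ℝ≥0∞) (f : ℤ → ℝ → ℂ) : Prop :=
  (∀ ξ : ℤ, AEStronglyMeasurable (f ξ) volume) ∧ xNorm s b r p f < ∞

/-- `u` is `2π`-periodic in the space variable, i.e. a function on `ℝ × 𝕋`. -/
def SpacePeriodic (u : ℝ × ℝ → ℂ) : Prop :=
  ∀ t x : ℝ, u (t, x + 2 * Real.pi) = u (t, x)

/-- `u` belongs to `L²(ℝ × 𝕋)`. -/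
def MemL2 (u : ℝ × ℝ → ℂ) : Prop :=
  SpacePeriodic u ∧ MemLp u 2 (volume.restrict (Set.univ ×ˢ Set.Ioc (0 : ℝ) (2 * Real.pi)))

/-- The space `𝒮(ℝ × 𝕋)`: smooth functions, `2π`-periodic in `x`, all of whose derivatives
decay faster than any power of `t`. -/
structure IsSchwartz (u : ℝ × ℝ → ℂ) : Prop where
  smooth : ContDiff ℝ (⊤ : ℕ∞) u
  periodic : SpacePeriodic u
  decay : ∀ α β γ : ℕ, ∃ C : ℝ, ∀ t x : ℝ,
    ‖((t ^ α : ℝ) : ℂ) *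
      iteratedDeriv β (fun t' => iteratedDeriv γ (fun x' => u (t', x')) x) t‖ ≤ C

/-- `supp u ⊆ {(t, x) : |t| ≤ T}` (support in the sense of distributions; for continuous
`u` this is the usual support). -/
def TimeSupported (T : ℝ) (u : ℝ × ℝ → ℂ) : Prop :=
  ∀ᵐ z : ℝ × ℝ, T < |z.1| → u z = 0

/-- The pairs of frequencies `(ξ₁, ξ₂)` with `ξ₁ ≠ ξ` and `ξ₂ ≠ ξ`. -/
abbrev NonResonant (ξ : ℤ) : Type := {k : ℤ × ℤ // k.1 ≠ ξ ∧ k.2 ≠ ξ}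

/-- The summand `û₁(t, ξ₁) û₂(t, ξ₂) (i η) (ū₃)^(t, ξ₃)`, where `(ū₃)^` denotes the Fourier
coefficients of the complex conjugate of `u₃`. -/
def cubicTerm (u₁ u₂ u₃ : ℝ × ℝ → ℂ) (ξ₁ ξ₂ η ξ₃ : ℤ) (t : ℝ) : ℂ :=
  fourierX u₁ t ξ₁ * fourierX u₂ t ξ₂ * (Complex.I * η) *
    fourierX (fun z => (starRingEnd ℂ) (u₃ z)) t ξ₃

/-- The nonresonant summand, with `ξ₃ = ξ - ξ₁ - ξ₂`. -/
def nonresTerm (u₁ u₂ u₃ : ℝ × ℝ → ℂ) (ξ : ℤ) (k : NonResonant ξ) (t : ℝ) : ℂ :=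
  cubicTerm u₁ u₂ u₃ k.1.1 k.1.2 (ξ - k.1.1 - k.1.2) (ξ - k.1.1 - k.1.2) t

/-- The correction term `û₁(t, ξ) û₂(t, ξ) (i ξ) (ū₃)^(t, -ξ)`. -/
def corrTerm (u₁ u₂ u₃ : ℝ × ℝ → ℂ) (ξ : ℤ) (t : ℝ) : ℂ :=
  cubicTerm u₁ u₂ u₃ ξ ξ ξ (-ξ) t

/-- The trilinear operator through its Fourier coefficients in `x` at each time `t`. -/
def trilinearHat (u₁ u₂ u₃ : ℝ × ℝ → ℂ) (t : ℝ) (ξ : ℤ) : ℂ :=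
  ((2 * Real.pi)⁻¹ : ℂ) * ∑' k : NonResonant ξ, nonresTerm u₁ u₂ u₃ ξ k t
    + ((2 * Real.pi)⁻¹ : ℂ) * corrTerm u₁ u₂ u₃ ξ t

/-- The space-time Fourier transform of the trilinear operator for general arguments: the same
series, where `ℱ_t` is applied to each summand. (For rough `u_i` the series need not converge
at fixed `t`, only after the Fourier transform in time.) -/
def trilinearFourier (u₁ u₂ u₃ : ℝ × ℝ → ℂ) (ξ : ℤ) (τ : ℝ) : ℂ :=
  ((2 * Real.pi)⁻¹ : ℂ) * ∑' k : NonResonant ξ, fourierT (nonresTerm u₁ u₂ u₃ ξ k) τ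
    + ((2 * Real.pi)⁻¹ : ℂ) * fourierT (corrTerm u₁ u₂ u₃ ξ) τ

end DNLS

end

/-! The estimate is proved for absolute values on the Fourier side; no cancellation is used. Put d =
ξ - ξ₁ and e = ξ - ξ₂, so that ξ₃ = d + e - ξ. With the modulations of the inputs reflected, the
four modulations add up to ξ² - ξ₁² - ξ₂² + ξ₃² = 2de. The convolution theorem, as an inequality,
bounds the transform of the operator by `majorant`, and duality in ℓ^{r'}L² (`dual_le`) leaves sums
over ξ, d, e of the forms `quadForm` at N = 2de.

The algebra is ξξ₃ = de - ξ₁ξ₂. Since d and e do not vanish in the nonresonant part, the multiplier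
is at most a constant times ⟨2de⟩^{1/2}(⟨d⟩^{-1/2}⟨e⟩^{-1/2} + ⟨ξ₁⟩^{-1/2}⟨ξ₂⟩^{-1/2})
(`multiplier_le`). As the modulations sum to 2de, the factor ⟨2de⟩^{1/2} cancels the weight
⟨σ⟩^{-1/2} of one of the four functions (`jb_rpow_half_mul_quadForm_le`).

Fix the frequency of the function that lost its weight. The three other weights, one of them
weakened by δ, still leave decay ⟨2de - x⟩^{-(1-δ-δ₁)/2} for any δ₁ > δ. Hölder in (d,e) with
exponents 1/2, δ₁, 1/2 - δ₁ then gives an ℓ^t bound with 1/t = 1/2 + δ₁ in place of the trivial ℓ¹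
bound (`exists_tsum_quadForm_le`). The last Hölder factor is a count of pairs (d,e) with prescribed
product: up to a weight ⟨d-e⟩^{-ε} it is bounded, by the divisor bound and because at most four
factorisations have d very close to e (`exists_tsum_nzPair_le`). The loss ⟨d-e⟩^ε is taken from the
frequency weights.

What remains are discrete sums in ℓ^t, handled by a Schur test or by Hölder:
`Exponents.exists_front_diff`, `Exponents.exists_front_freq`, `Exponents.exists_side_freq` and
`Exponents.exists_side_diff`. The last one is the critical one and needs δ₁ < 1/q'. The condition t
≤ q reads δ₁ ≥ 1/2 - 1/q', and the two are compatible with room exactly when q > 4/3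
(`exists_exponents`).

The power T^δ comes from the uncertainty principle: a function living on |t| ≤ T has at most half of
its L² mass at modulations below c/T, so giving up ⟨σ⟩^δ on one input gains T^δ (`sqNorm_gain`). The
correction term has no resonance, but its multiplier is bounded (`exists_corr_form_le`). For rough
inputs, finiteness of the norm of the majorant yields absolute convergence for almost every τ. For
smooth inputs, quadratic decay of the Fourier coefficients justifies the termwise transform
(`fourierT_trilinearHat`). -/

noncomputable section

namespace DNLS

/-! ### The Japanese bracket as an extended nonnegative real -/

/-- The Japanese bracket with values in `ℝ≥0∞`. -/
def jb (x : ℝ) : ℝ≥0∞ := ENNReal.ofReal (bracket x)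

lemma one_le_bracket (x : ℝ) : 1 ≤ bracket x := by
  unfold bracket
  rw [Real.one_le_sqrt]
  nlinarith [sq_nonneg x]

lemma bracket_pos (x : ℝ) : 0 < bracket x := lt_of_lt_of_le one_pos (one_le_bracket x)

lemma bracket_sq (x : ℝ) : bracket x ^ 2 = 1 + x ^ 2 := by
  unfold bracket
  rw [Real.sq_sqrt (by positivity)]

lemma abs_le_bracket (x : ℝ) : |x| ≤ bracket x :=
  abs_le_of_sq_le_sq (by rw [bracket_sq]; linarith) (bracket_pos x).le

lemma continuous_bracket : Continuous bracket := by unfold bracket; fun_prop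

lemma bracket_neg (x : ℝ) : bracket (-x) = bracket x := by simp [bracket]

lemma bracket_le_bracket {x y : ℝ} (h : |x| ≤ |y|) : bracket x ≤ bracket y := by
  unfold bracket
  exact Real.sqrt_le_sqrt (by have := sq_le_sq.2 h; linarith)

lemma bracket_add_le (x y : ℝ) : bracket (x + y) ≤ 2 * (bracket x * bracket y) := by
  have h1 := bracket_sq x
  have h2 := bracket_sq y
  have h3 := bracket_sq (x + y)
  have := bracket_pos x
  have := bracket_pos y
  refine (pow_le_pow_iff_left₀ (bracket_pos _).le (by positivity) two_ne_zero).1 ?_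
  rw [mul_pow, mul_pow, h1, h2, h3]
  nlinarith [sq_nonneg (x - y), sq_nonneg (x * y)]

lemma one_le_jb (x : ℝ) : 1 ≤ jb x := by
  simpa [jb] using one_le_bracket x

lemma jb_ne_top (x : ℝ) : jb x ≠ ∞ := ENNReal.ofReal_ne_top

lemma jb_ne_zero (x : ℝ) : jb x ≠ 0 := (lt_of_lt_of_le one_pos (one_le_jb x)).ne'

lemma jb_neg (x : ℝ) : jb (-x) = jb x := by simp [jb, bracket_neg]

lemma jb_le_jb {x y : ℝ} (h : |x| ≤ |y|) : jb x ≤ jb y :=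
  ENNReal.ofReal_le_ofReal (bracket_le_bracket h)

lemma jb_add_le (x y : ℝ) : jb (x + y) ≤ 2 * (jb x * jb y) := by
  have := ENNReal.ofReal_le_ofReal (bracket_add_le x y)
  rwa [ENNReal.ofReal_mul (by norm_num), ENNReal.ofReal_mul (bracket_pos x).le,
    ENNReal.ofReal_ofNat] at this

lemma measurable_jb : Measurable jb := continuous_bracket.measurable.ennreal_ofReal

lemma jb_rpow (x s : ℝ) : jb x ^ s = ENNReal.ofReal (bracket x ^ s) := by
  rw [jb, ENNReal.ofReal_rpow_of_pos (bracket_pos x)]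

lemma jb_rpow_ne_top (x s : ℝ) : jb x ^ s ≠ ∞ := by rw [jb_rpow]; exact ENNReal.ofReal_ne_top

lemma jb_rpow_ne_zero (x s : ℝ) : jb x ^ s ≠ 0 := by
  rw [jb_rpow]
  simpa using Real.rpow_pos_of_pos (bracket_pos x) s

lemma jb_rpow_add (x s u : ℝ) : jb x ^ (s + u) = jb x ^ s * jb x ^ u :=
  ENNReal.rpow_add _ _ (jb_ne_zero x) (jb_ne_top x)

lemma jb_rpow_le_jb_rpow {s u : ℝ} (x : ℝ) (h : s ≤ u) : jb x ^ s ≤ jb x ^ u :=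
  ENNReal.rpow_le_rpow_of_exponent_le (one_le_jb x) h

lemma jb_rpow_le_one {s : ℝ} (x : ℝ) (h : s ≤ 0) : jb x ^ s ≤ 1 := by
  simpa using jb_rpow_le_jb_rpow x h

lemma measurable_jb_rpow (s : ℝ) : Measurable fun x => jb x ^ s := measurable_jb.pow_const s

/-- Antitonicity of negative powers. -/
lemma rpow_neg_le_rpow_neg {a b : ℝ≥0∞} {s : ℝ} (h : a ≤ b) (hs : 0 ≤ s) :
    b ^ (-s) ≤ a ^ (-s) := by
  rw [ENNReal.rpow_neg, ENNReal.rpow_neg]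
  exact ENNReal.inv_le_inv.2 (ENNReal.rpow_le_rpow h hs)

/-- If `a ≤ C b` then `b ^ (-s) ≤ C ^ s a ^ (-s)`. -/
lemma rpow_neg_le_of_le_mul {a b C : ℝ≥0∞} {s : ℝ} (h : a ≤ C * b) (hs : 0 ≤ s)
    (hC : C ≠ 0) (hC' : C ≠ ∞) : b ^ (-s) ≤ C ^ s * a ^ (-s) := by
  have h1 := rpow_neg_le_rpow_neg h hs
  rw [ENNReal.rpow_neg, ENNReal.mul_rpow_of_nonneg _ _ hs, ENNReal.mul_inv
    (Or.inl (by simp [ENNReal.rpow_eq_zero_iff, hC, hC']))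
    (Or.inl (ENNReal.rpow_ne_top_of_nonneg hs hC')), ← ENNReal.rpow_neg, ← ENNReal.rpow_neg] at h1
  calc b ^ (-s) = C ^ s * (C ^ (-s) * b ^ (-s)) := by
        rw [← mul_assoc, ← ENNReal.rpow_add _ _ hC hC']; simp
    _ ≤ C ^ s * a ^ (-s) := by gcongr

lemma lintegral_jb_rpow_lt_top {s : ℝ} (hs : 1 < s) : ∫⁻ x : ℝ, jb x ^ (-s) < ∞ := by
  have h := integrable_rpow_neg_one_add_norm_sq (E := ℝ) (μ := volume) (r := s) (by simpa using hs)
  have h2 : ∀ x : ℝ, jb x ^ (-s) = ENNReal.ofReal ((1 + ‖x‖ ^ 2) ^ (-s / 2)) := by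
    intro x
    rw [jb_rpow, bracket, Real.sqrt_eq_rpow, ← Real.rpow_mul (by positivity)]
    congr 2
    · simp
    · ring
  simp_rw [h2]
  exact h.lintegral_lt_top

/-- Convolution of two negative powers of brackets. -/
lemma exists_lintegral_jb_mul_jb_le {α β γ : ℝ} (hγ : 0 ≤ γ) (hα : γ ≤ α) (hβ : γ ≤ β)
    (h : 1 < α + β - γ) :
    ∃ C : ℝ≥0∞, C ≠ ∞ ∧ ∀ M : ℝ,
      ∫⁻ y : ℝ, jb y ^ (-α) * jb (M - y) ^ (-β) ≤ C * jb M ^ (-γ) := by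
  set I := ∫⁻ x : ℝ, jb x ^ (-(α + β - γ)) with hI
  have hIt : I < ∞ := lintegral_jb_rpow_lt_top h
  refine ⟨2 ^ γ * (I + I), by finiteness, fun M => ?_⟩
  have key : ∀ y : ℝ, jb y ^ (-α) * jb (M - y) ^ (-β) ≤
      2 ^ γ * jb M ^ (-γ) * (jb y ^ (-(α + β - γ)) + jb (M - y) ^ (-(α + β - γ))) := by
    intro y
    -- Here a is the larger of y and M - y, so |M| ≤ 2|a|, and a part γ of its decay is traded for
    -- decay in M.
    have main : ∀ (a b : ℝ) (α β : ℝ), γ ≤ α → γ ≤ β → 1 < α + β - γ → |M| ≤ 2 * |a| →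
        jb a ^ (-α) * jb b ^ (-β) ≤
          2 ^ γ * jb M ^ (-γ) * (jb a ^ (-(α + β - γ)) + jb b ^ (-(α + β - γ))) := by
      intro a b α β hα hβ _ hM
      have h1 : jb M ≤ 2 * jb a := by
        have : bracket M ≤ 2 * bracket a := by
          have h1 := bracket_sq M
          have h2 := bracket_sq a
          have := bracket_pos a
          refine (pow_le_pow_iff_left₀ (bracket_pos _).le (by positivity) two_ne_zero).1 ?_
          rw [mul_pow, h1, h2]
          have := sq_le_sq.2 (show |M| ≤ |2 * a| by simpa [abs_mul] using hM)
          nlinarith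
        have := ENNReal.ofReal_le_ofReal this
        rwa [ENNReal.ofReal_mul (by norm_num), ENNReal.ofReal_ofNat] at this
      have h2 : jb a ^ (-γ) ≤ 2 ^ γ * jb M ^ (-γ) :=
        rpow_neg_le_of_le_mul h1 hγ (by norm_num) (by norm_num)
      -- The smaller of the two brackets can carry the whole remaining exponent α + β - γ, which
      -- exceeds one.
      have h3 : jb a ^ (-(α - γ)) * jb b ^ (-β) ≤
          jb a ^ (-(α + β - γ)) + jb b ^ (-(α + β - γ)) := by
        rcases le_total (jb a) (jb b) with hab | hab
        · refine le_trans ?_ le_self_add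
          rw [show -(α + β - γ) = -(α - γ) + -β by ring, jb_rpow_add]
          exact mul_le_mul_right (rpow_neg_le_rpow_neg (s := β) hab (by linarith)) _
        · refine le_trans ?_ le_add_self
          rw [show -(α + β - γ) = -(α - γ) + -β by ring, jb_rpow_add]
          exact mul_le_mul_left (rpow_neg_le_rpow_neg (s := α - γ) hab (by linarith)) _
      calc jb a ^ (-α) * jb b ^ (-β) = jb a ^ (-γ) * (jb a ^ (-(α - γ)) * jb b ^ (-β)) := by
            rw [← mul_assoc, ← jb_rpow_add]; ring_nf
        _ ≤ _ := by gcongr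
    rcases le_total |M - y| |y| with hy | hy
    · refine main y (M - y) α β hα hβ h ?_
      calc |M| = |(M - y) + y| := by ring_nf
        _ ≤ |M - y| + |y| := abs_add_le _ _
        _ ≤ _ := by linarith
    · have := main (M - y) y β α hβ hα (by linarith) ?_
      · rw [mul_comm, add_comm (jb y ^ _)]
        convert this using 3 <;> ring_nf
      calc |M| = |(M - y) + y| := by ring_nf
        _ ≤ |M - y| + |y| := abs_add_le _ _
        _ ≤ _ := by linarith
  calc ∫⁻ y : ℝ, jb y ^ (-α) * jb (M - y) ^ (-β)
      ≤ ∫⁻ y : ℝ, 2 ^ γ * jb M ^ (-γ) *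
          (jb y ^ (-(α + β - γ)) + jb (M - y) ^ (-(α + β - γ))) := lintegral_mono key
    _ = 2 ^ γ * jb M ^ (-γ) * (I + I) := by
        rw [lintegral_const_mul' _ _ (by have := jb_rpow_ne_top M (-γ); finiteness),
          lintegral_add_left (measurable_jb_rpow _),
          lintegral_sub_left_eq_self (fun y => jb y ^ (-(α + β - γ))) M]
    _ = _ := by ring

/-- Uniform bound for the sum of negative powers of brackets over a shifted lattice. -/
lemma exists_tsum_jb_sub_le {s : ℝ} (hs : 1 < s) :
    ∃ C : ℝ≥0∞, C ≠ ∞ ∧ ∀ x : ℝ, ∑' n : ℤ, jb (x - n) ^ (-s) ≤ C := by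
  have h0 : ∑' n : ℤ, jb (n : ℝ) ^ (-s) ≠ ∞ := by
    have h1 : Summable fun n : ℤ => |(n : ℝ)| ^ (-s) := Real.summable_abs_int_rpow hs
    have h2 : ∑' n : ℤ, ENNReal.ofReal (|(n : ℝ)| ^ (-s)) ≠ ∞ := h1.tsum_ofReal_ne_top
    have h3 : ∑' n : ℤ, (if n = 0 then (1 : ℝ≥0∞) else 0) = 1 := tsum_ite_eq 0 _
    refine ne_top_of_le_ne_top (b := ∑' n : ℤ, (ENNReal.ofReal (|(n : ℝ)| ^ (-s)) +
      (if n = 0 then (1 : ℝ≥0∞) else 0))) ?_ (ENNReal.tsum_le_tsum fun n => ?_)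
    · rw [ENNReal.tsum_add, h3]; finiteness
    · by_cases hn : n = 0
      · simp only [hn, if_true]
        exact le_trans (jb_rpow_le_one _ (by linarith)) le_add_self
      · refine le_trans ?_ le_self_add
        rw [jb_rpow]
        refine ENNReal.ofReal_le_ofReal ?_
        exact Real.rpow_le_rpow_of_nonpos (by positivity) (abs_le_bracket _) (by linarith)
  refine ⟨(2 * jb 1) ^ s * ∑' n : ℤ, jb (n : ℝ) ^ (-s), ?_, fun x => ?_⟩
  · have := jb_ne_top 1
    finiteness
  -- Substituting ⌊x⌋ - n for n centres the lattice at x up to the fractional part, which changes a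
  -- bracket by a factor of at most 2⟨1⟩.
  · rw [← ENNReal.tsum_mul_left, ← (Equiv.subLeft ⌊x⌋).tsum_eq]
    refine ENNReal.tsum_le_tsum fun n => ?_
    refine rpow_neg_le_of_le_mul ?_ (by linarith) ?_ ?_
    · have h1 := jb_add_le (x - (Equiv.subLeft ⌊x⌋ n : ℤ)) (-Int.fract x)
      have h2 : jb (-Int.fract x) ≤ jb 1 := jb_le_jb (by
        rw [abs_neg, abs_one, abs_of_nonneg (Int.fract_nonneg x)]
        exact (Int.fract_lt_one x).le)
      have h3 : x - (Equiv.subLeft ⌊x⌋ n : ℤ) + -Int.fract x = n := by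
        simp only [Equiv.subLeft_apply, Int.cast_sub, Int.fract]; ring
      rw [h3] at h1
      calc _ ≤ _ := h1
        _ ≤ 2 * (jb (x - (Equiv.subLeft ⌊x⌋ n : ℤ)) * jb 1) := by gcongr
        _ = _ := by ring
    · simp [jb_ne_zero]
    · have := jb_ne_top 1
      finiteness

/-! ### The divisor bound -/

/-- From exp y ≥ 1 + y. It controls the factor k + 1 that a small prime of multiplicity k
contributes to the number of divisors. -/
lemma exists_add_one_le_mul_two_rpow {ε : ℝ} (hε : 0 < ε) :
    ∃ K : ℝ, 1 ≤ K ∧ ∀ k : ℕ, (k + 1 : ℝ) ≤ K * (2 : ℝ) ^ (k * ε) := by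
  have hl : 0 < Real.log 2 := Real.log_pos (by norm_num)
  refine ⟨max 1 (1 / (ε * Real.log 2)), le_max_left _ _, fun k => ?_⟩
  have h1 : 1 + k * (ε * Real.log 2) ≤ (2 : ℝ) ^ (k * ε) := by
    rw [Real.rpow_def_of_pos (by norm_num)]
    have := Real.add_one_le_exp (Real.log 2 * (k * ε))
    linarith
  have h3 : (1 : ℝ) ≤ max 1 (1 / (ε * Real.log 2)) := le_max_left _ _
  have h4 : 1 ≤ max 1 (1 / (ε * Real.log 2)) * (ε * Real.log 2) := by
    have := le_max_right 1 (1 / (ε * Real.log 2))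
    calc 1 = 1 / (ε * Real.log 2) * (ε * Real.log 2) := by field_simp
      _ ≤ _ := by gcongr
  have hk : (0 : ℝ) ≤ k := k.cast_nonneg
  calc (k + 1 : ℝ) ≤ max 1 (1 / (ε * Real.log 2)) * (1 + k * (ε * Real.log 2)) := by nlinarith
    _ ≤ _ := by gcongr

/-- The divisor bound `d(n) = O(n ^ ε)`. -/
lemma exists_card_divisors_le {ε : ℝ} (hε : 0 < ε) :
    ∃ C : ℝ, 0 < C ∧ ∀ n : ℕ, n ≠ 0 → (n.divisors.card : ℝ) ≤ C * (n : ℝ) ^ ε := by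
  obtain ⟨K, hK1, hK⟩ := exists_add_one_le_mul_two_rpow hε
  -- A prime p ≥ 2^{1/ε} satisfies p^{kε} ≥ 2^k ≥ k + 1 and costs nothing. Fewer than B + 1 primes
  -- are smaller, each costing a factor K.
  set B : ℕ := ⌈(2 : ℝ) ^ (1 / ε)⌉₊ with hB
  refine ⟨K ^ B, by positivity, fun n hn => ?_⟩
  rw [Nat.card_divisors hn]
  push_cast
  have h1 : ∀ p ∈ n.primeFactors, ((n.factorization p : ℝ) + 1) ≤
      (if p < B then K else 1) * (((p : ℝ) ^ n.factorization p) ^ ε) := by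
    intro p hp
    have hp2 : (2 : ℝ) ≤ p := by exact_mod_cast (Nat.prime_of_mem_primeFactors hp).two_le
    set k := n.factorization p
    rw [← Real.rpow_natCast, ← Real.rpow_mul (by positivity)]
    split_ifs with h
    · refine (hK k).trans ?_
      gcongr
    · have h2 : (2 : ℝ) ^ (1 / ε) ≤ p := (Nat.le_ceil _).trans (by exact_mod_cast not_lt.1 h)
      have h3 : (2 : ℝ) ^ (k : ℝ) ≤ (p : ℝ) ^ ((k : ℝ) * ε) := by
        calc (2 : ℝ) ^ (k : ℝ) = ((2 : ℝ) ^ (1 / ε)) ^ ((k : ℝ) * ε) := by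
              rw [← Real.rpow_mul (by norm_num)]; congr 1; field_simp
          _ ≤ _ := by gcongr
      rw [one_mul]
      refine le_trans ?_ h3
      rw [Real.rpow_natCast]
      exact_mod_cast Nat.lt_two_pow_self
  calc ∏ p ∈ n.primeFactors, ((n.factorization p : ℝ) + 1)
      ≤ ∏ p ∈ n.primeFactors, (if p < B then K else 1) * (((p : ℝ) ^ n.factorization p) ^ ε) :=
        Finset.prod_le_prod (fun _ _ => by positivity) h1
    _ = (∏ p ∈ n.primeFactors, if p < B then K else 1) * (n : ℝ) ^ ε := by
        rw [Finset.prod_mul_distrib, Real.finsetProd_rpow _ _ (fun _ _ => by positivity)]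
        congr 2
        conv_rhs => rw [← Nat.prod_factorization_pow_eq_self hn]
        rw [Finsupp.prod, Nat.support_factorization]
        push_cast
        rfl
    _ ≤ K ^ B * (n : ℝ) ^ ε := by
        gcongr
        rw [← Finset.prod_filter, Finset.prod_const]
        refine pow_le_pow_right₀ hK1 ?_
        calc _ ≤ (Finset.range B).card := Finset.card_le_card (fun p hp => by
              simp only [Finset.mem_filter] at hp; simpa using hp.2)
          _ = B := by simp

/-- The number of factorisations `N = d e` over the integers. -/
lemma card_divisorsAntidiag_le (N : ℤ) :
    N.divisorsAntidiag.card ≤ 2 * N.natAbs.divisors.card := by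
  have : N.divisorsAntidiag.card ≤ (({-1, 1} : Finset ℤ) ×ˢ N.natAbs.divisors).card := by
    -- A factorisation of N ≠ 0 is determined by its first factor, hence by the sign and absolute
    -- value of that factor.
    refine Finset.card_le_card_of_injOn (fun p => (p.1.sign, p.1.natAbs)) ?_ ?_
    · intro p hp
      simp only [Finset.mem_coe, Int.mem_divisorsAntidiag] at hp
      have h1 : p.1 ≠ 0 := by rintro h; simp [h] at hp; exact hp.2 hp.1.symm
      simp only [Finset.coe_product, Set.mem_prod, Finset.mem_coe, Finset.mem_insert,
        Finset.mem_singleton, Nat.mem_divisors]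
      refine ⟨?_, ?_, ?_⟩
      · rcases lt_or_gt_of_ne h1 with h | h
        · left; exact Int.sign_eq_neg_one_of_neg h
        · right; exact Int.sign_eq_one_of_pos h
      · exact Int.natAbs_dvd_natAbs.2 ⟨p.2, hp.1.symm⟩
      · simpa using hp.2
    · intro p hp p' hp' h
      simp only [Finset.mem_coe, Int.mem_divisorsAntidiag] at hp hp'
      simp only [Prod.mk.injEq] at h
      have h1 : p.1 ≠ 0 := by rintro h; simp [h] at hp; exact hp.2 hp.1.symm
      have h2 : p.1 = p'.1 := by rw [← Int.sign_mul_natAbs p.1, ← Int.sign_mul_natAbs p'.1, h.1, h.2]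
      refine Prod.ext h2 (mul_left_cancel₀ h1 ?_)
      rw [hp.1, h2, hp'.1]
  refine this.trans ?_
  rw [Finset.card_product]
  simp

/-- Few factorisations `N = d e` have `d` close to `e`. -/
lemma card_filter_divisorsAntidiag_le (N : ℤ) :
    (N.divisorsAntidiag.filter fun p => (p.1 - p.2) ^ 4 < 4 * |N|).card ≤ 4 := by
  rcases (N.divisorsAntidiag.filter fun p => (p.1 - p.2) ^ 4 < 4 * |N|).eq_empty_or_nonempty
    with h0 | ⟨⟨d, e⟩, hde⟩
  · simp [h0]
  simp only [Finset.mem_filter, Int.mem_divisorsAntidiag] at hde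
  obtain ⟨⟨hN, hN0⟩, hlt⟩ := hde
  have hsub : (N.divisorsAntidiag.filter fun p => (p.1 - p.2) ^ 4 < 4 * |N|) ⊆
      {(d, e), (e, d), (-d, -e), (-e, -d)} := by
    rintro ⟨a, b⟩ hab
    simp only [Finset.mem_filter, Int.mem_divisorsAntidiag] at hab
    obtain ⟨⟨hN', -⟩, hlt'⟩ := hab
    -- For N < 0 one has (a - b)² ≥ 4|N|, so close factors exist only for positive N.
    have pos : ∀ a b : ℤ, a * b = N → (a - b) ^ 4 < 4 * |N| → 0 < N := by
      intro a b hN hlt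
      by_contra hneg
      have hneg : N < 0 := lt_of_le_of_ne (not_lt.1 hneg) hN0
      rw [abs_of_neg hneg] at hlt
      have h1 : -(4 * N) ≤ (a - b) ^ 2 := by nlinarith [sq_nonneg (a + b)]
      have h2 : 4 ≤ -(4 * N) := by linarith
      nlinarith [sq_nonneg ((a - b) ^ 2)]
    have hNp := pos d e hN hlt
    rw [abs_of_pos hNp] at hlt hlt'
    -- Since (a+b)² = (a-b)² + 4N, a strictly smaller |c+g| forces (a-b)² ≥ 2|c+g| + 1, while (c+g)²
    -- ≥ 4N; then (a-b)⁴ > 4N. Hence all close factorisations share |a+b|, and sum and product fix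
    -- the pair up to order and sign.
    have key : ∀ a b c g : ℤ, a * b = N → c * g = N → (a - b) ^ 4 < 4 * N →
        |c + g| < |a + b| → False := by
      intro a b c g h1 h2 h3 h4
      have h5 : (|c + g| + 1) ^ 2 ≤ (a + b) ^ 2 := by
        rw [← sq_abs (a + b)]
        have := abs_nonneg (c + g)
        gcongr
        omega
      have h6 : (c + g) ^ 2 = (c - g) ^ 2 + 4 * N := by rw [← h2]; ring
      have h7 : (a + b) ^ 2 = (a - b) ^ 2 + 4 * N := by rw [← h1]; ring
      have h8 : 2 * |c + g| + 1 ≤ (a - b) ^ 2 := by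
        nlinarith [sq_abs (c + g), sq_nonneg (c - g)]
      have h9 : 4 * N ≤ |c + g| ^ 2 := by rw [sq_abs, h6]; nlinarith [sq_nonneg (c - g)]
      nlinarith [abs_nonneg (c + g)]
    have hs : |a + b| = |d + e| := by
      refine le_antisymm ?_ ?_
      · by_contra hc
        exact key a b d e hN' hN hlt' (not_le.1 hc)
      · by_contra hc
        exact key d e a b hN hN' hlt (not_le.1 hc)
    simp only [Finset.mem_insert, Finset.mem_singleton, Prod.mk.injEq]
    rcases abs_eq_abs.1 hs with h | h
    · have : (a - d) * (a - e) = 0 := by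
        have : b = d + e - a := by linarith
        subst this
        nlinarith
      rcases mul_eq_zero.1 this with h' | h'
      · left; constructor <;> linarith
      · right; left; constructor <;> linarith
    · have : (a + d) * (a + e) = 0 := by
        have : b = -(d + e) - a := by linarith
        subst this
        nlinarith
      rcases mul_eq_zero.1 this with h' | h'
      · right; right; left; constructor <;> linarith
      · right; right; right; constructor <;> linarith
  exact (Finset.card_le_card hsub).trans Finset.card_le_four

/-- The weighted number of factorisations `N = d e` is bounded. -/
lemma exists_sum_divisorsAntidiag_jb_le {ε : ℝ} (hε : 0 < ε) :
    ∃ C : ℝ≥0∞, C ≠ ∞ ∧ ∀ N : ℤ,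
      ∑ p ∈ N.divisorsAntidiag, jb ((p.1 : ℝ) - p.2) ^ (-ε) ≤ C := by
  -- The exponent ε/4 fits the threshold: (d-e)⁴ ≥ 4|N| gives ⟨d-e⟩^{-ε} ≤ |N|^{-ε/4}, which pays
  -- for the divisor bound.
  obtain ⟨C, hC0, hC⟩ := exists_card_divisors_le (ε := ε / 4) (by positivity)
  refine ⟨4 + ENNReal.ofReal (2 * C), by finiteness, fun N => ?_⟩
  by_cases hN : N = 0
  · simp [hN]
  rw [← Finset.sum_filter_add_sum_filter_not _ (fun p : ℤ × ℤ => (p.1 - p.2) ^ 4 < 4 * |N|)]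
  refine add_le_add ?_ ?_
  · calc _ ≤ ∑ p ∈ N.divisorsAntidiag.filter (fun p => (p.1 - p.2) ^ 4 < 4 * |N|), (1 : ℝ≥0∞) :=
          Finset.sum_le_sum fun p _ => jb_rpow_le_one _ (by linarith)
      _ ≤ 4 := by
          simp only [Finset.sum_const, nsmul_eq_mul, mul_one]
          exact_mod_cast card_filter_divisorsAntidiag_le N
  · have hb : ∀ p ∈ N.divisorsAntidiag.filter (fun p => ¬ (p.1 - p.2) ^ 4 < 4 * |N|),
        jb ((p.1 : ℝ) - p.2) ^ (-ε) ≤ ENNReal.ofReal ((N.natAbs : ℝ) ^ (-(ε / 4))) := by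
      intro p hp
      have h1 := (Finset.mem_filter.1 hp).2
      have hN1 : (1 : ℝ) ≤ N.natAbs := by exact_mod_cast Int.natAbs_pos.2 hN
      have h2 : ((N.natAbs : ℝ)) ≤ bracket ((p.1 : ℝ) - p.2) ^ (4 : ℝ) := by
        have h3 : (4 * |N| : ℤ) ≤ (p.1 - p.2) ^ 4 := not_lt.1 h1
        have h4 : (4 * |(N : ℝ)|) ≤ ((p.1 : ℝ) - p.2) ^ 4 := by exact_mod_cast h3
        have h5 : ((N.natAbs : ℝ)) = |(N : ℝ)| := by
          rw [← Int.cast_abs, Int.abs_eq_natAbs]; simp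
        rw [h5]
        have h6 : ((p.1 : ℝ) - p.2) ^ 4 ≤ bracket ((p.1 : ℝ) - p.2) ^ 4 := by
          rw [← Even.pow_abs (by decide : Even 4)]
          exact pow_le_pow_left₀ (abs_nonneg _) (abs_le_bracket _) 4
        have h7 := abs_nonneg (N : ℝ)
        rw [show (4 : ℝ) = (4 : ℕ) by norm_num, Real.rpow_natCast]
        linarith
      rw [jb_rpow]
      refine ENNReal.ofReal_le_ofReal ?_
      calc bracket ((p.1 : ℝ) - p.2) ^ (-ε)
          = (bracket ((p.1 : ℝ) - p.2) ^ (4 : ℝ)) ^ (-(ε / 4)) := by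
            rw [← Real.rpow_mul (bracket_pos _).le]; congr 1; ring
        _ ≤ _ := Real.rpow_le_rpow_of_nonpos (by linarith) h2 (by linarith)
    refine (Finset.sum_le_sum hb).trans ?_
    rw [Finset.sum_const, nsmul_eq_mul]
    have hn : N.natAbs ≠ 0 := by simpa using hN
    have hn' : (0 : ℝ) < N.natAbs := by positivity
    have h3 : ((N.divisorsAntidiag.filter (fun p => ¬ (p.1 - p.2) ^ 4 < 4 * |N|)).card : ℝ) ≤
        2 * C * (N.natAbs : ℝ) ^ (ε / 4) := by
      have h4 := (Finset.card_filter_le N.divisorsAntidiag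
        (fun p => ¬ (p.1 - p.2) ^ 4 < 4 * |N|)).trans (card_divisorsAntidiag_le N)
      have h5 : ((N.divisorsAntidiag.filter (fun p => ¬ (p.1 - p.2) ^ 4 < 4 * |N|)).card : ℝ) ≤
        2 * N.natAbs.divisors.card := by exact_mod_cast h4
      have := hC _ hn
      linarith
    rw [← ENNReal.ofReal_natCast, ← ENNReal.ofReal_mul (by positivity)]
    refine ENNReal.ofReal_le_ofReal ?_
    calc _ ≤ 2 * C * (N.natAbs : ℝ) ^ (ε / 4) * (N.natAbs : ℝ) ^ (-(ε / 4)) := by gcongr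
      _ = 2 * C := by rw [mul_assoc, ← Real.rpow_add hn']; simp

/-- Pairs of nonzero integers. -/
abbrev NzPair : Type := {p : ℤ × ℤ // p.1 ≠ 0 ∧ p.2 ≠ 0}

/-- The counting estimate behind the orthogonality argument. -/
lemma exists_tsum_nzPair_le {ε p : ℝ} (hε : 0 < ε) (hp : 1 < p) :
    ∃ C : ℝ≥0∞, C ≠ ∞ ∧ ∀ x : ℝ,
      ∑' k : NzPair, jb ((k.1.1 : ℝ) - k.1.2) ^ (-ε) *
        jb (2 * ((k.1.1 : ℝ) * k.1.2) - x) ^ (-p) ≤ C := by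
  obtain ⟨C₁, hC₁, h₁⟩ := exists_sum_divisorsAntidiag_jb_le hε
  obtain ⟨C₂, hC₂, h₂⟩ := exists_tsum_jb_sub_le hp
  refine ⟨C₁ * C₂, by finiteness, fun x => ?_⟩
  -- Group the pairs by their product N: the second weight depends on N only, the first is summed
  -- over the factorisations of N, and a sum over the lattice 2ℤ remains.
  rw [← (Equiv.sigmaFiberEquiv (fun k : NzPair => k.1.1 * k.1.2)).tsum_eq, ENNReal.tsum_sigma']
  have hfib : ∀ N : ℤ, ∑' k : {k : NzPair // k.1.1 * k.1.2 = N},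
      jb ((k.1.1.1 : ℝ) - k.1.1.2) ^ (-ε) * jb (2 * ((k.1.1.1 : ℝ) * k.1.1.2) - x) ^ (-p) ≤
      C₁ * jb (x - 2 * N) ^ (-p) := by
    intro N
    have e1 : ∀ k : {k : NzPair // k.1.1 * k.1.2 = N},
        jb (2 * ((k.1.1.1 : ℝ) * k.1.1.2) - x) = jb (x - 2 * N) := by
      intro k
      have hk : (N : ℝ) = (k.1.1.1 : ℝ) * k.1.1.2 := by exact_mod_cast k.2.symm
      rw [← jb_neg, hk]
      ring_nf
    simp_rw [e1]
    rw [ENNReal.tsum_mul_right]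
    gcongr
    refine le_trans ?_ (h₁ N)
    rw [← Finset.tsum_subtype N.divisorsAntidiag
      (fun p : ℤ × ℤ => jb ((p.1 : ℝ) - p.2) ^ (-ε))]
    let f : {k : NzPair // k.1.1 * k.1.2 = N} → {p // p ∈ N.divisorsAntidiag} := fun k =>
      ⟨k.1.1, by
        rw [Int.mem_divisorsAntidiag]
        exact ⟨k.2, by rw [← k.2]; exact mul_ne_zero k.1.2.1 k.1.2.2⟩⟩
    have hf : Function.Injective f := by
      intro k k' h
      have : k.1.1 = k'.1.1 := congrArg (fun z => z.1) h
      exact Subtype.ext (Subtype.ext this)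
    exact ENNReal.tsum_comp_le_tsum_of_injective hf
      (fun p : {p // p ∈ N.divisorsAntidiag} => jb ((p.1.1 : ℝ) - p.1.2) ^ (-ε))
  calc _ ≤ ∑' N : ℤ, C₁ * jb (x - 2 * N) ^ (-p) := ENNReal.tsum_le_tsum hfib
    _ = C₁ * ∑' N : ℤ, jb (x - ((2 * N : ℤ) : ℝ)) ^ (-p) := by
        rw [ENNReal.tsum_mul_left]; push_cast; rfl
    _ ≤ C₁ * ∑' N : ℤ, jb (x - N) ^ (-p) := by
        refine mul_le_mul_right ?_ _
        exact ENNReal.tsum_comp_le_tsum_of_injective (mul_right_injective₀ two_ne_zero)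
          (fun N : ℤ => jb (x - N) ^ (-p))
    _ ≤ C₁ * C₂ := by gcongr; exact h₂ x

/-! ### Hölder's inequality for sums -/

/-- Generalised Hölder inequality for sums in `ℝ≥0∞`. -/
lemma tsum_prod_rpow_le {ι κ : Type*} (s : Finset κ) (f : κ → ι → ℝ≥0∞) {p : κ → ℝ}
    (hp : ∑ k ∈ s, p k = 1) (h0 : ∀ k ∈ s, 0 ≤ p k) :
    ∑' i, ∏ k ∈ s, f k i ^ p k ≤ ∏ k ∈ s, (∑' i, f k i) ^ p k := by
  let _ : MeasurableSpace ι := ⊤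
  have := ENNReal.lintegral_prod_norm_pow_le (μ := Measure.count) s
    (f := f) (fun k _ => (measurable_from_top).aemeasurable) hp h0
  simpa [lintegral_count' measurable_from_top] using this

lemma tsum_rpow_mul_le {ι : Type*} (f g : ι → ℝ≥0∞) {a b : ℝ} (ha : 0 ≤ a) (hb : 0 ≤ b)
    (h : a + b = 1) :
    ∑' i, f i ^ a * g i ^ b ≤ (∑' i, f i) ^ a * (∑' i, g i) ^ b := by
  have := tsum_prod_rpow_le Finset.univ ![f, g] (p := ![a, b]) (by simp [Fin.sum_univ_succ, h])
    (by intro k _; fin_cases k <;> simp [ha, hb])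
  simpa [Fin.prod_univ_succ] using this

lemma tsum_rpow_mul_mul_le {ι : Type*} (f g k : ι → ℝ≥0∞) {a b c : ℝ} (ha : 0 ≤ a) (hb : 0 ≤ b)
    (hc : 0 ≤ c) (h : a + b + c = 1) :
    ∑' i, f i ^ a * g i ^ b * k i ^ c ≤
      (∑' i, f i) ^ a * (∑' i, g i) ^ b * (∑' i, k i) ^ c := by
  have := tsum_prod_rpow_le Finset.univ ![f, g, k] (p := ![a, b, c])
    (by simp [Fin.sum_univ_succ, ← h, add_assoc])
    (by intro k _; fin_cases k <;> simp [ha, hb, hc])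
  simpa [Fin.prod_univ_succ, mul_assoc] using this

/-! ### The quadrilinear convolution form -/

/-- The quadrilinear form `∫ a₀(x₀) a₁(x₁) a₂(x₂) a₃(x₃)` over `x₀ + x₁ + x₂ + x₃ = N`. -/
def quadForm (a₀ a₁ a₂ a₃ : ℝ → ℝ≥0∞) (N : ℝ) : ℝ≥0∞ :=
  ∫⁻ x, a₀ x * ∫⁻ y, a₁ y * ∫⁻ z, a₂ z * a₃ (N - x - y - z)

/-- The corresponding trilinear convolution. -/
def triConv (a₁ a₂ a₃ : ℝ → ℝ≥0∞) (M : ℝ) : ℝ≥0∞ :=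
  ∫⁻ y, a₁ y * ∫⁻ z, a₂ z * a₃ (M - y - z)

lemma quadForm_eq (a₀ a₁ a₂ a₃ : ℝ → ℝ≥0∞) (N : ℝ) :
    quadForm a₀ a₁ a₂ a₃ N = ∫⁻ x, a₀ x * triConv a₁ a₂ a₃ (N - x) := rfl

lemma measurable_conv {a b : ℝ → ℝ≥0∞} (ha : Measurable a) (hb : Measurable b) :
    Measurable fun M => ∫⁻ z, a z * b (M - z) := by
  refine Measurable.lintegral_prod_right' (f := fun p : ℝ × ℝ => a p.2 * b (p.1 - p.2)) ?_
  exact (ha.comp measurable_snd).mul (hb.comp (measurable_fst.sub measurable_snd))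

lemma measurable_triConv {a₁ a₂ a₃ : ℝ → ℝ≥0∞} (h₁ : Measurable a₁) (h₂ : Measurable a₂)
    (h₃ : Measurable a₃) : Measurable (triConv a₁ a₂ a₃) :=
  measurable_conv h₁ (measurable_conv h₂ h₃)

/-- Tonelli and translation invariance. In the orthogonality argument this bounds the mass of a
convolution of squares of normalised functions by one. -/
lemma lintegral_triConv {a₁ a₂ a₃ : ℝ → ℝ≥0∞} (h₁ : Measurable a₁) (h₂ : Measurable a₂)
    (h₃ : Measurable a₃) (N : ℝ) :
    ∫⁻ x, triConv a₁ a₂ a₃ (N - x) = (∫⁻ x, a₁ x) * (∫⁻ x, a₂ x) * ∫⁻ x, a₃ x := by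
  have conv : ∀ {a b : ℝ → ℝ≥0∞}, Measurable a → Measurable b →
      ∫⁻ M, ∫⁻ z, a z * b (M - z) = (∫⁻ x, a x) * ∫⁻ x, b x := by
    intro a b ha hb
    rw [lintegral_lintegral_swap
      ((ha.comp measurable_snd).mul (hb.comp (measurable_fst.sub measurable_snd))).aemeasurable,
      ← lintegral_mul_const _ ha]
    refine lintegral_congr fun z => ?_
    rw [lintegral_const_mul (f := fun x => b (x - z)) _ (hb.comp (measurable_id.sub_const z)),
      lintegral_sub_right_eq_self b z]
  rw [lintegral_sub_left_eq_self (triConv a₁ a₂ a₃) N]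
  unfold triConv
  rw [conv h₁ (measurable_conv h₂ h₃), conv h₂ h₃, mul_assoc]

/-- Cauchy--Schwarz for the trilinear convolution. -/
lemma triConv_rpow_half_le {f₁ f₂ f₃ g₁ g₂ g₃ : ℝ → ℝ≥0∞} (hf₁ : Measurable f₁)
    (hf₂ : Measurable f₂) (hf₃ : Measurable f₃) (hg₁ : Measurable g₁) (hg₂ : Measurable g₂)
    (hg₃ : Measurable g₃) (M : ℝ) :
    triConv (fun x => f₁ x ^ (1 / 2 : ℝ) * g₁ x ^ (1 / 2 : ℝ))
      (fun x => f₂ x ^ (1 / 2 : ℝ) * g₂ x ^ (1 / 2 : ℝ))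
      (fun x => f₃ x ^ (1 / 2 : ℝ) * g₃ x ^ (1 / 2 : ℝ)) M ≤
    triConv f₁ f₂ f₃ M ^ (1 / 2 : ℝ) * triConv g₁ g₂ g₃ M ^ (1 / 2 : ℝ) := by
  -- Cauchy–Schwarz for a single convolution, used once for the inner and once for the outer one.
  have step : ∀ {f g f' g' : ℝ → ℝ≥0∞}, Measurable f → Measurable g → Measurable f' →
      Measurable g' → ∀ M : ℝ, ∫⁻ y, (f y ^ (1 / 2 : ℝ) * g y ^ (1 / 2 : ℝ)) *
        (f' (M - y) ^ (1 / 2 : ℝ) * g' (M - y) ^ (1 / 2 : ℝ)) ≤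
      (∫⁻ y, f y * f' (M - y)) ^ (1 / 2 : ℝ) * (∫⁻ y, g y * g' (M - y)) ^ (1 / 2 : ℝ) := by
    intro f g f' g' hf hg hf' hg' M
    have hm : Measurable fun y : ℝ => M - y := measurable_const.sub measurable_id
    refine le_trans (le_of_eq ?_) (ENNReal.lintegral_mul_norm_pow_le (p := 1 / 2) (q := 1 / 2)
      (hf.mul (hf'.comp hm)).aemeasurable
      (hg.mul (hg'.comp hm)).aemeasurable (by norm_num) (by norm_num) (by norm_num))
    refine lintegral_congr fun y => ?_
    simp only [Pi.mul_apply, Function.comp_apply]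
    rw [ENNReal.mul_rpow_of_nonneg _ _ (by norm_num), ENNReal.mul_rpow_of_nonneg _ _ (by norm_num)]
    ring
  unfold triConv
  refine le_trans ?_ (step hf₁ hg₁ (measurable_conv hf₂ hf₃) (measurable_conv hg₂ hg₃) M)
  refine lintegral_mono fun y => ?_
  exact mul_le_mul_right (step hf₂ hg₂ hf₃ hg₃ (M - y)) _

/-- Iterated convolution of negative powers of brackets. -/
lemma exists_triConv_jb_le {δ δ₁ : ℝ} (hδ : 0 ≤ δ) (h : δ < δ₁) (h₁ : δ₁ ≤ 1 / 2) :
    ∃ C : ℝ≥0∞, C ≠ ∞ ∧ ∀ M : ℝ,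
      triConv (fun x => jb x ^ (-1 : ℝ)) (fun x => jb x ^ (-1 : ℝ))
        (fun x => jb x ^ (-(1 - 2 * δ))) M ≤ C * jb M ^ (-(1 - δ - δ₁)) := by
  -- Convolving with ⟨x⟩^{-1} just fails to preserve decay; each of the two convolutions is allowed
  -- to lose (δ₁ - δ)/2.
  obtain ⟨C₁, hC₁, H₁⟩ := exists_lintegral_jb_mul_jb_le (α := 1) (β := 1 - 2 * δ)
    (γ := 1 - 2 * δ - (δ₁ - δ) / 2) (by linarith) (by linarith) (by linarith) (by linarith)
  obtain ⟨C₂, hC₂, H₂⟩ := exists_lintegral_jb_mul_jb_le (α := 1)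
    (β := 1 - 2 * δ - (δ₁ - δ) / 2)
    (γ := 1 - δ - δ₁) (by linarith) (by linarith) (by linarith) (by linarith)
  refine ⟨C₁ * C₂, by finiteness, fun M => ?_⟩
  unfold triConv
  calc _ ≤ ∫⁻ y, jb y ^ (-1 : ℝ) * (C₁ * jb (M - y) ^ (-(1 - 2 * δ - (δ₁ - δ) / 2))) :=
        lintegral_mono fun y => mul_le_mul_right (H₁ (M - y)) _
    _ = C₁ * ∫⁻ y, jb y ^ (-1 : ℝ) * jb (M - y) ^ (-(1 - 2 * δ - (δ₁ - δ) / 2)) := by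
        rw [← lintegral_const_mul' _ _ hC₁]
        refine lintegral_congr fun y => by ring
    _ ≤ C₁ * (C₂ * jb M ^ (-(1 - δ - δ₁))) := by gcongr; exact H₂ M
    _ = _ := by ring

/-- The weights carried by the three functions that are not eliminated. -/
lemma exists_triConv_weighted_le {δ δ₁ : ℝ} (hδ : 0 ≤ δ) (h : δ < δ₁) (h₁ : δ₁ ≤ 1 / 2) :
    ∃ C : ℝ≥0∞, C ≠ ∞ ∧ ∀ b c e : ℝ → ℝ≥0∞, Measurable b → Measurable c → Measurable e →
      ∀ M : ℝ, triConv (fun x => b x * jb x ^ (-(1 / 2) : ℝ)) (fun x => c x * jb x ^ (-(1 / 2) : ℝ))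
        (fun x => e x * jb x ^ (-(1 / 2 - δ))) M ≤
      C * jb M ^ (-((1 - δ - δ₁) / 2)) * triConv (fun x => b x ^ (2 : ℝ)) (fun x => c x ^ (2 : ℝ))
        (fun x => e x ^ (2 : ℝ)) M ^ (1 / 2 : ℝ) := by
  obtain ⟨C, hC, H⟩ := exists_triConv_jb_le hδ h h₁
  refine ⟨C ^ (1 / 2 : ℝ), by finiteness, fun b c e hb hc he M => ?_⟩
  have e1 : ∀ x : ℝ≥0∞, (x ^ (2 : ℝ)) ^ (1 / 2 : ℝ) = x := fun x => by
    rw [← ENNReal.rpow_mul]; norm_num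
  have e2 : ∀ (x s : ℝ), (jb x ^ (-s)) ^ (1 / 2 : ℝ) = jb x ^ (-(s / 2)) := fun x s => by
    rw [← ENNReal.rpow_mul]; ring_nf
  -- Writing each factor as (b²)^{1/2} times the square root of a doubled weight separates the
  -- convolution of the squares from that of the weights.
  have := triConv_rpow_half_le (hb.pow_const (2 : ℝ)) (hc.pow_const (2 : ℝ))
    (he.pow_const (2 : ℝ)) (measurable_jb_rpow (-1)) (measurable_jb_rpow (-1)) (measurable_jb_rpow (-(1 - 2 * δ))) M
  simp only [e1, e2] at this
  rw [show (1 - 2 * δ) / 2 = 1 / 2 - δ by ring] at this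
  refine this.trans ?_
  rw [mul_comm]
  gcongr
  calc _ ≤ (C * jb M ^ (-(1 - δ - δ₁))) ^ (1 / 2 : ℝ) := by gcongr; exact H M
    _ = _ := by rw [ENNReal.mul_rpow_of_nonneg _ _ (by norm_num), e2]

/-- The almost orthogonality estimate: triples with different resonance functions interact
weakly, so that the sum is controlled by an `ℓ^t`-sum with `1/t = 1/2 + δ₁`. -/
lemma exists_tsum_quadForm_le {δ δ₁ ε : ℝ} (hδ : 0 ≤ δ) (h : δ < δ₁) (h₁ : δ₁ < 1 / 2)
    (hε : 0 < ε) :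
    ∃ C : ℝ≥0∞, C ≠ ∞ ∧ ∀ (y : NzPair → ℝ≥0∞) (a : ℝ → ℝ≥0∞) (b c e : NzPair → ℝ → ℝ≥0∞),
      Measurable a → (∀ p, Measurable (b p)) → (∀ p, Measurable (c p)) →
      (∀ p, Measurable (e p)) → ∫⁻ x, a x ^ (2 : ℝ) ≤ 1 → (∀ p, ∫⁻ x, b p x ^ (2 : ℝ) ≤ 1) →
      (∀ p, ∫⁻ x, c p x ^ (2 : ℝ) ≤ 1) → (∀ p, ∫⁻ x, e p x ^ (2 : ℝ) ≤ 1) →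
      ∑' p : NzPair, y p * quadForm a (fun x => b p x * jb x ^ (-(1 / 2) : ℝ))
        (fun x => c p x * jb x ^ (-(1 / 2) : ℝ)) (fun x => e p x * jb x ^ (-(1 / 2 - δ)))
        (2 * ((p.1.1 : ℝ) * p.1.2)) ≤
      C * (∑' p : NzPair, (y p * jb ((p.1.1 : ℝ) - p.1.2) ^ ε) ^ (1 / (1 / 2 + δ₁))) ^
        (1 / 2 + δ₁) := by
  have hδ₁ : 0 < δ₁ := lt_of_le_of_lt hδ h
  set t : ℝ := 1 / (1 / 2 + δ₁) with ht
  have ht0 : 0 < t := by positivity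
  have htm : t * (1 / 2 + δ₁) = 1 := by rw [ht]; field_simp
  obtain ⟨C₁, hC₁, H₁⟩ := exists_triConv_weighted_le hδ h h₁.le
  have hq : 0 < 1 / 2 - δ₁ := by linarith
  -- The exponents are divided by 1/2 - δ₁ because this sum enters Hölder with that power. The
  -- second exceeds one precisely because δ < δ₁.
  obtain ⟨C₀, hC₀, H₀⟩ := exists_tsum_nzPair_le (ε := ε / (1 / 2 - δ₁))
    (p := (1 - δ - δ₁) / 2 / (1 / 2 - δ₁)) (by positivity)
    (by rw [lt_div_iff₀ hq]; linarith)
  refine ⟨C₁ * C₀ ^ (1 / 2 - δ₁), by finiteness, fun y a b c e ha hb hc he ha1 hb1 hc1 he1 => ?_⟩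
  set w : NzPair → ℝ≥0∞ := fun p => y p * jb ((p.1.1 : ℝ) - p.1.2) ^ ε with hw
  set S : ℝ≥0∞ := ∑' p, w p ^ t with hS
  set N : NzPair → ℝ := fun p => 2 * ((p.1.1 : ℝ) * p.1.2) with hN
  set Y : NzPair → ℝ → ℝ≥0∞ := fun p x => triConv (fun x => b p x ^ (2 : ℝ))
    (fun x => c p x ^ (2 : ℝ)) (fun x => e p x ^ (2 : ℝ)) (N p - x) with hY
  have hmN : ∀ p, Measurable fun x : ℝ => N p - x := fun p => measurable_const.sub measurable_id
  have hYm : ∀ p, Measurable (Y p) := fun p =>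
    (measurable_triConv ((hb p).pow_const 2) ((hc p).pow_const 2) ((he p).pow_const 2)).comp (hmN p)
  have hY1 : ∀ p, ∫⁻ x, Y p x ≤ 1 := fun p => by
    rw [hY]
    simp only
    rw [lintegral_triConv ((hb p).pow_const 2) ((hc p).pow_const 2) ((he p).pow_const 2)]
    exact mul_le_one' (mul_le_one' (hb1 p) (hc1 p)) (he1 p)
  have hsum_m : Measurable fun x => ∑' p, w p ^ t * Y p x :=
    Measurable.tsum fun p => (hYm p).const_mul _
  -- the pointwise Hölder inequality
  have hpt : ∀ x, ∑' p, y p * (C₁ * jb (N p - x) ^ (-((1 - δ - δ₁) / 2)) * Y p x ^ (1 / 2 : ℝ)) ≤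
      C₁ * C₀ ^ (1 / 2 - δ₁) * S ^ δ₁ * (∑' p, w p ^ t * Y p x) ^ (1 / 2 : ℝ) := by
    intro x
    -- The Hölder exponents are 1/2, δ₁ and 1/2 - δ₁. The first two restore w, since (1/2 + δ₁)t =
    -- 1, and ⟨d-e⟩^{-ε} in the third undoes the factor put into w.
    have e1 : ∀ p, y p * (C₁ * jb (N p - x) ^ (-((1 - δ - δ₁) / 2)) * Y p x ^ (1 / 2 : ℝ)) =
        C₁ * ((w p ^ t * Y p x) ^ (1 / 2 : ℝ) * (w p ^ t) ^ δ₁ *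
          (jb ((p.1.1 : ℝ) - p.1.2) ^ (-(ε / (1 / 2 - δ₁))) *
            jb (N p - x) ^ (-((1 - δ - δ₁) / 2 / (1 / 2 - δ₁)))) ^ (1 / 2 - δ₁)) := by
      intro p
      have e2 : (w p ^ t) ^ (1 / 2 : ℝ) * (w p ^ t) ^ δ₁ = w p := by
        rw [← ENNReal.rpow_add_of_nonneg _ _ (by norm_num) hδ₁.le, ← ENNReal.rpow_mul, htm,
          ENNReal.rpow_one]
      have e3 : (jb ((p.1.1 : ℝ) - p.1.2) ^ (-(ε / (1 / 2 - δ₁)))) ^ (1 / 2 - δ₁) =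
          jb ((p.1.1 : ℝ) - p.1.2) ^ (-ε) := by
        rw [← ENNReal.rpow_mul, neg_mul, div_mul_cancel₀ _ hq.ne']
      have e4 : (jb (N p - x) ^ (-((1 - δ - δ₁) / 2 / (1 / 2 - δ₁)))) ^ (1 / 2 - δ₁) =
          jb (N p - x) ^ (-((1 - δ - δ₁) / 2)) := by
        rw [← ENNReal.rpow_mul, neg_mul, div_mul_cancel₀ _ hq.ne']
      have e5 : w p * jb ((p.1.1 : ℝ) - p.1.2) ^ (-ε) = y p := by
        rw [hw]
        simp only
        rw [mul_assoc, ← jb_rpow_add]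
        simp
      rw [ENNReal.mul_rpow_of_nonneg _ _ (by norm_num), ENNReal.mul_rpow_of_nonneg _ _ hq.le,
        e3, e4]
      calc _ = C₁ * (y p * Y p x ^ (1 / 2 : ℝ) * jb (N p - x) ^ (-((1 - δ - δ₁) / 2))) := by ring
        _ = C₁ * ((w p * jb ((p.1.1 : ℝ) - p.1.2) ^ (-ε)) * Y p x ^ (1 / 2 : ℝ) *
              jb (N p - x) ^ (-((1 - δ - δ₁) / 2))) := by rw [e5]
        _ = C₁ * ((((w p ^ t) ^ (1 / 2 : ℝ) * (w p ^ t) ^ δ₁) *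
              jb ((p.1.1 : ℝ) - p.1.2) ^ (-ε)) * Y p x ^ (1 / 2 : ℝ) *
              jb (N p - x) ^ (-((1 - δ - δ₁) / 2))) := by rw [e2]
        _ = _ := by ring
    simp_rw [e1]
    rw [ENNReal.tsum_mul_left]
    calc _ ≤ C₁ * ((∑' p, w p ^ t * Y p x) ^ (1 / 2 : ℝ) * S ^ δ₁ * (∑' p : NzPair,
          jb ((p.1.1 : ℝ) - p.1.2) ^ (-(ε / (1 / 2 - δ₁))) *
            jb (N p - x) ^ (-((1 - δ - δ₁) / 2 / (1 / 2 - δ₁)))) ^ (1 / 2 - δ₁)) := by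
          gcongr
          exact tsum_rpow_mul_mul_le _ _ _ (by norm_num) hδ₁.le hq.le (by ring)
      _ ≤ C₁ * ((∑' p, w p ^ t * Y p x) ^ (1 / 2 : ℝ) * S ^ δ₁ * C₀ ^ (1 / 2 - δ₁)) := by
          gcongr
          exact H₀ x
      _ = _ := by ring
  have hS1 : S ^ δ₁ * S ^ (1 / 2 : ℝ) = S ^ (1 / 2 + δ₁) := by
    rw [← ENNReal.rpow_add_of_nonneg _ _ hδ₁.le (by norm_num), add_comm]
  calc ∑' p : NzPair, y p * quadForm a (fun x => b p x * jb x ^ (-(1 / 2) : ℝ))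
        (fun x => c p x * jb x ^ (-(1 / 2) : ℝ)) (fun x => e p x * jb x ^ (-(1 / 2 - δ))) (N p)
      ≤ ∑' p : NzPair, ∫⁻ x, a x *
          (y p * (C₁ * jb (N p - x) ^ (-((1 - δ - δ₁) / 2)) * Y p x ^ (1 / 2 : ℝ))) := by
        refine ENNReal.tsum_le_tsum fun p => ?_
        have hm : Measurable fun x => C₁ * jb (N p - x) ^ (-((1 - δ - δ₁) / 2)) *
            Y p x ^ (1 / 2 : ℝ) :=
          (((measurable_jb_rpow _).comp (hmN p)).const_mul _).mul ((hYm p).pow_const _)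
        calc _ ≤ y p * ∫⁻ x, a x * (C₁ * jb (N p - x) ^ (-((1 - δ - δ₁) / 2)) *
                  Y p x ^ (1 / 2 : ℝ)) := by
              rw [quadForm_eq]
              refine mul_le_mul_right (lintegral_mono fun x => mul_le_mul_right ?_ _) _
              exact H₁ (b p) (c p) (e p) (hb p) (hc p) (he p) (N p - x)
          _ = _ := by
              rw [← lintegral_const_mul (f := fun x => a x * (C₁ * jb (N p - x) ^ (-((1 - δ - δ₁) / 2)) *
                  Y p x ^ (1 / 2 : ℝ))) _ (ha.mul hm)]
              refine lintegral_congr fun x => by ring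
    _ = ∫⁻ x, a x * ∑' p : NzPair,
          (y p * (C₁ * jb (N p - x) ^ (-((1 - δ - δ₁) / 2)) * Y p x ^ (1 / 2 : ℝ))) := by
        rw [← lintegral_tsum]
        · refine lintegral_congr fun x => ENNReal.tsum_mul_left
        · intro p
          exact (ha.mul (((((measurable_jb_rpow _).comp (hmN p)).const_mul _).mul
            ((hYm p).pow_const _)).const_mul _)).aemeasurable
    _ ≤ ∫⁻ x, C₁ * C₀ ^ (1 / 2 - δ₁) * S ^ δ₁ *
          ((a x ^ (2 : ℝ)) ^ (1 / 2 : ℝ) * (∑' p, w p ^ t * Y p x) ^ (1 / 2 : ℝ)) := by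
        refine lintegral_mono fun x => ?_
        calc _ ≤ a x * (C₁ * C₀ ^ (1 / 2 - δ₁) * S ^ δ₁ *
                (∑' p, w p ^ t * Y p x) ^ (1 / 2 : ℝ)) := mul_le_mul_right (hpt x) _
          _ = _ := by
            rw [← ENNReal.rpow_mul]
            norm_num
            ring
    _ = C₁ * C₀ ^ (1 / 2 - δ₁) * S ^ δ₁ * ∫⁻ x,
          ((a x ^ (2 : ℝ)) ^ (1 / 2 : ℝ) * (∑' p, w p ^ t * Y p x) ^ (1 / 2 : ℝ)) :=
        lintegral_const_mul _ (((ha.pow_const _).pow_const _).mul (hsum_m.pow_const _))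
    -- Cauchy–Schwarz in x; the second integral is at most S because every Y p has mass at most one.
    _ ≤ C₁ * C₀ ^ (1 / 2 - δ₁) * S ^ δ₁ * (1 ^ (1 / 2 : ℝ) * S ^ (1 / 2 : ℝ)) := by
        gcongr
        refine (ENNReal.lintegral_mul_norm_pow_le (p := 1 / 2) (q := 1 / 2)
          (ha.pow_const _).aemeasurable hsum_m.aemeasurable (by norm_num) (by norm_num)
          (by norm_num)).trans ?_
        gcongr
        rw [lintegral_tsum fun p => ((hYm p).const_mul _).aemeasurable]
        refine ENNReal.tsum_le_tsum fun p => ?_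
        rw [lintegral_const_mul _ (hYm p)]
        exact mul_le_of_le_one_right' (hY1 p)
    _ = _ := by rw [ENNReal.one_rpow, one_mul, mul_assoc, hS1]

section

/-! ### Summation over the frequencies -/

lemma tsum_five_rpow_mul_le {ι : Type*} (f₁ f₂ f₃ f₄ f₅ : ι → ℝ≥0∞) {a b c d e : ℝ}
    (ha : 0 ≤ a) (hb : 0 ≤ b) (hc : 0 ≤ c) (hd : 0 ≤ d) (he : 0 ≤ e)
    (h : a + b + c + d + e = 1) :
    ∑' i, f₁ i ^ a * f₂ i ^ b * f₃ i ^ c * f₄ i ^ d * f₅ i ^ e ≤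
      (∑' i, f₁ i) ^ a * (∑' i, f₂ i) ^ b * (∑' i, f₃ i) ^ c * (∑' i, f₄ i) ^ d *
        (∑' i, f₅ i) ^ e := by
  have := tsum_prod_rpow_le Finset.univ ![f₁, f₂, f₃, f₄, f₅] (p := ![a, b, c, d, e])
    (by simp [Fin.sum_univ_succ, ← h, add_assoc])
    (by intro k _; fin_cases k <;> simp [ha, hb, hc, hd, he])
  simpa [Fin.prod_univ_succ, mul_assoc] using this

/-- By injectivity the sum is a subsum of the product of two independent sums. -/
lemma tsum_pair_mul_le {P : Type*} (f g : P → ℤ) (h : Function.Injective fun p => (f p, g p))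
    (F G : ℤ → ℝ≥0∞) :
    ∑' p, F (f p) * G (g p) ≤ (∑' n, F n) * ∑' n, G n := by
  calc _ ≤ ∑' z : ℤ × ℤ, F z.1 * G z.2 :=
        ENNReal.tsum_comp_le_tsum_of_injective h (fun z : ℤ × ℤ => F z.1 * G z.2)
    _ = _ := by
        rw [ENNReal.tsum_prod']
        simp_rw [ENNReal.tsum_mul_left, ENNReal.tsum_mul_right]

/-- Three linear forms that determine (u, p) may be summed independently. This is how every
frequency sum over all three variables is closed. -/
lemma tsum_triple_mul_le {P : Type*} (f g k : ℤ → P → ℤ)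
    (h : Function.Injective fun z : ℤ × P => (f z.1 z.2, g z.1 z.2, k z.1 z.2))
    (F G K : ℤ → ℝ≥0∞) :
    ∑' u, ∑' p, F (f u p) * G (g u p) * K (k u p) ≤ (∑' n, F n) * (∑' n, G n) * ∑' n, K n := by
  calc _ = ∑' z : ℤ × P, F (f z.1 z.2) * G (g z.1 z.2) * K (k z.1 z.2) :=
        (ENNReal.tsum_prod' (f := fun z : ℤ × P =>
          F (f z.1 z.2) * G (g z.1 z.2) * K (k z.1 z.2))).symm
    _ ≤ ∑' z : ℤ × ℤ × ℤ, F z.1 * G z.2.1 * K z.2.2 :=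
        ENNReal.tsum_comp_le_tsum_of_injective h
          (fun z : ℤ × ℤ × ℤ => F z.1 * G z.2.1 * K z.2.2)
    _ = _ := by
        rw [ENNReal.tsum_prod']
        simp_rw [ENNReal.tsum_prod', ENNReal.tsum_mul_left, ENNReal.tsum_mul_right, mul_assoc,
          ENNReal.tsum_mul_left, ENNReal.tsum_mul_right]
        simp only [mul_assoc]

/-- Row sums of an `ℓ^Q`-sequence against a power of the bracket. -/
lemma exists_tsum_jb_mul_rpow_le {Q t θ : ℝ} (ht : 0 < t) (hQ : t < Q)
    (h : 1 / t < θ + 1 / Q) :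
    ∃ C : ℝ≥0∞, C ≠ ∞ ∧ ∀ A : ℤ → ℝ≥0∞, ∑' n, A n ^ Q ≤ 1 → ∀ x : ℝ,
      ∑' n : ℤ, (jb (x - n) ^ (-θ) * A n) ^ t ≤ C := by
  have hQ0 : 0 < Q := ht.trans hQ
  have h1 : 0 < 1 - t / Q := by rw [sub_pos, div_lt_one hQ0]; exact hQ
  -- Hölder with exponents 1 - t/Q and t/Q leaves this power of the bracket; its summability is the
  -- hypothesis 1/t < θ + 1/Q.
  have h2 : 1 < θ * t / (1 - t / Q) := by
    rw [lt_div_iff₀ h1]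
    have := mul_lt_mul_of_pos_left h ht
    rw [mul_one_div_cancel ht.ne'] at this
    have e : t * (1 / Q) = t / Q := by ring
    nlinarith
  obtain ⟨C, hC, H⟩ := exists_tsum_jb_sub_le h2
  refine ⟨C ^ (1 - t / Q), ENNReal.rpow_ne_top_of_nonneg h1.le hC, fun A hA x => ?_⟩
  calc ∑' n : ℤ, (jb (x - n) ^ (-θ) * A n) ^ t
      = ∑' n : ℤ, (jb (x - n) ^ (-(θ * t / (1 - t / Q)))) ^ (1 - t / Q) * (A n ^ Q) ^ (t / Q) := by
        refine tsum_congr fun n => ?_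
        rw [ENNReal.mul_rpow_of_nonneg _ _ ht.le, ← ENNReal.rpow_mul, ← ENNReal.rpow_mul,
          ← ENNReal.rpow_mul, neg_mul, neg_mul, div_mul_cancel₀ _ h1.ne', mul_div_cancel₀ _ hQ0.ne']
    _ ≤ (∑' n : ℤ, jb (x - n) ^ (-(θ * t / (1 - t / Q)))) ^ (1 - t / Q) *
          (∑' n : ℤ, A n ^ Q) ^ (t / Q) :=
        tsum_rpow_mul_le _ _ h1.le (by positivity) (by ring)
    _ ≤ C ^ (1 - t / Q) * 1 ^ (t / Q) := by gcongr; exact H x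
    _ = _ := by simp

/-- A Schur test. -/
lemma tsum_mul_tsum_rpow_le {ι P : Type*} {t ρ ρ' : ℝ} (ht : 0 < t) (htρ : t ≤ ρ)
    (hρ : 1 / ρ + 1 / ρ' = 1) (hρ' : 0 < ρ') {C : ℝ≥0∞}
    (m D : ι → P → ℝ≥0∞) (E : ι → ℝ≥0∞) (hm : ∀ u, ∑' p, m u p ≤ C)
    (hD : ∑' u, ∑' p, m u p * D u p ^ ρ ≤ C) (hE : ∑' u, E u ^ ρ' ≤ 1) :
    ∑' u, E u * (∑' p, m u p * D u p ^ t) ^ (1 / t) ≤ C ^ (1 / t) := by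
  have hρ0 : 0 < ρ := ht.trans_le htρ
  have h1 : t / ρ ≤ 1 := (div_le_one hρ0).2 htρ
  have h2 : 0 ≤ 1 / t - 1 / ρ := sub_nonneg.2 (one_div_le_one_div_of_le ht htρ)
  -- For fixed u, m u is a measure of mass at most C, so the L^t norm of D is bounded by its L^ρ
  -- norm times C^{1/t-1/ρ}.
  have hin : ∀ u, (∑' p, m u p * D u p ^ t) ^ (1 / t) ≤
      (∑' p, m u p * D u p ^ ρ) ^ (1 / ρ) * C ^ (1 / t - 1 / ρ) := by
    intro u
    calc (∑' p, m u p * D u p ^ t) ^ (1 / t)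
        = (∑' p, (m u p * D u p ^ ρ) ^ (t / ρ) * m u p ^ (1 - t / ρ)) ^ (1 / t) := by
          congr 1
          refine tsum_congr fun p => ?_
          rw [ENNReal.mul_rpow_of_nonneg _ _ (by positivity), ← ENNReal.rpow_mul,
            mul_div_cancel₀ _ hρ0.ne', mul_right_comm,
            ← ENNReal.rpow_add_of_nonneg _ _ (by positivity) (by linarith)]
          simp
      _ ≤ ((∑' p, m u p * D u p ^ ρ) ^ (t / ρ) * C ^ (1 - t / ρ)) ^ (1 / t) := by
          gcongr
          refine (tsum_rpow_mul_le _ _ (by positivity) (by linarith) (by ring)).trans ?_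
          gcongr
          exact hm u
      _ = _ := by
          rw [ENNReal.mul_rpow_of_nonneg _ _ (by positivity), ← ENNReal.rpow_mul,
            ← ENNReal.rpow_mul]
          congr 2 <;> field_simp
  calc ∑' u, E u * (∑' p, m u p * D u p ^ t) ^ (1 / t)
      ≤ ∑' u, C ^ (1 / t - 1 / ρ) *
          ((E u ^ ρ') ^ (1 / ρ') * (∑' p, m u p * D u p ^ ρ) ^ (1 / ρ)) := by
        refine ENNReal.tsum_le_tsum fun u => ?_
        rw [← ENNReal.rpow_mul, mul_one_div_cancel hρ'.ne', ENNReal.rpow_one]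
        calc _ ≤ E u * ((∑' p, m u p * D u p ^ ρ) ^ (1 / ρ) * C ^ (1 / t - 1 / ρ)) :=
              mul_le_mul_right (hin u) _
          _ = _ := by ring
    _ ≤ C ^ (1 / t - 1 / ρ) * (1 ^ (1 / ρ') * C ^ (1 / ρ)) := by
        rw [ENNReal.tsum_mul_left]
        gcongr
        refine (tsum_rpow_mul_le _ _ (by positivity) (by positivity) (by linarith)).trans ?_
        gcongr
    _ = C ^ (1 / t) := by
        rw [ENNReal.one_rpow, one_mul, ← ENNReal.rpow_add_of_nonneg _ _ h2 (by positivity)]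
        congr 1; ring

/-- The exponents of the trilinear estimate: `Q = q'`, `R = r'`, the exponent `t` of the almost
orthogonality estimate, and the exponents `θ' < θ ≤ 1/2` of the remaining frequency weights. -/
structure Exponents (q Q r R t θ θ' : ℝ) : Prop where
  hq : 1 / q + 1 / Q = 1
  hr : 1 / r + 1 / R = 1
  one_lt_t : 1 < t
  t_lt_two : t < 2
  t_lt_q : t ≤ q
  q_le_r : q ≤ r
  hQ : 2 ≤ Q
  hR : 2 ≤ R
  theta_lt : θ' < θ
  theta_le : θ ≤ 1 / 2
  ht : 1 / t ≤ 1 / Q + 2 * θ' - 1 / 2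
  htheta : 1 / q + 1 / 2 - 1 / R ≤ 2 * θ'

namespace Exponents

variable {q Q r R t θ θ' : ℝ} (X : Exponents q Q r R t θ θ')
include X

lemma t_pos : 0 < t := one_pos.trans X.one_lt_t
lemma q_pos : 0 < q := X.t_pos.trans_le X.t_lt_q
lemma r_pos : 0 < r := X.q_pos.trans_le X.q_le_r
lemma Q_pos : 0 < Q := two_pos.trans_le X.hQ
lemma R_pos : 0 < R := two_pos.trans_le X.hR
lemma t_lt_Q : t < Q := X.t_lt_two.trans_le X.hQ

/-- Because 2θ' - 1/2 < θ, by θ' < θ ≤ 1/2. This is the row condition for the Schur tests. -/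
lemma one_div_t_lt : 1 / t < θ + 1 / Q := by
  linarith [X.ht, X.theta_lt, X.theta_le]

end Exponents

variable {q Q r R t θ θ' : ℝ}

lemma neg_injective_rpow_sum {A : ℤ → ℝ≥0∞} {s : ℝ} :
    ∑' n, A (-n) ^ s = ∑' n, A n ^ s :=
  (Equiv.neg ℤ).tsum_eq (fun n => A n ^ s)

/-- Frequency sum: elimination of the modulation of the output or of the conjugated factor, with
the weight `⟨ξ - ξ₁⟩^{-θ}⟨ξ - ξ₂⟩^{-θ}`. -/
lemma Exponents.exists_front_diff (X : Exponents q Q r R t θ θ') :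
    ∃ C : ℝ≥0∞, C ≠ ∞ ∧ ∀ (ρ ρ' : ℝ), t ≤ ρ → 1 / ρ + 1 / ρ' = 1 → 0 < ρ' →
      ∀ E a b D : ℤ → ℝ≥0∞, ∑' n, E n ^ ρ' ≤ 1 → ∑' n, a n ^ Q ≤ 1 → ∑' n, b n ^ Q ≤ 1 →
      ∑' n, D n ^ ρ ≤ 1 →
      ∑' u, E u * (∑' p : ℤ × ℤ, (jb p.1 ^ (-θ) * jb p.2 ^ (-θ) *
        (a (u - p.1) * b (u - p.2) * D (p.1 + p.2 - u))) ^ t) ^ (1 / t) ≤ C := by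
  obtain ⟨C, hC, H⟩ := exists_tsum_jb_mul_rpow_le X.t_pos X.t_lt_Q X.one_div_t_lt
  refine ⟨(C * C) ^ (1 / t), ENNReal.rpow_ne_top_of_nonneg (by have := X.t_pos; positivity)
    (by finiteness), fun ρ ρ' hρt hρ hρ' E a b D hE ha hb hD => ?_⟩
  have ht := X.t_pos
  have row : ∀ (a : ℤ → ℝ≥0∞), ∑' n, a n ^ Q ≤ 1 → ∀ u : ℤ,
      ∑' d : ℤ, (jb d ^ (-θ) * a (u - d)) ^ t ≤ C := by
    intro a ha u
    rw [← (Equiv.subLeft u).tsum_eq]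
    refine le_trans (le_of_eq (tsum_congr fun n => ?_)) (H a ha u)
    simp
  have row' : ∀ (a : ℤ → ℝ≥0∞), ∑' n, a n ^ Q ≤ 1 → ∀ u : ℤ,
      ∑' n : ℤ, (jb (n + u : ℤ) ^ (-θ) * a n) ^ t ≤ C := by
    intro a ha u
    refine le_trans (le_of_eq (tsum_congr fun n => ?_)) (H a ha (-u))
    rw [← jb_neg]; push_cast; ring_nf
  -- The kernel consists of the two weights with a and b. Its rows have u fixed; its columns have
  -- the argument d + e - u of D fixed.
  have key := tsum_mul_tsum_rpow_le (ι := ℤ) (P := ℤ × ℤ) (C := C * C) ht hρt hρ hρ'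
    (fun u p => (jb p.1 ^ (-θ) * a (u - p.1)) ^ t * (jb p.2 ^ (-θ) * b (u - p.2)) ^ t)
    (fun u p => D (p.1 + p.2 - u)) E ?_ ?_ hE
  · refine le_trans (le_of_eq (tsum_congr fun u => ?_)) key
    congr 2
    refine tsum_congr fun p => ?_
    rw [← ENNReal.mul_rpow_of_nonneg _ _ ht.le, ← ENNReal.mul_rpow_of_nonneg _ _ ht.le]
    ring_nf
  · intro u
    rw [ENNReal.tsum_prod']
    simp_rw [ENNReal.tsum_mul_left, ENNReal.tsum_mul_right]
    gcongr
    · exact row a ha u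
    · exact row b hb u
  · calc ∑' u : ℤ, ∑' p : ℤ × ℤ, (jb p.1 ^ (-θ) * a (u - p.1)) ^ t *
          (jb p.2 ^ (-θ) * b (u - p.2)) ^ t * D (p.1 + p.2 - u) ^ ρ
        = ∑' z : ℤ × ℤ × ℤ, (jb z.2.1 ^ (-θ) * a (z.1 - z.2.1)) ^ t *
          (jb z.2.2 ^ (-θ) * b (z.1 - z.2.2)) ^ t * D (z.2.1 + z.2.2 - z.1) ^ ρ :=
          (ENNReal.tsum_prod' (f := fun z : ℤ × ℤ × ℤ => (jb z.2.1 ^ (-θ) * a (z.1 - z.2.1)) ^ t *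
          (jb z.2.2 ^ (-θ) * b (z.1 - z.2.2)) ^ t * D (z.2.1 + z.2.2 - z.1) ^ ρ)).symm
      _ ≤ ∑' w : ℤ × ℤ × ℤ, (jb (w.2.2 + w.1 : ℤ) ^ (-θ) * a w.2.1) ^ t *
          (jb (w.2.1 + w.1 : ℤ) ^ (-θ) * b w.2.2) ^ t * D w.1 ^ ρ := by
          refine le_trans (le_of_eq ?_) (ENNReal.tsum_comp_le_tsum_of_injective
            (f := fun z : ℤ × ℤ × ℤ => (z.2.1 + z.2.2 - z.1, z.1 - z.2.1, z.1 - z.2.2)) ?_ _)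
          · refine tsum_congr fun z => ?_
            simp only
            rw [show z.1 - z.2.2 + (z.2.1 + z.2.2 - z.1) = z.2.1 by ring,
              show z.1 - z.2.1 + (z.2.1 + z.2.2 - z.1) = z.2.2 by ring]
          · rintro ⟨u, d, e⟩ ⟨u', d', e'⟩ h
            simp only [Prod.mk.injEq] at h ⊢
            omega
      _ = ∑' w, D w ^ ρ * ∑' x : ℤ × ℤ, (jb (x.2 + w : ℤ) ^ (-θ) * a x.1) ^ t *
          (jb (x.1 + w : ℤ) ^ (-θ) * b x.2) ^ t := by
          rw [ENNReal.tsum_prod']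
          refine tsum_congr fun w => ?_
          rw [← ENNReal.tsum_mul_left]
          refine tsum_congr fun x => by ring
      -- For fixed w the weight on d depends on the argument of b and the weight on e on that of a.
      -- Exchanging the weights makes the double sum a product of two row sums.
      _ = ∑' w, D w ^ ρ * ∑' x : ℤ × ℤ, (jb (x.1 + w : ℤ) ^ (-θ) * a x.1) ^ t *
          (jb (x.2 + w : ℤ) ^ (-θ) * b x.2) ^ t := by
          refine tsum_congr fun w => ?_
          congr 1
          refine tsum_congr fun x => ?_
          simp only [ENNReal.mul_rpow_of_nonneg _ _ ht.le]
          ring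
      _ ≤ ∑' w, D w ^ ρ * (C * C) := by
          refine ENNReal.tsum_le_tsum fun w => mul_le_mul_right ?_ _
          rw [ENNReal.tsum_prod']
          simp_rw [ENNReal.tsum_mul_left, ENNReal.tsum_mul_right]
          gcongr
          · exact row' a ha w
          · exact row' b hb w
      _ ≤ 1 * (C * C) := by
          rw [ENNReal.tsum_mul_right]
          gcongr
      _ = _ := one_mul _

/-- Frequency sum: elimination of the modulation of the output or of the conjugated factor, with
the weight `⟨ξ₁⟩^{-θ}⟨ξ₂⟩^{-θ}`. -/
lemma Exponents.exists_front_freq (X : Exponents q Q r R t θ θ') :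
    ∃ C : ℝ≥0∞, C ≠ ∞ ∧ ∀ (ρ ρ' : ℝ), t ≤ ρ → 1 / ρ + 1 / ρ' = 1 → 0 < ρ' →
      ∀ E a b D : ℤ → ℝ≥0∞, ∑' n, E n ^ ρ' ≤ 1 → ∑' n, a n ^ Q ≤ 1 → ∑' n, b n ^ Q ≤ 1 →
      ∑' n, D n ^ ρ ≤ 1 →
      ∑' u, E u * (∑' p : ℤ × ℤ, (jb (u - p.1 : ℤ) ^ (-θ) * jb (u - p.2 : ℤ) ^ (-θ) *
        (a (u - p.1) * b (u - p.2) * D (p.1 + p.2 - u))) ^ t) ^ (1 / t) ≤ C := by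
  obtain ⟨C, hC, H⟩ := exists_tsum_jb_mul_rpow_le X.t_pos X.t_lt_Q X.one_div_t_lt
  refine ⟨(C * C) ^ (1 / t), ENNReal.rpow_ne_top_of_nonneg (by have := X.t_pos; positivity)
    (by finiteness), fun ρ ρ' hρt hρ hρ' E a b D hE ha hb hD => ?_⟩
  have ht := X.t_pos
  have row : ∀ (a : ℤ → ℝ≥0∞), ∑' n, a n ^ Q ≤ 1 →
      ∑' d : ℤ, (jb d ^ (-θ) * a d) ^ t ≤ C := by
    intro a ha
    refine le_trans (le_of_eq (tsum_congr fun n => ?_)) (H a ha 0)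
    rw [← jb_neg]; simp
  -- Here each weight sits on the argument of its own sequence, so the kernel is a product of two
  -- summable sequences of independent variables.
  have key := tsum_mul_tsum_rpow_le (ι := ℤ) (P := ℤ × ℤ) (C := C * C) ht hρt hρ hρ'
    (fun u p => (jb (u - p.1 : ℤ) ^ (-θ) * a (u - p.1)) ^ t *
      (jb (u - p.2 : ℤ) ^ (-θ) * b (u - p.2)) ^ t)
    (fun u p => D (p.1 + p.2 - u)) E ?_ ?_ hE
  · refine le_trans (le_of_eq (tsum_congr fun u => ?_)) key
    congr 2
    refine tsum_congr fun p => ?_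
    rw [← ENNReal.mul_rpow_of_nonneg _ _ ht.le, ← ENNReal.mul_rpow_of_nonneg _ _ ht.le]
    ring_nf
  · intro u
    refine (tsum_pair_mul_le (P := ℤ × ℤ) (fun p => u - p.1) (fun p => u - p.2) ?_
      (fun n => (jb n ^ (-θ) * a n) ^ t) (fun n => (jb n ^ (-θ) * b n) ^ t)).trans ?_
    · rintro ⟨d, e⟩ ⟨d', e'⟩ h
      simp only [Prod.mk.injEq] at h ⊢
      omega
    · gcongr
      · exact row a ha
      · exact row b hb
  · refine (tsum_triple_mul_le (P := ℤ × ℤ) (fun u p => u - p.1) (fun u p => u - p.2)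
      (fun u p => p.1 + p.2 - u) ?_
      (fun n => (jb n ^ (-θ) * a n) ^ t) (fun n => (jb n ^ (-θ) * b n) ^ t)
      (fun n => D n ^ ρ)).trans ?_
    · rintro ⟨u, d, e⟩ ⟨u', d', e'⟩ h
      simp only [Prod.mk.injEq] at h ⊢
      omega
    · calc _ ≤ C * C * 1 := by
            gcongr
            · exact row a ha
            · exact row b hb
        _ = C * C := mul_one _

/-- Frequency sum: elimination of the modulation of one of the first two factors, with the weight
`⟨ξ₁⟩^{-θ}⟨ξ₂⟩^{-θ}`. -/
lemma Exponents.exists_side_freq (X : Exponents q Q r R t θ θ') :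
    ∃ C : ℝ≥0∞, C ≠ ∞ ∧ ∀ E a A₀ A₃ : ℤ → ℝ≥0∞, ∑' n, E n ^ Q ≤ 1 → ∑' n, a n ^ Q ≤ 1 →
      ∑' n, A₀ n ^ r ≤ 1 → ∑' n, A₃ n ^ R ≤ 1 →
      ∑' u, E u * (∑' p : ℤ × ℤ, (jb u ^ (-θ) * jb (u + p.1 - p.2 : ℤ) ^ (-θ) *
        (A₀ (u + p.1) * a (u + p.1 - p.2) * A₃ (p.2 - u))) ^ t) ^ (1 / t) ≤ C := by
  obtain ⟨C, hC, H⟩ := exists_tsum_jb_mul_rpow_le X.t_pos X.t_lt_Q X.one_div_t_lt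
  have ht := X.t_pos
  have hr := X.r_pos
  have hR := X.R_pos
  have h1t := X.one_lt_t
  have htr : t ≤ r := X.t_lt_q.trans X.q_le_r
  have hx : 0 ≤ t - 1 := by linarith
  have hy : 0 ≤ 1 - t / R := by
    rw [sub_nonneg, div_le_one hR]; linarith [X.t_lt_two, X.hR]
  have hz : 0 ≤ 1 - t / r := by rw [sub_nonneg, div_le_one hr]; exact htr
  have hxyz : t - 1 + (1 - t / R) + (1 - t / r) = 1 := by
    have : t * (1 / r + 1 / R) = t := by rw [X.hr, mul_one]
    have e1 : t / R = t * (1 / R) := by ring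
    have e2 : t / r = t * (1 / r) := by ring
    rw [e1, e2]; linarith
  have ex0 : r * (t - 1) + r * (1 - t / R) = t := by
    have e1 : r * t * (1 / r + 1 / R) = r * t := by rw [X.hr, mul_one]
    have e2 : r * t * (1 / r + 1 / R) = t + r * (t / R) := by field_simp
    linarith
  have ex3 : R * (t - 1) + R * (1 - t / r) = t := by
    have e1 : R * t * (1 / r + 1 / R) = R * t := by rw [X.hr, mul_one]
    have e2 : R * t * (1 / r + 1 / R) = t + R * (t / r) := by field_simp; ring
    linarith
  have row : ∀ (a : ℤ → ℝ≥0∞), ∑' n, a n ^ Q ≤ 1 →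
      ∑' d : ℤ, (jb d ^ (-θ) * a d) ^ t ≤ C := by
    intro a ha
    refine le_trans (le_of_eq (tsum_congr fun n => ?_)) (H a ha 0)
    rw [← jb_neg]; simp
  have hpow : 0 ≤ 1 - 1 / t := by
    rw [sub_nonneg, div_le_one ht]; exact h1t.le
  refine ⟨C ^ (1 / t) * C ^ (1 - 1 / t) * ((C ^ (1 - t / R)) ^ (1 / t) * (C ^ (1 - t / r)) ^ (1 / t)),
    by finiteness, fun E a A₀ A₃ hE ha hA₀ hA₃ => ?_⟩
  set b : ℤ → ℝ≥0∞ := fun n => (jb n ^ (-θ) * a n) ^ t with hb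
  have hbC : ∑' n, b n ≤ C := row a ha
  set m : ℤ → ℝ≥0∞ := fun u => ∑' p : ℤ × ℤ,
    b (u + p.1 - p.2) * A₀ (u + p.1) ^ r * A₃ (p.2 - u) ^ R with hm
  have hmC : ∑' u, m u ≤ C := by
    refine (tsum_triple_mul_le (P := ℤ × ℤ) (fun u p => u + p.1 - p.2) (fun u p => u + p.1)
      (fun u p => p.2 - u) ?_ b (fun n => A₀ n ^ r) (fun n => A₃ n ^ R)).trans ?_
    · rintro ⟨u, d, e⟩ ⟨u', d', e'⟩ h
      simp only [Prod.mk.injEq] at h ⊢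
      omega
    · calc _ ≤ C * 1 * 1 := by gcongr
        _ = C := by simp
  have hin : ∀ u : ℤ, (∑' p : ℤ × ℤ, (jb u ^ (-θ) * jb (u + p.1 - p.2 : ℤ) ^ (-θ) *
        (A₀ (u + p.1) * a (u + p.1 - p.2) * A₃ (p.2 - u))) ^ t) ^ (1 / t) ≤
      jb u ^ (-θ) * (m u ^ (1 - 1 / t) *
        ((C ^ (1 - t / R)) ^ (1 / t) * (C ^ (1 - t / r)) ^ (1 / t))) := by
    intro u
    -- With b summable, the Hölder exponents t - 1, 1 - t/R, 1 - t/r add up to one by duality of r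
    -- and R. The last two sums over p are bounded for each u; the first one is m, which is summable
    -- in u.
    have e1 : ∀ p : ℤ × ℤ, (jb u ^ (-θ) * jb (u + p.1 - p.2 : ℤ) ^ (-θ) *
        (A₀ (u + p.1) * a (u + p.1 - p.2) * A₃ (p.2 - u))) ^ t =
        (jb u ^ (-θ)) ^ t * ((b (u + p.1 - p.2) * A₀ (u + p.1) ^ r * A₃ (p.2 - u) ^ R) ^ (t - 1) *
          (b (u + p.1 - p.2) * A₀ (u + p.1) ^ r) ^ (1 - t / R) *
          (b (u + p.1 - p.2) * A₃ (p.2 - u) ^ R) ^ (1 - t / r)) := by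
      intro p
      have f0 : A₀ (u + p.1) ^ t = (A₀ (u + p.1) ^ r) ^ (t - 1) *
          (A₀ (u + p.1) ^ r) ^ (1 - t / R) := by
        rw [← ENNReal.rpow_mul, ← ENNReal.rpow_mul,
          ← ENNReal.rpow_add_of_nonneg _ _ (by positivity) (by positivity), ex0]
      have f3 : A₃ (p.2 - u) ^ t = (A₃ (p.2 - u) ^ R) ^ (t - 1) *
          (A₃ (p.2 - u) ^ R) ^ (1 - t / r) := by
        rw [← ENNReal.rpow_mul, ← ENNReal.rpow_mul,
          ← ENNReal.rpow_add_of_nonneg _ _ (by positivity) (by positivity), ex3]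
      have fb : (jb (u + p.1 - p.2 : ℤ) ^ (-θ) * a (u + p.1 - p.2)) ^ t =
          b (u + p.1 - p.2) ^ (t - 1) * b (u + p.1 - p.2) ^ (1 - t / R) *
          b (u + p.1 - p.2) ^ (1 - t / r) := by
        rw [← ENNReal.rpow_add_of_nonneg _ _ hx hy,
          ← ENNReal.rpow_add_of_nonneg _ _ (by linarith) hz, hxyz, ENNReal.rpow_one]
      calc _ = (jb u ^ (-θ)) ^ t * ((jb (u + p.1 - p.2 : ℤ) ^ (-θ) * a (u + p.1 - p.2)) ^ t *
              A₀ (u + p.1) ^ t * A₃ (p.2 - u) ^ t) := by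
            simp only [ENNReal.mul_rpow_of_nonneg _ _ ht.le]; ring
        _ = _ := by
            rw [f0, f3, fb]
            simp only [ENNReal.mul_rpow_of_nonneg _ _ hx, ENNReal.mul_rpow_of_nonneg _ _ hy,
              ENNReal.mul_rpow_of_nonneg _ _ hz]
            ring
    simp_rw [e1]
    rw [ENNReal.tsum_mul_left, ENNReal.mul_rpow_of_nonneg _ _ (by positivity), ← ENNReal.rpow_mul,
      mul_one_div_cancel ht.ne', ENNReal.rpow_one]
    refine mul_le_mul_right ?_ _
    calc _ ≤ (m u ^ (t - 1) * C ^ (1 - t / R) * C ^ (1 - t / r)) ^ (1 / t) := by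
          gcongr
          refine (tsum_rpow_mul_mul_le _ _ _ hx hy hz hxyz).trans ?_
          gcongr
          · refine (tsum_pair_mul_le (P := ℤ × ℤ) (fun p => u + p.1 - p.2) (fun p => u + p.1) ?_
              b (fun n => A₀ n ^ r)).trans ?_
            · rintro ⟨d, e⟩ ⟨d', e'⟩ h
              simp only [Prod.mk.injEq] at h ⊢
              omega
            · calc _ ≤ C * 1 := by gcongr
                _ = C := mul_one _
          · refine (tsum_pair_mul_le (P := ℤ × ℤ) (fun p => u + p.1 - p.2) (fun p => p.2 - u) ?_
              b (fun n => A₃ n ^ R)).trans ?_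
            · rintro ⟨d, e⟩ ⟨d', e'⟩ h
              simp only [Prod.mk.injEq] at h ⊢
              omega
            · calc _ ≤ C * 1 := by gcongr
                _ = C := mul_one _
      _ = _ := by
          rw [ENNReal.mul_rpow_of_nonneg _ _ (by positivity),
            ENNReal.mul_rpow_of_nonneg _ _ (by positivity), ← ENNReal.rpow_mul (m u), mul_assoc]
          congr 2
          field_simp
  -- Outer Hölder: the weighted sequence E is in ℓ^t, and the power of m is in the dual space.
  calc _ ≤ ∑' u : ℤ, (((jb u ^ (-θ) * E u) ^ t) ^ (1 / t) * m u ^ (1 - 1 / t)) *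
        ((C ^ (1 - t / R)) ^ (1 / t) * (C ^ (1 - t / r)) ^ (1 / t)) := by
        refine ENNReal.tsum_le_tsum fun u => ?_
        refine (mul_le_mul_right (hin u) (E u)).trans (le_of_eq ?_)
        rw [← ENNReal.rpow_mul (jb u ^ (-θ) * E u), mul_one_div_cancel ht.ne', ENNReal.rpow_one]
        ring
    _ ≤ _ := by
        rw [ENNReal.tsum_mul_right]
        gcongr
        refine (tsum_rpow_mul_le _ _ (by positivity) hpow (by ring)).trans ?_
        gcongr
        exact row E hE

/-- A single term is at most the sum. For a sequence bounded by one, the power t may be replaced by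
any smaller power, so that exponent conditions below need only be inequalities. -/
lemma le_one_of_tsum_rpow_le_one {A : ℤ → ℝ≥0∞} {s : ℝ} (hs : 0 < s) (h : ∑' n, A n ^ s ≤ 1)
    (n : ℤ) : A n ≤ 1 := by
  have h1 : A n ^ s ≤ 1 := (ENNReal.le_tsum n).trans h
  by_contra hc
  exact absurd h1 (not_le.2 (ENNReal.one_lt_rpow (not_le.1 hc) hs))

/-- Frequency sum: elimination of the modulation of one of the first two factors, with the weight
`⟨ξ - ξ₁⟩^{-θ}⟨ξ - ξ₂⟩^{-θ}`. -/
lemma Exponents.exists_side_diff (X : Exponents q Q r R t θ θ') :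
    ∃ C : ℝ≥0∞, C ≠ ∞ ∧ ∀ E a A₀ A₃ : ℤ → ℝ≥0∞, ∑' n, E n ^ Q ≤ 1 → ∑' n, a n ^ Q ≤ 1 →
      ∑' n, A₀ n ^ r ≤ 1 → ∑' n, A₃ n ^ R ≤ 1 →
      ∑' u, E u * (∑' p : ℤ × ℤ, (jb p.1 ^ (-θ) * jb p.2 ^ (-θ) *
        (A₀ (u + p.1) * a (u + p.1 - p.2) * A₃ (p.2 - u))) ^ t) ^ (1 / t) ≤ C := by
  have ht := X.t_pos
  have hr := X.r_pos
  have hR := X.R_pos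
  have hq := X.q_pos
  have hQ := X.Q_pos
  have h1t := X.one_lt_t
  have i1 : t * (1 / t) = 1 := mul_one_div_cancel ht.ne'
  have iq : 1 / q ≤ 1 / t := one_div_le_one_div_of_le ht X.t_lt_q
  have iQ : 1 / Q ≤ 1 / 2 := one_div_le_one_div_of_le two_pos X.hQ
  have iR : 1 / R ≤ 1 / 2 := one_div_le_one_div_of_le two_pos X.hR
  have iR0 : 0 < 1 / R := by positivity
  have hc1 := X.hq
  have hc2 := X.hr
  have hθ := X.theta_lt
  have hθ2 := X.theta_le
  have hθ' : 0 < θ' := by linarith [X.ht, X.htheta]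
  -- The gap θ' < θ makes ⟨n⟩^{-θ/θ'} summable, and its power tθ' is the weight ⟨n⟩^{-θt}.
  obtain ⟨C, hC, H⟩ := exists_tsum_jb_sub_le (s := θ / θ') (by rw [lt_div_iff₀ hθ']; linarith)
  have HK : ∑' n : ℤ, jb n ^ (-(θ / θ')) ≤ C := by
    refine le_trans (le_of_eq (tsum_congr fun n => ?_)) (H 0)
    rw [← jb_neg]; simp
  -- the weights of the five spanning trees
  set la : ℝ := 1 - t * (1 / q) with hla
  set x : ℝ := t * (1 / q - θ') with hx
  set c : ℝ := t * (1 / 2 - 1 / R) with hc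
  set b : ℝ := t * (2 * θ' - 1 / 2 - 1 / q + 1 / R) with hb
  -- The constraints: nonnegative weights (b ≥ 0 is `X.htheta`, la ≥ 0 is t ≤ q), total weight one,
  -- at most the power t of each sequence (for A₀ this is exactly `X.ht`), and weight tθ' on each
  -- bracket.
  have la0 : 0 ≤ la := by rw [hla]; nlinarith
  have x0 : 0 ≤ x := mul_nonneg ht.le (by linarith)
  have c0 : 0 ≤ c := mul_nonneg ht.le (by linarith)
  have b0 : 0 ≤ b := mul_nonneg ht.le (by linarith [X.htheta])
  have hsum : la + x + x + c + b = 1 := by rw [hla, hx, hc, hb]; ring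
  have hA0 : r * (la + x + x + c) ≤ t := by
    have h1 : la + x + x + c ≤ t * (1 / r) := by
      rw [hla, hx, hc]
      nlinarith [mul_le_mul_of_nonneg_left X.ht ht.le]
    calc r * (la + x + x + c) ≤ r * (t * (1 / r)) := by gcongr
      _ = t := by field_simp
  have ha2 : Q * (la + x) ≤ t := by
    have h1 : la + x ≤ t * (1 / Q) := by
      rw [hla, hx]
      nlinarith [mul_le_mul_of_nonneg_left X.ht ht.le]
    calc Q * (la + x) ≤ Q * (t * (1 / Q)) := by gcongr
      _ = t := by field_simp
  have hA3 : R * (x + b) ≤ t := by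
    have h1 : x + b ≤ t * (1 / R) := by
      rw [hx, hb]
      nlinarith
    calc R * (x + b) ≤ R * (t * (1 / R)) := by gcongr
      _ = t := by field_simp
  have hK : x + c + b = t * θ' := by rw [hx, hc, hb]; ring
  set S : ℝ≥0∞ := C ^ (x / t) * C ^ (x / t) * (C * C) ^ (c / t) * (C * C) ^ (b / t) with hS
  refine ⟨S, by rw [hS]; finiteness, fun E a A₀ A₃ hE ha hA₀ hA₃ => ?_⟩
  have A0le := le_one_of_tsum_rpow_le_one hr hA₀
  have ale := le_one_of_tsum_rpow_le_one hQ ha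
  have A3le := le_one_of_tsum_rpow_le_one hR hA₃
  set K : ℤ → ℝ≥0∞ := fun n => jb n ^ (-(θ / θ')) with hKdef
  -- Each of these sums contains three summable factors whose arguments determine (u, d, e), so it
  -- is summable in u. The fifth tree, with two factors only, is bounded for every fixed u.
  set m₁ : ℤ → ℝ≥0∞ := fun u => ∑' p : ℤ × ℤ,
    A₀ (u + p.1) ^ r * a (u + p.1 - p.2) ^ Q * K p.1 with hm₁
  set m₂ : ℤ → ℝ≥0∞ := fun u => ∑' p : ℤ × ℤ,
    A₀ (u + p.1) ^ r * A₃ (p.2 - u) ^ R * K p.2 with hm₂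
  set m₃ : ℤ → ℝ≥0∞ := fun u => ∑' p : ℤ × ℤ, A₀ (u + p.1) ^ r * K p.1 * K p.2 with hm₃
  set m₄ : ℤ → ℝ≥0∞ := fun u => ∑' p : ℤ × ℤ, A₃ (p.2 - u) ^ R * K p.1 * K p.2 with hm₄
  have hm₁C : ∑' u, m₁ u ≤ C := by
    refine (tsum_triple_mul_le (P := ℤ × ℤ) (fun u p => u + p.1) (fun u p => u + p.1 - p.2)
      (fun _ p => p.1) ?_ (fun n => A₀ n ^ r) (fun n => a n ^ Q) K).trans ?_
    · rintro ⟨u, d, e⟩ ⟨u', d', e'⟩ h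
      simp only [Prod.mk.injEq] at h ⊢
      omega
    · calc _ ≤ 1 * 1 * C := by gcongr
        _ = C := by simp
  have hm₂C : ∑' u, m₂ u ≤ C := by
    refine (tsum_triple_mul_le (P := ℤ × ℤ) (fun u p => u + p.1) (fun u p => p.2 - u)
      (fun _ p => p.2) ?_ (fun n => A₀ n ^ r) (fun n => A₃ n ^ R) K).trans ?_
    · rintro ⟨u, d, e⟩ ⟨u', d', e'⟩ h
      simp only [Prod.mk.injEq] at h ⊢
      omega
    · calc _ ≤ 1 * 1 * C := by gcongr
        _ = C := by simp
  have hm₃C : ∑' u, m₃ u ≤ C * C := by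
    refine (tsum_triple_mul_le (P := ℤ × ℤ) (fun u p => u + p.1) (fun _ p => p.1)
      (fun _ p => p.2) ?_ (fun n => A₀ n ^ r) K K).trans ?_
    · rintro ⟨u, d, e⟩ ⟨u', d', e'⟩ h
      simp only [Prod.mk.injEq] at h ⊢
      omega
    · calc _ ≤ 1 * C * C := by gcongr
        _ = C * C := by simp
  have hm₄C : ∑' u, m₄ u ≤ C * C := by
    refine (tsum_triple_mul_le (P := ℤ × ℤ) (fun u p => p.2 - u) (fun _ p => p.1)
      (fun _ p => p.2) ?_ (fun n => A₃ n ^ R) K K).trans ?_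
    · rintro ⟨u, d, e⟩ ⟨u', d', e'⟩ h
      simp only [Prod.mk.injEq] at h ⊢
      omega
    · calc _ ≤ 1 * C * C := by gcongr
        _ = C * C := by simp
  have hin : ∀ u : ℤ, (∑' p : ℤ × ℤ, (jb p.1 ^ (-θ) * jb p.2 ^ (-θ) *
        (A₀ (u + p.1) * a (u + p.1 - p.2) * A₃ (p.2 - u))) ^ t) ^ (1 / t) ≤
      m₁ u ^ (x / t) * m₂ u ^ (x / t) * m₃ u ^ (c / t) * m₄ u ^ (b / t) := by
    intro u
    have e1 : ∀ p : ℤ × ℤ, (jb p.1 ^ (-θ) * jb p.2 ^ (-θ) *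
        (A₀ (u + p.1) * a (u + p.1 - p.2) * A₃ (p.2 - u))) ^ t ≤
        (A₀ (u + p.1) ^ r * a (u + p.1 - p.2) ^ Q) ^ la *
        (A₀ (u + p.1) ^ r * a (u + p.1 - p.2) ^ Q * K p.1) ^ x *
        (A₀ (u + p.1) ^ r * A₃ (p.2 - u) ^ R * K p.2) ^ x *
        (A₀ (u + p.1) ^ r * K p.1 * K p.2) ^ c *
        (A₃ (p.2 - u) ^ R * K p.1 * K p.2) ^ b := by
      intro p
      have f0 : A₀ (u + p.1) ^ t ≤ (A₀ (u + p.1) ^ r) ^ la * (A₀ (u + p.1) ^ r) ^ x *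
          (A₀ (u + p.1) ^ r) ^ x * (A₀ (u + p.1) ^ r) ^ c := by
        rw [← ENNReal.rpow_add_of_nonneg _ _ la0 x0,
          ← ENNReal.rpow_add_of_nonneg _ _ (by linarith) x0,
          ← ENNReal.rpow_add_of_nonneg _ _ (by linarith) c0, ← ENNReal.rpow_mul]
        exact ENNReal.rpow_le_rpow_of_exponent_ge (A0le _) hA0
      have f2 : a (u + p.1 - p.2) ^ t ≤ (a (u + p.1 - p.2) ^ Q) ^ la *
          (a (u + p.1 - p.2) ^ Q) ^ x := by
        rw [← ENNReal.rpow_add_of_nonneg _ _ la0 x0, ← ENNReal.rpow_mul]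
        exact ENNReal.rpow_le_rpow_of_exponent_ge (ale _) ha2
      have f3 : A₃ (p.2 - u) ^ t ≤ (A₃ (p.2 - u) ^ R) ^ x * (A₃ (p.2 - u) ^ R) ^ b := by
        rw [← ENNReal.rpow_add_of_nonneg _ _ x0 b0, ← ENNReal.rpow_mul]
        exact ENNReal.rpow_le_rpow_of_exponent_ge (A3le _) hA3
      have fK : ∀ n : ℤ, (jb n ^ (-θ)) ^ t = K n ^ x * K n ^ c * K n ^ b := by
        intro n
        rw [← ENNReal.rpow_add_of_nonneg _ _ x0 c0,
          ← ENNReal.rpow_add_of_nonneg _ _ (by linarith) b0, hK, hKdef]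
        simp only
        rw [← ENNReal.rpow_mul, ← ENNReal.rpow_mul]
        congr 1
        field_simp
      calc _ = (jb p.1 ^ (-θ)) ^ t * (jb p.2 ^ (-θ)) ^ t *
              (A₀ (u + p.1) ^ t * a (u + p.1 - p.2) ^ t * A₃ (p.2 - u) ^ t) := by
            simp only [ENNReal.mul_rpow_of_nonneg _ _ ht.le]
        _ ≤ (K p.1 ^ x * K p.1 ^ c * K p.1 ^ b) * (K p.2 ^ x * K p.2 ^ c * K p.2 ^ b) *
              (((A₀ (u + p.1) ^ r) ^ la * (A₀ (u + p.1) ^ r) ^ x *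
          (A₀ (u + p.1) ^ r) ^ x * (A₀ (u + p.1) ^ r) ^ c) * ((a (u + p.1 - p.2) ^ Q) ^ la *
          (a (u + p.1 - p.2) ^ Q) ^ x) * ((A₃ (p.2 - u) ^ R) ^ x * (A₃ (p.2 - u) ^ R) ^ b)) := by
            rw [fK, fK]
            gcongr
        _ = _ := by
            simp only [ENNReal.mul_rpow_of_nonneg _ _ la0, ENNReal.mul_rpow_of_nonneg _ _ x0,
              ENNReal.mul_rpow_of_nonneg _ _ c0, ENNReal.mul_rpow_of_nonneg _ _ b0]
            ring
    calc _ ≤ (1 ^ la * m₁ u ^ x * m₂ u ^ x * m₃ u ^ c * m₄ u ^ b) ^ (1 / t) := by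
          gcongr
          refine (ENNReal.tsum_le_tsum e1).trans
            ((tsum_five_rpow_mul_le _ _ _ _ _ la0 x0 x0 c0 b0 hsum).trans ?_)
          gcongr
          refine (tsum_pair_mul_le (P := ℤ × ℤ) (fun p => u + p.1) (fun p => u + p.1 - p.2) ?_
              (fun n => A₀ n ^ r) (fun n => a n ^ Q)).trans ?_
          · rintro ⟨d, e⟩ ⟨d', e'⟩ h
            simp only [Prod.mk.injEq] at h ⊢
            omega
          · exact mul_le_one' hA₀ ha
      _ = _ := by
          have i2 : 0 ≤ 1 / t := by positivity
          simp only [ENNReal.one_rpow, one_mul, ENNReal.mul_rpow_of_nonneg _ _ i2,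
            ← ENNReal.rpow_mul, mul_one_div]
  calc _ ≤ ∑' u : ℤ, (E u ^ Q) ^ (1 / Q) * m₁ u ^ (x / t) * m₂ u ^ (x / t) * m₃ u ^ (c / t) *
        m₄ u ^ (b / t) := by
        refine ENNReal.tsum_le_tsum fun u => ?_
        rw [← ENNReal.rpow_mul, mul_one_div_cancel hQ.ne', ENNReal.rpow_one]
        refine (mul_le_mul_right (hin u) (E u)).trans (le_of_eq (by ring))
    -- The outer Hölder exponents sum to one because la = 1 - t/q leaves 2x + c + b = t/q, and 1/Q +
    -- 1/q = 1.
    _ ≤ 1 ^ (1 / Q) * C ^ (x / t) * C ^ (x / t) * (C * C) ^ (c / t) * (C * C) ^ (b / t) := by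
        refine (tsum_five_rpow_mul_le _ _ _ _ _ (by positivity) (by positivity) (by positivity)
          (by positivity) (by positivity) ?_).trans ?_
        · have : x + x + c + b = t * (1 / q) := by linarith
          have : (x + x + c + b) / t = 1 / q := by rw [this]; field_simp
          calc 1 / Q + x / t + x / t + c / t + b / t = 1 / Q + (x + x + c + b) / t := by ring
            _ = 1 := by rw [this]; linarith
        · gcongr
    _ = S := by rw [hS, ENNReal.one_rpow, one_mul]

end

section

/-! ### The quadrilinear form -/

lemma conv_comm {a b : ℝ → ℝ≥0∞} (s : ℝ) :
    ∫⁻ z, a z * b (s - z) = ∫⁻ z, b z * a (s - z) := by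
  rw [← lintegral_sub_left_eq_self (fun z => b z * a (s - z)) s]
  refine lintegral_congr fun z => ?_
  rw [sub_sub_cancel, mul_comm]

/-- The form is symmetric in its four functions; the three adjacent transpositions suffice to bring
the function without weight to the front. -/
lemma quadForm_swap_last (a₀ a₁ a₂ a₃ : ℝ → ℝ≥0∞) (N : ℝ) :
    quadForm a₀ a₁ a₂ a₃ N = quadForm a₀ a₁ a₃ a₂ N := by
  unfold quadForm
  simp_rw [conv_comm (a := a₂)]

lemma lintegral_mul_lintegral_swap {a b Φ : ℝ → ℝ≥0∞} (ha : Measurable a) (hb : Measurable b)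
    (hΦ : Measurable Φ) (N : ℝ) :
    ∫⁻ x, a x * ∫⁻ y, b y * Φ (N - x - y) = ∫⁻ x, b x * ∫⁻ y, a y * Φ (N - x - y) := by
  have h : ∀ {a b : ℝ → ℝ≥0∞}, Measurable b →
      ∫⁻ x, a x * ∫⁻ y, b y * Φ (N - x - y) = ∫⁻ x, ∫⁻ y, a x * (b y * Φ (N - x - y)) := by
    intro a b hb
    refine lintegral_congr fun x => ?_
    rw [lintegral_const_mul (f := fun y => b y * Φ (N - x - y)) _ (hb.mul (hΦ.comp (by fun_prop)))]
  rw [h hb, h ha, lintegral_lintegral_swap]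
  · refine lintegral_congr fun x => lintegral_congr fun y => ?_
    rw [sub_right_comm]
    ring
  · exact ((ha.comp measurable_fst).mul ((hb.comp measurable_snd).mul
      (hΦ.comp (by fun_prop)))).aemeasurable

lemma quadForm_swap_first {a₀ a₁ a₂ a₃ : ℝ → ℝ≥0∞} (h₀ : Measurable a₀) (h₁ : Measurable a₁)
    (h₂ : Measurable a₂) (h₃ : Measurable a₃) (N : ℝ) :
    quadForm a₀ a₁ a₂ a₃ N = quadForm a₁ a₀ a₂ a₃ N :=
  lintegral_mul_lintegral_swap h₀ h₁ (measurable_conv h₂ h₃) N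

lemma quadForm_swap_middle {a₀ a₁ a₂ a₃ : ℝ → ℝ≥0∞} (h₁ : Measurable a₁)
    (h₂ : Measurable a₂) (h₃ : Measurable a₃) (N : ℝ) :
    quadForm a₀ a₁ a₂ a₃ N = quadForm a₀ a₂ a₁ a₃ N := by
  unfold quadForm
  simp_rw [lintegral_mul_lintegral_swap h₁ h₂ h₃]

/-- By Tonelli. As a single integral the form admits a pointwise comparison of the four modulations.
-/
lemma quadForm_eq_lintegral {a₀ a₁ a₂ a₃ : ℝ → ℝ≥0∞} (h₀ : Measurable a₀) (h₁ : Measurable a₁)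
    (h₂ : Measurable a₂) (h₃ : Measurable a₃) (N : ℝ) :
    quadForm a₀ a₁ a₂ a₃ N =
      ∫⁻ v : ℝ × ℝ × ℝ, a₀ v.1 * a₁ v.2.1 * a₂ v.2.2 * a₃ (N - v.1 - v.2.1 - v.2.2) := by
  rw [Measure.volume_eq_prod, lintegral_prod _ (by fun_prop)]
  unfold quadForm
  refine lintegral_congr fun x => ?_
  rw [Measure.volume_eq_prod, lintegral_prod _ (by fun_prop),
    ← lintegral_const_mul (f := fun y => a₁ y * ∫⁻ z, a₂ z * a₃ (N - x - y - z))]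
  · refine lintegral_congr fun y => ?_
    rw [← mul_assoc, ← lintegral_const_mul (f := fun z => a₂ z * a₃ (N - x - y - z)) _ (by fun_prop)]
    refine lintegral_congr fun z => ?_
    simp only [mul_assoc]
  · exact h₁.mul ((measurable_conv h₂ h₃).comp (measurable_const.sub measurable_id))

lemma quadForm_const_mul {κ : ℝ≥0∞} (hκ : κ ≠ ∞) (a₀ a₁ a₂ a₃ : ℝ → ℝ≥0∞) (N : ℝ) :
    quadForm a₀ a₁ a₂ (fun x => κ * a₃ x) N = κ * quadForm a₀ a₁ a₂ a₃ N := by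
  unfold quadForm
  rw [← lintegral_const_mul' _ _ hκ]
  refine lintegral_congr fun x => ?_
  rw [mul_left_comm, ← lintegral_const_mul' _ _ hκ]
  congr 1
  refine lintegral_congr fun y => ?_
  rw [mul_left_comm, ← lintegral_const_mul' _ _ hκ]
  congr 1
  refine lintegral_congr fun z => ?_
  ring

/-- The weight `⟨σ⟩^{-1/2}` put on a function of the modulation. -/
def wt (a : ℝ → ℝ≥0∞) (x : ℝ) : ℝ≥0∞ := a x * jb x ^ (-(1 / 2) : ℝ)

lemma measurable_wt {a : ℝ → ℝ≥0∞} (h : Measurable a) : Measurable (wt a) :=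
  h.mul (measurable_jb_rpow _)

lemma bracket_add_le_add (x y : ℝ) : bracket (x + y) ≤ bracket x + bracket y := by
  have hx := bracket_pos x
  have hy := bracket_pos y
  refine (pow_le_pow_iff_left₀ (bracket_pos _).le (by positivity) two_ne_zero).1 ?_
  have h : x * y ≤ bracket x * bracket y := by
    calc x * y ≤ |x * y| := le_abs_self _
      _ = |x| * |y| := abs_mul x y
      _ ≤ _ := mul_le_mul (abs_le_bracket x) (abs_le_bracket y) (abs_nonneg _) hx.le
  nlinarith [bracket_sq x, bracket_sq y, bracket_sq (x + y)]

lemma jb_add_le_add (x y : ℝ) : jb (x + y) ≤ jb x + jb y := by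
  unfold jb
  rw [← ENNReal.ofReal_add (bracket_pos x).le (bracket_pos y).le]
  exact ENNReal.ofReal_le_ofReal (bracket_add_le_add x y)

/-- The resonance identity: one of the four modulations dominates. -/
lemma jb_rpow_half_mul_quadForm_le {a₀ a₁ a₂ a₃ : ℝ → ℝ≥0∞} (h₀ : Measurable a₀)
    (h₁ : Measurable a₁) (h₂ : Measurable a₂) (h₃ : Measurable a₃) (N : ℝ) :
    jb N ^ (1 / 2 : ℝ) * quadForm (wt a₀) (wt a₁) (wt a₂) (wt a₃) N ≤
      quadForm a₀ (wt a₁) (wt a₂) (wt a₃) N + quadForm (wt a₀) a₁ (wt a₂) (wt a₃) N +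
      quadForm (wt a₀) (wt a₁) a₂ (wt a₃) N + quadForm (wt a₀) (wt a₁) (wt a₂) a₃ N := by
  have w₀ := measurable_wt h₀
  have w₁ := measurable_wt h₁
  have w₂ := measurable_wt h₂
  have w₃ := measurable_wt h₃
  rw [quadForm_eq_lintegral w₀ w₁ w₂ w₃, quadForm_eq_lintegral h₀ w₁ w₂ w₃,
    quadForm_eq_lintegral w₀ h₁ w₂ w₃, quadForm_eq_lintegral w₀ w₁ h₂ w₃,
    quadForm_eq_lintegral w₀ w₁ w₂ h₃, ← lintegral_add_left (by fun_prop),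
    ← lintegral_add_left (by fun_prop), ← lintegral_add_left (by fun_prop),
    ← lintegral_const_mul _ (by fun_prop)]
  refine lintegral_mono fun v => ?_
  obtain ⟨x, y, z⟩ := v
  simp only
  set w := N - x - y - z with hw
  have h1 : jb N ^ (1 / 2 : ℝ) ≤ jb x ^ (1 / 2 : ℝ) + jb y ^ (1 / 2 : ℝ) + jb z ^ (1 / 2 : ℝ) +
      jb w ^ (1 / 2 : ℝ) := by
    have e : N = x + y + z + w := by rw [hw]; ring
    have sub : ∀ a b : ℝ≥0∞, (a + b) ^ (1 / 2 : ℝ) ≤ a ^ (1 / 2 : ℝ) + b ^ (1 / 2 : ℝ) :=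
      fun a b => ENNReal.rpow_add_le_add_rpow a b (by norm_num) (by norm_num)
    have h2 : jb N ≤ jb x + jb y + jb z + jb w := by
      rw [e]
      refine (jb_add_le_add _ _).trans (add_le_add_left ?_ _)
      refine (jb_add_le_add _ _).trans (add_le_add_left ?_ _)
      exact jb_add_le_add _ _
    refine (ENNReal.rpow_le_rpow h2 (by norm_num)).trans ?_
    refine (sub _ _).trans (add_le_add_left ?_ _)
    refine (sub _ _).trans (add_le_add_left ?_ _)
    exact sub _ _
  have cancel : ∀ (a : ℝ → ℝ≥0∞) (s : ℝ), jb s ^ (1 / 2 : ℝ) * wt a s = a s := by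
    intro a s
    unfold wt
    rw [mul_left_comm, ← jb_rpow_add]
    simp
  calc _ ≤ (jb x ^ (1 / 2 : ℝ) + jb y ^ (1 / 2 : ℝ) + jb z ^ (1 / 2 : ℝ) +
      jb w ^ (1 / 2 : ℝ)) * (wt a₀ x * wt a₁ y * wt a₂ z * wt a₃ w) := by gcongr
    _ = (jb x ^ (1 / 2 : ℝ) * wt a₀ x) * wt a₁ y * wt a₂ z * wt a₃ w +
        wt a₀ x * (jb y ^ (1 / 2 : ℝ) * wt a₁ y) * wt a₂ z * wt a₃ w +
        wt a₀ x * wt a₁ y * (jb z ^ (1 / 2 : ℝ) * wt a₂ z) * wt a₃ w +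
        wt a₀ x * wt a₁ y * wt a₂ z * (jb w ^ (1 / 2 : ℝ) * wt a₃ w) := by ring
    _ = _ := by simp only [cancel]

/-- The two frequency weights of the main estimate. -/
def pairWeight (s : Bool) (α : ℝ) (ξ : ℤ) (p : ℤ × ℤ) : ℝ≥0∞ :=
  match s with
  | true => jb p.1 ^ (-α) * jb p.2 ^ (-α)
  | false => jb (ξ - p.1 : ℤ) ^ (-α) * jb (ξ - p.2 : ℤ) ^ (-α)

/-- Since d - e = ξ₂ - ξ₁, in both weights it is a difference of the two variables up to sign; its
bracket is at most twice the product of theirs, which lowers each exponent by ε. -/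
lemma pairWeight_mul_le {ε : ℝ} (hε : 0 ≤ ε) (s : Bool) (ξ : ℤ) (p : ℤ × ℤ) :
    pairWeight s (1 / 2) ξ p * jb ((p.1 : ℝ) - p.2) ^ ε ≤
      2 ^ ε * pairWeight s (1 / 2 - ε) ξ p := by
  have key : ∀ x y : ℝ, jb x ^ (-(1 / 2) : ℝ) * jb y ^ (-(1 / 2) : ℝ) * jb (x + y) ^ ε ≤
      2 ^ ε * (jb x ^ (-(1 / 2 - ε)) * jb y ^ (-(1 / 2 - ε))) := by
    intro x y
    calc _ ≤ jb x ^ (-(1 / 2) : ℝ) * jb y ^ (-(1 / 2) : ℝ) * (2 * (jb x * jb y)) ^ ε := by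
          gcongr; exact jb_add_le x y
      _ = 2 ^ ε * ((jb x ^ (-(1 / 2) : ℝ) * jb x ^ ε) * (jb y ^ (-(1 / 2) : ℝ) * jb y ^ ε)) := by
          rw [ENNReal.mul_rpow_of_nonneg _ _ hε, ENNReal.mul_rpow_of_nonneg _ _ hε]; ring
      _ = _ := by rw [← jb_rpow_add, ← jb_rpow_add]; ring_nf
  cases s
  · have := key (-(ξ - p.1 : ℤ)) ((ξ - p.2 : ℤ))
    rw [jb_neg, show -((ξ - p.1 : ℤ) : ℝ) + ((ξ - p.2 : ℤ) : ℝ) = (p.1 : ℝ) - p.2 by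
      push_cast; ring] at this
    exact this
  · have := key p.1 (-p.2)
    rw [jb_neg, ← sub_eq_add_neg] at this
    exact this

/-- The multiplier of the nonresonant part is controlled by the resonance function. -/
lemma multiplier_le {ξ d e : ℤ} (hd : d ≠ 0) (he : e ≠ 0) :
    jb ξ ^ (1 / 2 : ℝ) * ENNReal.ofReal |((d + e - ξ : ℤ) : ℝ)| *
      (jb (ξ - d : ℤ) ^ (-(1 / 2) : ℝ) * jb (ξ - e : ℤ) ^ (-(1 / 2) : ℝ) *
        jb (d + e - ξ : ℤ) ^ (-(1 / 2) : ℝ)) ≤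
    2 * jb (2 * ((d : ℝ) * e)) ^ (1 / 2 : ℝ) *
      (pairWeight true (1 / 2) ξ (d, e) + pairWeight false (1 / 2) ξ (d, e)) := by
  set k : ℤ := d + e - ξ with hk
  set x : ℤ := ξ - d with hx
  set y : ℤ := ξ - e with hy
  set N : ℝ := 2 * ((d : ℝ) * e) with hN
  have hd1 : (1 : ℝ) ≤ |(d : ℝ)| := by exact_mod_cast Int.one_le_abs hd
  have he1 : (1 : ℝ) ≤ |(e : ℝ)| := by exact_mod_cast Int.one_le_abs he
  have hd2 : (1 : ℝ) ≤ (d : ℝ) ^ 2 := by rw [← sq_abs]; nlinarith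
  have he2 : (1 : ℝ) ≤ (e : ℝ) ^ 2 := by rw [← sq_abs]; nlinarith
  -- This uses that d and e are nonzero integers, so (1 + d²)(1 + e²) ≤ 1 + 4d²e².
  have hprod : jb d * jb e ≤ jb N := by
    unfold jb
    rw [← ENNReal.ofReal_mul (bracket_pos _).le]
    refine ENNReal.ofReal_le_ofReal ?_
    refine (pow_le_pow_iff_left₀ (by have := bracket_pos d; have := bracket_pos e; positivity)
      (bracket_pos _).le two_ne_zero).1 ?_
    rw [mul_pow, bracket_sq, bracket_sq, bracket_sq, hN]
    nlinarith [mul_nonneg (sub_nonneg.2 hd2) (sub_nonneg.2 he2)]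
  have hreal : bracket ξ * |(k : ℝ)| ≤ 2 * (bracket N + bracket x * bracket y) := by
    have hb : bracket ξ ≤ 1 + |(ξ : ℝ)| := by
      refine (pow_le_pow_iff_left₀ (bracket_pos _).le (by positivity) two_ne_zero).1 ?_
      rw [bracket_sq]
      nlinarith [abs_nonneg (ξ : ℝ), sq_abs (ξ : ℝ)]
    have hxy : |(x : ℝ)| * |(y : ℝ)| ≤ bracket x * bracket y :=
      mul_le_mul (abs_le_bracket _) (abs_le_bracket _) (abs_nonneg _) (bracket_pos _).le
    have hn : |(ξ : ℝ)| * |(k : ℝ)| ≤ bracket N + bracket x * bracket y := by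
      -- The identity ξξ₃ = de - ξ₁ξ₂.
      have e1 : (ξ : ℝ) * k = N / 2 + -((x : ℝ) * y) := by
        rw [hN, hk, hx, hy]; push_cast; ring
      rw [← abs_mul, e1]
      refine (abs_add_le _ _).trans ?_
      rw [abs_neg, abs_mul (x : ℝ), abs_div, abs_two]
      have := abs_le_bracket N
      have := abs_nonneg N
      linarith
    have h0 := abs_nonneg (k : ℝ)
    -- For ξ = 0 the identity says nothing about k, but then k = -(x + y) is controlled directly.
    have hB : |(k : ℝ)| ≤ bracket N + 2 * (bracket x * bracket y) ∨
        |(k : ℝ)| ≤ |(ξ : ℝ)| * |(k : ℝ)| := by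
      by_cases h : ξ = 0
      · left
        have e1 : (k : ℝ) = -((x : ℝ) + y) := by
          rw [hk, hx, hy, h]; push_cast; ring
        rw [e1, abs_neg]
        refine (abs_add_le _ _).trans ?_
        have := abs_le_bracket x
        have := abs_le_bracket y
        nlinarith [one_le_bracket x, one_le_bracket y, bracket_pos N]
      · right
        have : (1 : ℝ) ≤ |(ξ : ℝ)| := by exact_mod_cast Int.one_le_abs h
        nlinarith
    have hz : ξ = 0 → bracket ξ * |(k : ℝ)| = |(k : ℝ)| := by
      rintro rfl; simp [bracket]
    by_cases h : ξ = 0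
    · rw [hz h]
      rcases hB with hB | hB
      · nlinarith [bracket_pos N]
      · nlinarith
    · have h1 : (1 : ℝ) ≤ |(ξ : ℝ)| := by exact_mod_cast Int.one_le_abs h
      nlinarith [mul_le_mul_of_nonneg_right hb h0]
  have hE : jb ξ * ENNReal.ofReal |(k : ℝ)| ≤ 2 * (jb N + jb x * jb y) := by
    unfold jb
    rw [← ENNReal.ofReal_mul (bracket_pos _).le, ← ENNReal.ofReal_mul (bracket_pos _).le,
      ← ENNReal.ofReal_add (bracket_pos _).le
        (by have := bracket_pos x; have := bracket_pos y; positivity),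
      ← ENNReal.ofReal_ofNat, ← ENNReal.ofReal_mul (by norm_num)]
    exact ENNReal.ofReal_le_ofReal hreal
  set K := ENNReal.ofReal |(k : ℝ)| with hK
  have hKk : K ≤ jb k := ENNReal.ofReal_le_ofReal (abs_le_bracket _)
  have half : (0 : ℝ) ≤ 1 / 2 := by norm_num
  have cancel : ∀ s : ℝ, jb s ^ (1 / 2 : ℝ) * jb s ^ (-(1 / 2) : ℝ) = 1 := by
    intro s; rw [← jb_rpow_add]; simp
  have hKK : K = K ^ (1 / 2 : ℝ) * K ^ (1 / 2 : ℝ) := by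
    rw [← ENNReal.rpow_add_of_nonneg _ _ half half]; norm_num
  have h2 : (2 : ℝ≥0∞) ^ (1 / 2 : ℝ) ≤ 2 := by
    calc (2 : ℝ≥0∞) ^ (1 / 2 : ℝ) ≤ 2 ^ (1 : ℝ) :=
          ENNReal.rpow_le_rpow_of_exponent_le one_le_two (by norm_num)
      _ = 2 := ENNReal.rpow_one _
  calc _ = (jb ξ * K) ^ (1 / 2 : ℝ) * (K ^ (1 / 2 : ℝ) * jb k ^ (-(1 / 2) : ℝ)) *
        (jb x ^ (-(1 / 2) : ℝ) * jb y ^ (-(1 / 2) : ℝ)) := by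
        rw [ENNReal.mul_rpow_of_nonneg _ _ half]
        conv_lhs => rw [hKK]
        ring
    _ ≤ (2 * (jb N + jb x * jb y)) ^ (1 / 2 : ℝ) * 1 *
        (jb x ^ (-(1 / 2) : ℝ) * jb y ^ (-(1 / 2) : ℝ)) := by
        refine mul_le_mul' (mul_le_mul' (ENNReal.rpow_le_rpow hE half) ?_) le_rfl
        rw [← cancel k]
        exact mul_le_mul' (ENNReal.rpow_le_rpow hKk half) le_rfl
    _ ≤ 2 * (jb N ^ (1 / 2 : ℝ) + (jb x * jb y) ^ (1 / 2 : ℝ)) * 1 *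
        (jb x ^ (-(1 / 2) : ℝ) * jb y ^ (-(1 / 2) : ℝ)) := by
        refine mul_le_mul' (mul_le_mul' ?_ le_rfl) le_rfl
        rw [ENNReal.mul_rpow_of_nonneg _ _ half]
        exact mul_le_mul' h2 (ENNReal.rpow_add_le_add_rpow _ _ half (by norm_num))
    _ = 2 * (jb N ^ (1 / 2 : ℝ) * (jb x ^ (-(1 / 2) : ℝ) * jb y ^ (-(1 / 2) : ℝ)) +
        (jb x ^ (1 / 2 : ℝ) * jb x ^ (-(1 / 2) : ℝ)) *
          (jb y ^ (1 / 2 : ℝ) * jb y ^ (-(1 / 2) : ℝ))) := by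
        rw [ENNReal.mul_rpow_of_nonneg _ _ half]; ring
    -- In the region governed by ξ₁ξ₂ the multiplier is bounded, and a bounded factor is at most
    -- ⟨N⟩^{1/2}⟨d⟩^{-1/2}⟨e⟩^{-1/2}.
    _ ≤ 2 * (jb N ^ (1 / 2 : ℝ) * (jb x ^ (-(1 / 2) : ℝ) * jb y ^ (-(1 / 2) : ℝ)) +
        jb N ^ (1 / 2 : ℝ) * (jb d ^ (-(1 / 2) : ℝ) * jb e ^ (-(1 / 2) : ℝ))) := by
        rw [cancel, cancel, one_mul]
        gcongr
        calc (1 : ℝ≥0∞) = (jb d ^ (1 / 2 : ℝ) * jb d ^ (-(1 / 2) : ℝ)) *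
              (jb e ^ (1 / 2 : ℝ) * jb e ^ (-(1 / 2) : ℝ)) := by rw [cancel, cancel, one_mul]
          _ = (jb d * jb e) ^ (1 / 2 : ℝ) * (jb d ^ (-(1 / 2) : ℝ) * jb e ^ (-(1 / 2) : ℝ)) := by
              rw [ENNReal.mul_rpow_of_nonneg _ _ half]; ring
          _ ≤ _ := mul_le_mul' (ENNReal.rpow_le_rpow hprod half) le_rfl
    _ = _ := by
        simp only [pairWeight]
        rw [← hx, ← hy]
        ring

/-- A family of functions of the modulation, indexed by the frequency, of norm at most one. -/
structure UnitFamily {ι : Type*} (g : ι → ℝ → ℝ≥0∞) : Prop where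
  measurable : ∀ n, Measurable (g n)
  le_one : ∀ n, ∫⁻ x, g n x ^ (2 : ℝ) ≤ 1

lemma UnitFamily.comp {ι ι' : Type*} {g : ι → ℝ → ℝ≥0∞} (h : UnitFamily g) (f : ι' → ι) :
    UnitFamily fun n => g (f n) :=
  ⟨fun n => h.measurable (f n), fun n => h.le_one (f n)⟩

/-- The summed form of the almost orthogonality estimate. -/
lemma exists_tsum_tsum_quadForm_le {δ δ₁ ε : ℝ} (hδ : 0 ≤ δ) (h : δ < δ₁) (h₁ : δ₁ < 1 / 2)
    (hε : 0 < ε) :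
    ∃ C : ℝ≥0∞, C ≠ ∞ ∧ ∀ (κ : ℝ≥0∞) (E : ℤ → ℝ≥0∞) (Y : ℤ → ℤ × ℤ → ℝ≥0∞)
      (a : ℤ → ℝ → ℝ≥0∞) (b c e : ℤ → ℤ × ℤ → ℝ → ℝ≥0∞), κ ≠ 0 → κ ≠ ∞ →
      UnitFamily a → (∀ u, UnitFamily (b u)) → (∀ u, UnitFamily (c u)) →
      (∀ u, UnitFamily (e u)) →
      (∀ u p, ∫⁻ x, (e u p x * jb x ^ (-δ)) ^ (2 : ℝ) ≤ κ ^ (2 : ℝ)) →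
      ∑' u, ∑' p : NzPair, E u * Y u p * quadForm (a u) (wt (b u p)) (wt (c u p)) (wt (e u p))
        (2 * ((p.1.1 : ℝ) * p.1.2)) ≤
      C * κ * ∑' u, E u * (∑' p : ℤ × ℤ, (Y u p * jb ((p.1 : ℝ) - p.2) ^ ε) ^
        (1 / (1 / 2 + δ₁))) ^ (1 / (1 / (1 / 2 + δ₁))) := by
  obtain ⟨C, hC, H⟩ := exists_tsum_quadForm_le hδ h h₁ hε
  refine ⟨C, hC, fun κ E Y a b c e hκ0 hκ ha hb hc he he' => ?_⟩
  rw [← ENNReal.tsum_mul_left]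
  refine ENNReal.tsum_le_tsum fun u => ?_
  -- A factor ⟨x⟩^{-δ} moves from the weight into the last function, whose norm drops to κ; division
  -- by κ normalises it again.
  set f : ℤ × ℤ → ℝ → ℝ≥0∞ := fun p x => κ⁻¹ * (e u p x * jb x ^ (-δ)) with hf
  have hfm : ∀ p, Measurable (f p) := fun p =>
    (((he u).measurable p).mul (measurable_jb_rpow _)).const_mul _
  have hf1 : ∀ p, ∫⁻ x, f p x ^ (2 : ℝ) ≤ 1 := by
    intro p
    calc ∫⁻ x, f p x ^ (2 : ℝ) = ∫⁻ x, (κ⁻¹) ^ (2 : ℝ) * (e u p x * jb x ^ (-δ)) ^ (2 : ℝ) := by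
          refine lintegral_congr fun x => ENNReal.mul_rpow_of_nonneg _ _ (by norm_num)
      _ = (κ⁻¹) ^ (2 : ℝ) * ∫⁻ x, (e u p x * jb x ^ (-δ)) ^ (2 : ℝ) :=
          lintegral_const_mul _ ((((he u).measurable p).mul (measurable_jb_rpow _)).pow_const _)
      _ ≤ (κ⁻¹) ^ (2 : ℝ) * κ ^ (2 : ℝ) := by gcongr; exact he' u p
      _ = 1 := by
          rw [← ENNReal.mul_rpow_of_nonneg _ _ (by norm_num), ENNReal.inv_mul_cancel hκ0 hκ,
            ENNReal.one_rpow]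
  have hq : ∀ p N, quadForm (a u) (wt (b u p)) (wt (c u p)) (wt (e u p)) N =
      κ * quadForm (a u) (wt (b u p)) (wt (c u p)) (fun x => f p x * jb x ^ (-(1 / 2 - δ))) N := by
    intro p N
    rw [← quadForm_const_mul hκ]
    congr 1
    funext x
    rw [hf]
    simp only
    rw [wt, mul_assoc κ⁻¹, ← mul_assoc κ, ENNReal.mul_inv_cancel hκ0 hκ, one_mul, mul_assoc,
      ← jb_rpow_add]
    ring_nf
  have key := H (fun p => Y u p.1) (a u) (fun p => b u p.1) (fun p => c u p.1) (fun p => f p.1)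
    (ha.measurable u) (fun p => (hb u).measurable p) (fun p => (hc u).measurable p)
    (fun p => hfm p) (ha.le_one u) (fun p => (hb u).le_one p) (fun p => (hc u).le_one p)
    (fun p => hf1 p)
  calc _ = E u * κ * ∑' p : NzPair, Y u p.1 * quadForm (a u) (wt (b u p)) (wt (c u p))
          (fun x => f p x * jb x ^ (-(1 / 2 - δ))) (2 * ((p.1.1 : ℝ) * p.1.2)) := by
        rw [← ENNReal.tsum_mul_left]
        refine tsum_congr fun p => ?_
        rw [hq]; ring
    _ ≤ E u * κ * (C * (∑' p : NzPair, (Y u p.1 * jb ((p.1.1 : ℝ) - p.1.2) ^ ε) ^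
          (1 / (1 / 2 + δ₁))) ^ (1 / 2 + δ₁)) := mul_le_mul_right key _
    _ ≤ E u * κ * (C * (∑' p : ℤ × ℤ, (Y u p * jb ((p.1 : ℝ) - p.2) ^ ε) ^
          (1 / (1 / 2 + δ₁))) ^ (1 / 2 + δ₁)) := by
        have h0 : 0 ≤ 1 / 2 + δ₁ := by linarith
        refine mul_le_mul_right (mul_le_mul_right (ENNReal.rpow_le_rpow ?_ h0) _) _
        exact ENNReal.tsum_comp_le_tsum_of_injective Subtype.val_injective
          (fun p : ℤ × ℤ => (Y u p * jb ((p.1 : ℝ) - p.2) ^ ε) ^ (1 / (1 / 2 + δ₁)))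
    _ = _ := by rw [one_div_one_div]; ring

/-- The normalised data of the quadrilinear estimate: the sequences `A i` carry the `ℓ^p`-norms in
the frequency, the families `g i` are normalised in the modulation, and `κ` is the gain for the
three inputs when the weight in the modulation is lowered by `δ`. -/
structure Normalized (Q r R δ : ℝ) (κ : ℝ≥0∞) (A₀ A₁ A₂ A₃ : ℤ → ℝ≥0∞)
    (g₀ g₁ g₂ g₃ : ℤ → ℝ → ℝ≥0∞) : Prop where
  ne_zero : κ ≠ 0
  ne_top : κ ≠ ∞
  hA₀ : ∑' n, A₀ n ^ r ≤ 1
  hA₁ : ∑' n, A₁ n ^ Q ≤ 1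
  hA₂ : ∑' n, A₂ n ^ Q ≤ 1
  hA₃ : ∑' n, A₃ n ^ R ≤ 1
  hg₀ : UnitFamily g₀
  hg₁ : UnitFamily g₁
  hg₂ : UnitFamily g₂
  hg₃ : UnitFamily g₃
  gain₁ : ∀ n, ∫⁻ x, (g₁ n x * jb x ^ (-δ)) ^ (2 : ℝ) ≤ κ ^ (2 : ℝ)
  gain₂ : ∀ n, ∫⁻ x, (g₂ n x * jb x ^ (-δ)) ^ (2 : ℝ) ≤ κ ^ (2 : ℝ)
  gain₃ : ∀ n, ∫⁻ x, (g₃ n x * jb x ^ (-δ)) ^ (2 : ℝ) ≤ κ ^ (2 : ℝ)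

lemma Normalized.swap {Q r R δ : ℝ} {κ : ℝ≥0∞} {A₀ A₁ A₂ A₃ : ℤ → ℝ≥0∞}
    {g₀ g₁ g₂ g₃ : ℤ → ℝ → ℝ≥0∞} (D : Normalized Q r R δ κ A₀ A₁ A₂ A₃ g₀ g₁ g₂ g₃) :
    Normalized Q r R δ κ A₀ A₂ A₁ A₃ g₀ g₂ g₁ g₃ :=
  ⟨D.ne_zero, D.ne_top, D.hA₀, D.hA₂, D.hA₁, D.hA₃, D.hg₀, D.hg₂, D.hg₁, D.hg₃, D.gain₂, D.gain₁,
    D.gain₃⟩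

/-- For fixed (d, e) the passage from the output frequency to another of the four frequencies is a
bijection of ℤ. -/
lemma tsum_tsum_reindex {P : Type*} (f : P → ℤ ≃ ℤ) (F : ℤ → P → ℝ≥0∞) :
    ∑' ξ, ∑' p, F ξ p = ∑' u, ∑' p, F (f p u) p := by
  rw [ENNReal.tsum_comm, ENNReal.tsum_comm (f := fun u p => F (f p u) p)]
  exact tsum_congr fun p => ((f p).tsum_eq (fun ξ => F ξ p)).symm

lemma tsum_rpow_le_of_le {P : Type*} {Y W : P → ℝ≥0∞} {c : ℝ≥0∞} {t : ℝ} (ht : 0 < t)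
    (h : ∀ p, Y p ≤ c * W p) :
    (∑' p, Y p ^ t) ^ (1 / t) ≤ c * (∑' p, W p ^ t) ^ (1 / t) := by
  calc _ ≤ (∑' p, c ^ t * W p ^ t) ^ (1 / t) := by
        gcongr with p
        rw [← ENNReal.mul_rpow_of_nonneg _ _ ht.le]
        exact ENNReal.rpow_le_rpow (h p) ht.le
    _ = _ := by
        rw [ENNReal.tsum_mul_left, ENNReal.mul_rpow_of_nonneg _ _ (by positivity),
          ← ENNReal.rpow_mul, mul_one_div_cancel ht.ne', ENNReal.rpow_one]

/-- Replacing ξ by ξ₃ = d + e - ξ interchanges ξ - d and ξ - e up to sign. -/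
lemma pairWeight_reflect (s : Bool) (α : ℝ) (u : ℤ) (p : ℤ × ℤ) :
    pairWeight s α (p.1 + p.2 - u) p = pairWeight s α u p := by
  cases s
  · simp only [pairWeight]
    rw [mul_comm, ← jb_neg, ← jb_neg ((p.1 + p.2 - u - p.1 : ℤ) : ℝ)]
    push_cast
    ring_nf
  · rfl

lemma pairWeight_swap (s : Bool) (α : ℝ) (u : ℤ) (p : ℤ × ℤ) :
    pairWeight s α u p.swap = pairWeight s α u p := by
  cases s <;> exact mul_comm _ _

section Estimates

variable {q Q r R δ δ₁ ε θ' : ℝ}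

/-- The part of the form where the modulation of the output is eliminated. -/
lemma exists_form_zero_le (X : Exponents q Q r R (1 / (1 / 2 + δ₁)) (1 / 2 - ε) θ')
    (hδ : 0 ≤ δ) (h : δ < δ₁) (h₁ : δ₁ < 1 / 2) (hε : 0 < ε) (s : Bool) :
    ∃ C : ℝ≥0∞, C ≠ ∞ ∧ ∀ (κ : ℝ≥0∞) (A₀ A₁ A₂ A₃ : ℤ → ℝ≥0∞) (g₀ g₁ g₂ g₃ : ℤ → ℝ → ℝ≥0∞),
      Normalized Q r R δ κ A₀ A₁ A₂ A₃ g₀ g₁ g₂ g₃ →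
      ∑' ξ, ∑' p : NzPair, pairWeight s (1 / 2) ξ p *
        (A₀ ξ * A₁ (ξ - p.1.1) * A₂ (ξ - p.1.2) * A₃ (p.1.1 + p.1.2 - ξ)) *
        quadForm (g₀ ξ) (wt (g₁ (ξ - p.1.1))) (wt (g₂ (ξ - p.1.2))) (wt (g₃ (p.1.1 + p.1.2 - ξ)))
          (2 * ((p.1.1 : ℝ) * p.1.2)) ≤ C * κ := by
  obtain ⟨C₁, hC₁, H₁⟩ := exists_tsum_tsum_quadForm_le hδ h h₁ hε
  obtain ⟨C₂, hC₂, H₂⟩ : ∃ C : ℝ≥0∞, C ≠ ∞ ∧ ∀ E a b D : ℤ → ℝ≥0∞, ∑' n, E n ^ r ≤ 1 →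
      ∑' n, a n ^ Q ≤ 1 → ∑' n, b n ^ Q ≤ 1 → ∑' n, D n ^ R ≤ 1 →
      ∑' u, E u * (∑' p : ℤ × ℤ, (pairWeight s (1 / 2 - ε) u p *
        (a (u - p.1) * b (u - p.2) * D (p.1 + p.2 - u))) ^ (1 / (1 / 2 + δ₁))) ^
          (1 / (1 / (1 / 2 + δ₁))) ≤ C := by
    have htR := X.t_lt_two.le.trans X.hR
    have hc := (add_comm (1 / R) (1 / r)).trans X.hr
    cases s
    · obtain ⟨C, hC, H⟩ := X.exists_front_freq
      exact ⟨C, hC, H R r htR hc X.r_pos⟩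
    · obtain ⟨C, hC, H⟩ := X.exists_front_diff
      exact ⟨C, hC, H R r htR hc X.r_pos⟩
  refine ⟨C₁ * (2 ^ ε * C₂), by finiteness, fun κ A₀ A₁ A₂ A₃ g₀ g₁ g₂ g₃ D => ?_⟩
  calc _ = ∑' ξ, ∑' p : NzPair, A₀ ξ * (pairWeight s (1 / 2) ξ p *
        (A₁ (ξ - p.1.1) * A₂ (ξ - p.1.2) * A₃ (p.1.1 + p.1.2 - ξ))) *
        quadForm (g₀ ξ) (wt (g₁ (ξ - p.1.1))) (wt (g₂ (ξ - p.1.2))) (wt (g₃ (p.1.1 + p.1.2 - ξ)))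
          (2 * ((p.1.1 : ℝ) * p.1.2)) :=
        tsum_congr fun ξ => tsum_congr fun p => by ring
    _ ≤ _ := H₁ κ A₀ (fun u p => pairWeight s (1 / 2) u p *
          (A₁ (u - p.1) * A₂ (u - p.2) * A₃ (p.1 + p.2 - u))) g₀ (fun u p => g₁ (u - p.1))
          (fun u p => g₂ (u - p.2)) (fun u p => g₃ (p.1 + p.2 - u)) D.ne_zero D.ne_top D.hg₀
          (fun u => D.hg₁.comp _) (fun u => D.hg₂.comp _) (fun u => D.hg₃.comp _)
          (fun u p => D.gain₃ _)
    _ ≤ C₁ * κ * ∑' u, A₀ u * (2 ^ ε * (∑' p : ℤ × ℤ, (pairWeight s (1 / 2 - ε) u p *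
          (A₁ (u - p.1) * A₂ (u - p.2) * A₃ (p.1 + p.2 - u))) ^ (1 / (1 / 2 + δ₁))) ^
          (1 / (1 / (1 / 2 + δ₁)))) := by
        refine mul_le_mul_right (ENNReal.tsum_le_tsum fun u => mul_le_mul_right ?_ _) _
        refine tsum_rpow_le_of_le X.t_pos fun p => ?_
        rw [mul_right_comm, ← mul_assoc (2 ^ ε)]
        exact mul_le_mul_left (pairWeight_mul_le hε.le s u p) _
    _ ≤ C₁ * κ * (2 ^ ε * C₂) := by
        refine mul_le_mul_right ?_ _
        simp_rw [mul_left_comm (A₀ _)]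
        rw [ENNReal.tsum_mul_left]
        exact mul_le_mul_right (H₂ A₀ A₁ A₂ A₃ D.hA₀ D.hA₁ D.hA₂ D.hA₃) _
    _ = _ := by ring

/-- The part of the form where the modulation of the first input is eliminated. -/
lemma exists_form_one_le (X : Exponents q Q r R (1 / (1 / 2 + δ₁)) (1 / 2 - ε) θ')
    (hδ : 0 ≤ δ) (h : δ < δ₁) (h₁ : δ₁ < 1 / 2) (hε : 0 < ε) (s : Bool) :
    ∃ C : ℝ≥0∞, C ≠ ∞ ∧ ∀ (κ : ℝ≥0∞) (A₀ A₁ A₂ A₃ : ℤ → ℝ≥0∞) (g₀ g₁ g₂ g₃ : ℤ → ℝ → ℝ≥0∞),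
      Normalized Q r R δ κ A₀ A₁ A₂ A₃ g₀ g₁ g₂ g₃ →
      ∑' ξ, ∑' p : NzPair, pairWeight s (1 / 2) ξ p *
        (A₀ ξ * A₁ (ξ - p.1.1) * A₂ (ξ - p.1.2) * A₃ (p.1.1 + p.1.2 - ξ)) *
        quadForm (wt (g₀ ξ)) (g₁ (ξ - p.1.1)) (wt (g₂ (ξ - p.1.2))) (wt (g₃ (p.1.1 + p.1.2 - ξ)))
          (2 * ((p.1.1 : ℝ) * p.1.2)) ≤ C * κ := by
  obtain ⟨C₁, hC₁, H₁⟩ := exists_tsum_tsum_quadForm_le hδ h h₁ hε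
  obtain ⟨C₂, hC₂, H₂⟩ : ∃ C : ℝ≥0∞, C ≠ ∞ ∧ ∀ E a A₀ A₃ : ℤ → ℝ≥0∞, ∑' n, E n ^ Q ≤ 1 →
      ∑' n, a n ^ Q ≤ 1 → ∑' n, A₀ n ^ r ≤ 1 → ∑' n, A₃ n ^ R ≤ 1 →
      ∑' u, E u * (∑' p : ℤ × ℤ, (pairWeight s (1 / 2 - ε) (u + p.1) p *
        (A₀ (u + p.1) * a (u + p.1 - p.2) * A₃ (p.2 - u))) ^ (1 / (1 / 2 + δ₁))) ^
          (1 / (1 / (1 / 2 + δ₁))) ≤ C := by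
    cases s
    · simp only [pairWeight, add_sub_cancel_right]
      exact X.exists_side_freq
    · exact X.exists_side_diff
  refine ⟨C₁ * (2 ^ ε * C₂), by finiteness, fun κ A₀ A₁ A₂ A₃ g₀ g₁ g₂ g₃ D => ?_⟩
  have e3 : ∀ (p : NzPair) (u : ℤ), p.1.1 + p.1.2 - (u + p.1.1) = p.1.2 - u := by
    intros; ring
  calc _ = ∑' u, ∑' p : NzPair, A₁ u * (pairWeight s (1 / 2) (u + p.1.1) p *
        (A₀ (u + p.1.1) * A₂ (u + p.1.1 - p.1.2) * A₃ (p.1.2 - u))) *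
        quadForm (g₁ u) (wt (g₀ (u + p.1.1))) (wt (g₂ (u + p.1.1 - p.1.2)))
          (wt (g₃ (p.1.2 - u))) (2 * ((p.1.1 : ℝ) * p.1.2)) := by
        -- The new summation variable is u = ξ₁, so ξ = u + d.
        rw [tsum_tsum_reindex (fun p : NzPair => Equiv.addRight p.1.1)]
        refine tsum_congr fun u => tsum_congr fun p => ?_
        simp only [Equiv.coe_addRight, add_sub_cancel_right, e3]
        rw [quadForm_swap_first (measurable_wt (D.hg₀.measurable _)) (D.hg₁.measurable _)
          (measurable_wt (D.hg₂.measurable _)) (measurable_wt (D.hg₃.measurable _))]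
        ring
    _ ≤ _ := H₁ κ A₁ (fun u p => pairWeight s (1 / 2) (u + p.1) p *
          (A₀ (u + p.1) * A₂ (u + p.1 - p.2) * A₃ (p.2 - u))) g₁ (fun u p => g₀ (u + p.1))
          (fun u p => g₂ (u + p.1 - p.2)) (fun u p => g₃ (p.2 - u)) D.ne_zero D.ne_top D.hg₁
          (fun u => D.hg₀.comp _) (fun u => D.hg₂.comp _) (fun u => D.hg₃.comp _)
          (fun u p => D.gain₃ _)
    _ ≤ C₁ * κ * ∑' u, A₁ u * (2 ^ ε * (∑' p : ℤ × ℤ, (pairWeight s (1 / 2 - ε) (u + p.1) p *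
          (A₀ (u + p.1) * A₂ (u + p.1 - p.2) * A₃ (p.2 - u))) ^ (1 / (1 / 2 + δ₁))) ^
          (1 / (1 / (1 / 2 + δ₁)))) := by
        refine mul_le_mul_right (ENNReal.tsum_le_tsum fun u => mul_le_mul_right ?_ _) _
        refine tsum_rpow_le_of_le X.t_pos fun p => ?_
        rw [mul_right_comm, ← mul_assoc (2 ^ ε)]
        exact mul_le_mul_left (pairWeight_mul_le hε.le s (u + p.1) p) _
    _ ≤ C₁ * κ * (2 ^ ε * C₂) := by
        refine mul_le_mul_right ?_ _
        simp_rw [mul_left_comm (A₁ _)]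
        rw [ENNReal.tsum_mul_left]
        exact mul_le_mul_right (H₂ A₁ A₂ A₀ A₃ D.hA₁ D.hA₂ D.hA₀ D.hA₃) _
    _ = _ := by ring

/-- The part of the form where the modulation of the second input is eliminated. -/
lemma exists_form_two_le (X : Exponents q Q r R (1 / (1 / 2 + δ₁)) (1 / 2 - ε) θ')
    (hδ : 0 ≤ δ) (h : δ < δ₁) (h₁ : δ₁ < 1 / 2) (hε : 0 < ε) (s : Bool) :
    ∃ C : ℝ≥0∞, C ≠ ∞ ∧ ∀ (κ : ℝ≥0∞) (A₀ A₁ A₂ A₃ : ℤ → ℝ≥0∞) (g₀ g₁ g₂ g₃ : ℤ → ℝ → ℝ≥0∞),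
      Normalized Q r R δ κ A₀ A₁ A₂ A₃ g₀ g₁ g₂ g₃ →
      ∑' ξ, ∑' p : NzPair, pairWeight s (1 / 2) ξ p *
        (A₀ ξ * A₁ (ξ - p.1.1) * A₂ (ξ - p.1.2) * A₃ (p.1.1 + p.1.2 - ξ)) *
        quadForm (wt (g₀ ξ)) (wt (g₁ (ξ - p.1.1))) (g₂ (ξ - p.1.2)) (wt (g₃ (p.1.1 + p.1.2 - ξ)))
          (2 * ((p.1.1 : ℝ) * p.1.2)) ≤ C * κ := by
  obtain ⟨C, hC, H⟩ := exists_form_one_le X hδ h h₁ hε s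
  refine ⟨C, hC, fun κ A₀ A₁ A₂ A₃ g₀ g₁ g₂ g₃ D => le_trans (le_of_eq ?_)
    (H κ A₀ A₂ A₁ A₃ g₀ g₂ g₁ g₃ D.swap)⟩
  refine tsum_congr fun ξ => ?_
  let σ : NzPair ≃ NzPair := (Equiv.prodComm ℤ ℤ).subtypeEquiv fun p => and_comm
  rw [← σ.tsum_eq]
  refine tsum_congr fun p => ?_
  have e1 : (σ p).1.1 = p.1.2 := rfl
  have e2 : (σ p).1.2 = p.1.1 := rfl
  have e3 : pairWeight s (1 / 2) ξ (σ p).1 = pairWeight s (1 / 2) ξ p.1 := pairWeight_swap s _ ξ p.1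
  rw [e3, e1, e2, quadForm_swap_middle (measurable_wt (D.hg₁.measurable _)) (D.hg₂.measurable _)
    (measurable_wt (D.hg₃.measurable _)), add_comm p.1.2 p.1.1, mul_comm (p.1.2 : ℝ)]
  ring

/-- The part of the form where the modulation of the conjugated input is eliminated. -/
lemma exists_form_three_le (X : Exponents q Q r R (1 / (1 / 2 + δ₁)) (1 / 2 - ε) θ')
    (hδ : 0 ≤ δ) (h : δ < δ₁) (h₁ : δ₁ < 1 / 2) (hε : 0 < ε) (s : Bool) :
    ∃ C : ℝ≥0∞, C ≠ ∞ ∧ ∀ (κ : ℝ≥0∞) (A₀ A₁ A₂ A₃ : ℤ → ℝ≥0∞) (g₀ g₁ g₂ g₃ : ℤ → ℝ → ℝ≥0∞),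
      Normalized Q r R δ κ A₀ A₁ A₂ A₃ g₀ g₁ g₂ g₃ →
      ∑' ξ, ∑' p : NzPair, pairWeight s (1 / 2) ξ p *
        (A₀ ξ * A₁ (ξ - p.1.1) * A₂ (ξ - p.1.2) * A₃ (p.1.1 + p.1.2 - ξ)) *
        quadForm (wt (g₀ ξ)) (wt (g₁ (ξ - p.1.1))) (wt (g₂ (ξ - p.1.2))) (g₃ (p.1.1 + p.1.2 - ξ))
          (2 * ((p.1.1 : ℝ) * p.1.2)) ≤ C * κ := by
  obtain ⟨C₁, hC₁, H₁⟩ := exists_tsum_tsum_quadForm_le hδ h h₁ hε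
  obtain ⟨C₂, hC₂, H₂⟩ : ∃ C : ℝ≥0∞, C ≠ ∞ ∧ ∀ E a b D : ℤ → ℝ≥0∞, ∑' n, E n ^ R ≤ 1 →
      ∑' n, a n ^ Q ≤ 1 → ∑' n, b n ^ Q ≤ 1 → ∑' n, D n ^ r ≤ 1 →
      ∑' u, E u * (∑' p : ℤ × ℤ, (pairWeight s (1 / 2 - ε) u p *
        (a (u - p.1) * b (u - p.2) * D (p.1 + p.2 - u))) ^ (1 / (1 / 2 + δ₁))) ^
          (1 / (1 / (1 / 2 + δ₁))) ≤ C := by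
    have htr := X.t_lt_q.trans X.q_le_r
    cases s
    · obtain ⟨C, hC, H⟩ := X.exists_front_freq
      exact ⟨C, hC, H r R htr X.hr X.R_pos⟩
    · obtain ⟨C, hC, H⟩ := X.exists_front_diff
      exact ⟨C, hC, H r R htr X.hr X.R_pos⟩
  refine ⟨C₁ * (2 ^ ε * C₂), by finiteness, fun κ A₀ A₁ A₂ A₃ g₀ g₁ g₂ g₃ D => ?_⟩
  have hneg : ∀ (x : ℤ) (u : ℤ), x - u = -(u - x) := by intros; ring
  calc _ = ∑' u, ∑' p : NzPair, A₃ u * (pairWeight s (1 / 2) u p *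
        (A₂ (-(u - p.1.1)) * A₁ (-(u - p.1.2)) * A₀ (p.1.1 + p.1.2 - u))) *
        quadForm (g₃ u) (wt (g₀ (p.1.1 + p.1.2 - u))) (wt (g₂ (-(u - p.1.1))))
          (wt (g₁ (-(u - p.1.2)))) (2 * ((p.1.1 : ℝ) * p.1.2)) := by
        -- The new variable is u = ξ₃. Then ξ₁ = -(u - e) and ξ₂ = -(u - d): the first two inputs
        -- trade places and are reflected, and the sum has the shape it had for the output.
        rw [tsum_tsum_reindex (fun p : NzPair => Equiv.subLeft (p.1.1 + p.1.2))]
        refine tsum_congr fun u => tsum_congr fun p => ?_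
        have e1 : p.1.1 + p.1.2 - u - p.1.1 = -(u - p.1.2) := by ring
        have e2 : p.1.1 + p.1.2 - u - p.1.2 = -(u - p.1.1) := by ring
        simp only [Equiv.subLeft_apply, e1, e2, sub_sub_cancel, pairWeight_reflect]
        rw [quadForm_swap_middle (measurable_wt (D.hg₁.measurable _))
            (measurable_wt (D.hg₂.measurable _)) (D.hg₃.measurable _),
          quadForm_swap_last, quadForm_swap_middle (measurable_wt (D.hg₂.measurable _))
            (D.hg₃.measurable _) (measurable_wt (D.hg₁.measurable _)),
          quadForm_swap_first (measurable_wt (D.hg₀.measurable _)) (D.hg₃.measurable _)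
          (measurable_wt (D.hg₂.measurable _)) (measurable_wt (D.hg₁.measurable _))]
        ring
    -- The last slot, which supplies the gain, must hold an input; the output has none to offer and
    -- the third input is the one eliminated, so the first input takes it.
    _ ≤ _ := H₁ κ A₃ (fun u p => pairWeight s (1 / 2) u p *
          (A₂ (-(u - p.1)) * A₁ (-(u - p.2)) * A₀ (p.1 + p.2 - u))) g₃
          (fun u p => g₀ (p.1 + p.2 - u))
          (fun u p => g₂ (-(u - p.1))) (fun u p => g₁ (-(u - p.2))) D.ne_zero D.ne_top D.hg₃
          (fun u => D.hg₀.comp _) (fun u => D.hg₂.comp _) (fun u => D.hg₁.comp _)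
          (fun u p => D.gain₁ _)
    _ ≤ C₁ * κ * ∑' u, A₃ u * (2 ^ ε * (∑' p : ℤ × ℤ, (pairWeight s (1 / 2 - ε) u p *
          (A₂ (-(u - p.1)) * A₁ (-(u - p.2)) * A₀ (p.1 + p.2 - u))) ^ (1 / (1 / 2 + δ₁))) ^
          (1 / (1 / (1 / 2 + δ₁)))) := by
        refine mul_le_mul_right (ENNReal.tsum_le_tsum fun u => mul_le_mul_right ?_ _) _
        refine tsum_rpow_le_of_le X.t_pos fun p => ?_
        rw [mul_right_comm, ← mul_assoc (2 ^ ε)]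
        exact mul_le_mul_left (pairWeight_mul_le hε.le s u p) _
    _ ≤ C₁ * κ * (2 ^ ε * C₂) := by
        refine mul_le_mul_right ?_ _
        simp_rw [mul_left_comm (A₃ _)]
        rw [ENNReal.tsum_mul_left]
        refine mul_le_mul_right (H₂ A₃ (fun n => A₂ (-n)) (fun n => A₁ (-n)) A₀ D.hA₃ ?_ ?_ D.hA₀) _
        · rw [neg_injective_rpow_sum]; exact D.hA₂
        · rw [neg_injective_rpow_sum]; exact D.hA₁
    _ = _ := by ring

/-- The quadrilinear estimate for the nonresonant part. -/
lemma exists_nonres_form_le (X : Exponents q Q r R (1 / (1 / 2 + δ₁)) (1 / 2 - ε) θ')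
    (hδ : 0 ≤ δ) (h : δ < δ₁) (h₁ : δ₁ < 1 / 2) (hε : 0 < ε) :
    ∃ C : ℝ≥0∞, C ≠ ∞ ∧ ∀ (κ : ℝ≥0∞) (A₀ A₁ A₂ A₃ : ℤ → ℝ≥0∞) (g₀ g₁ g₂ g₃ : ℤ → ℝ → ℝ≥0∞),
      Normalized Q r R δ κ A₀ A₁ A₂ A₃ g₀ g₁ g₂ g₃ →
      ∑' ξ : ℤ, ∑' p : NzPair, jb ξ ^ (1 / 2 : ℝ) *
        ENNReal.ofReal |((p.1.1 + p.1.2 - ξ : ℤ) : ℝ)| *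
        (jb (ξ - p.1.1 : ℤ) ^ (-(1 / 2) : ℝ) * jb (ξ - p.1.2 : ℤ) ^ (-(1 / 2) : ℝ) *
          jb (p.1.1 + p.1.2 - ξ : ℤ) ^ (-(1 / 2) : ℝ)) *
        (A₀ ξ * A₁ (ξ - p.1.1) * A₂ (ξ - p.1.2) * A₃ (p.1.1 + p.1.2 - ξ)) *
        quadForm (wt (g₀ ξ)) (wt (g₁ (ξ - p.1.1))) (wt (g₂ (ξ - p.1.2)))
          (wt (g₃ (p.1.1 + p.1.2 - ξ))) (2 * ((p.1.1 : ℝ) * p.1.2)) ≤ C * κ := by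
  choose C₀ hC₀ H₀ using exists_form_zero_le X hδ h h₁ hε
  choose C₁ hC₁ H₁ using exists_form_one_le X hδ h h₁ hε
  choose C₂ hC₂ H₂ using exists_form_two_le X hδ h h₁ hε
  choose C₃ hC₃ H₃ using exists_form_three_le X hδ h h₁ hε
  refine ⟨2 * ((C₀ true + C₁ true + C₂ true + C₃ true) +
    (C₀ false + C₁ false + C₂ false + C₃ false)), by
      have := hC₀ true; have := hC₁ true; have := hC₂ true; have := hC₃ true
      have := hC₀ false; have := hC₁ false; have := hC₂ false; have := hC₃ false
      finiteness,
    fun κ A₀ A₁ A₂ A₃ g₀ g₁ g₂ g₃ D => ?_⟩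
  set M : ℤ → NzPair → ℝ≥0∞ := fun ξ p =>
    A₀ ξ * A₁ (ξ - p.1.1) * A₂ (ξ - p.1.2) * A₃ (p.1.1 + p.1.2 - ξ) with hM
  set q₀ : ℤ → NzPair → ℝ≥0∞ := fun ξ p => quadForm (g₀ ξ) (wt (g₁ (ξ - p.1.1)))
    (wt (g₂ (ξ - p.1.2))) (wt (g₃ (p.1.1 + p.1.2 - ξ))) (2 * ((p.1.1 : ℝ) * p.1.2)) with hq₀
  set q₁ : ℤ → NzPair → ℝ≥0∞ := fun ξ p => quadForm (wt (g₀ ξ)) (g₁ (ξ - p.1.1))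
    (wt (g₂ (ξ - p.1.2))) (wt (g₃ (p.1.1 + p.1.2 - ξ))) (2 * ((p.1.1 : ℝ) * p.1.2)) with hq₁
  set q₂ : ℤ → NzPair → ℝ≥0∞ := fun ξ p => quadForm (wt (g₀ ξ)) (wt (g₁ (ξ - p.1.1)))
    (g₂ (ξ - p.1.2)) (wt (g₃ (p.1.1 + p.1.2 - ξ))) (2 * ((p.1.1 : ℝ) * p.1.2)) with hq₂
  set q₃ : ℤ → NzPair → ℝ≥0∞ := fun ξ p => quadForm (wt (g₀ ξ)) (wt (g₁ (ξ - p.1.1)))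
    (wt (g₂ (ξ - p.1.2))) (g₃ (p.1.1 + p.1.2 - ξ)) (2 * ((p.1.1 : ℝ) * p.1.2)) with hq₃
  have add : ∀ F G : ℤ → NzPair → ℝ≥0∞,
      ∑' ξ, ∑' p, (F ξ p + G ξ p) = ∑' ξ, ∑' p, F ξ p + ∑' ξ, ∑' p, G ξ p := by
    intro F G
    simp_rw [ENNReal.tsum_add]
  have one : ∀ s, ∑' ξ, ∑' p : NzPair, (pairWeight s (1 / 2) ξ p * M ξ p * q₀ ξ p +
      pairWeight s (1 / 2) ξ p * M ξ p * q₁ ξ p + pairWeight s (1 / 2) ξ p * M ξ p * q₂ ξ p +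
      pairWeight s (1 / 2) ξ p * M ξ p * q₃ ξ p) ≤ (C₀ s + C₁ s + C₂ s + C₃ s) * κ := by
    intro s
    rw [add, add, add, add_mul, add_mul, add_mul]
    exact add_le_add (add_le_add (add_le_add (H₀ s κ _ _ _ _ _ _ _ _ D) (H₁ s κ _ _ _ _ _ _ _ _ D))
      (H₂ s κ _ _ _ _ _ _ _ _ D)) (H₃ s κ _ _ _ _ _ _ _ _ D)
  calc _ ≤ ∑' ξ, ∑' p : NzPair, 2 * ((pairWeight true (1 / 2) ξ p * M ξ p * q₀ ξ p +
      pairWeight true (1 / 2) ξ p * M ξ p * q₁ ξ p + pairWeight true (1 / 2) ξ p * M ξ p * q₂ ξ p +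
      pairWeight true (1 / 2) ξ p * M ξ p * q₃ ξ p) +
      (pairWeight false (1 / 2) ξ p * M ξ p * q₀ ξ p +
      pairWeight false (1 / 2) ξ p * M ξ p * q₁ ξ p +
      pairWeight false (1 / 2) ξ p * M ξ p * q₂ ξ p +
      pairWeight false (1 / 2) ξ p * M ξ p * q₃ ξ p)) := by
        refine ENNReal.tsum_le_tsum fun ξ => ENNReal.tsum_le_tsum fun p => ?_
        have h1 := multiplier_le (ξ := ξ) p.2.1 p.2.2
        have h2 := jb_rpow_half_mul_quadForm_le (D.hg₀.measurable ξ) (D.hg₁.measurable (ξ - p.1.1))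
          (D.hg₂.measurable (ξ - p.1.2)) (D.hg₃.measurable (p.1.1 + p.1.2 - ξ))
          (2 * ((p.1.1 : ℝ) * p.1.2))
        calc _ ≤ 2 * jb (2 * ((p.1.1 : ℝ) * p.1.2)) ^ (1 / 2 : ℝ) *
              (pairWeight true (1 / 2) ξ p + pairWeight false (1 / 2) ξ p) * M ξ p *
              quadForm (wt (g₀ ξ)) (wt (g₁ (ξ - p.1.1))) (wt (g₂ (ξ - p.1.2)))
                (wt (g₃ (p.1.1 + p.1.2 - ξ))) (2 * ((p.1.1 : ℝ) * p.1.2)) :=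
              mul_le_mul_left (mul_le_mul_left h1 _) _
          _ = 2 * (pairWeight true (1 / 2) ξ p + pairWeight false (1 / 2) ξ p) * M ξ p *
              (jb (2 * ((p.1.1 : ℝ) * p.1.2)) ^ (1 / 2 : ℝ) *
              quadForm (wt (g₀ ξ)) (wt (g₁ (ξ - p.1.1))) (wt (g₂ (ξ - p.1.2)))
                (wt (g₃ (p.1.1 + p.1.2 - ξ))) (2 * ((p.1.1 : ℝ) * p.1.2))) := by ring
          _ ≤ 2 * (pairWeight true (1 / 2) ξ p + pairWeight false (1 / 2) ξ p) * M ξ p *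
              (q₀ ξ p + q₁ ξ p + q₂ ξ p + q₃ ξ p) := mul_le_mul_right h2 _
          _ = _ := by ring
    _ ≤ 2 * ((C₀ true + C₁ true + C₂ true + C₃ true) * κ +
        (C₀ false + C₁ false + C₂ false + C₃ false) * κ) := by
        simp_rw [ENNReal.tsum_mul_left]
        rw [add]
        exact mul_le_mul_right (add_le_add (one true) (one false)) _
    _ = _ := by ring

end Estimates

end

section

/-! ### Duality -/

/-- Testing with the extremisers of Hölder, g = G/‖G‖ in L² and A proportional to ‖G‖^{R-1} in ℓ^r.
The test hypothesis concerns the larger family G', so it applies unchanged to all truncations. -/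
lemma dual_truncated_le {r R : ℝ} (hr : 0 < r) (hR : 1 < R) (hc : 1 / r + 1 / R = 1)
    {G G' : ℤ → ℝ → ℝ≥0∞} (hG : ∀ n, Measurable (G n)) (hGG' : ∀ n x, G n x ≤ G' n x)
    (hfin : ∀ n, ∫⁻ x, G n x ^ (2 : ℝ) ≠ ∞) {C : ℝ≥0∞}
    (H : ∀ (A : ℤ → ℝ≥0∞) (g : ℤ → ℝ → ℝ≥0∞), ∑' n, A n ^ r ≤ 1 → UnitFamily g →
      ∑' n, A n * ∫⁻ x, g n x * G' n x ≤ C) (S : Finset ℤ) :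
    ∑ n ∈ S, (∫⁻ x, G n x ^ (2 : ℝ)) ^ (R / 2) ≤ C ^ R := by
  classical
  have hR0 : 0 < R := one_pos.trans hR
  set m : ℤ → ℝ≥0∞ := fun n => (∫⁻ x, G n x ^ (2 : ℝ)) ^ (1 / 2 : ℝ) with hm
  have hmt : ∀ n, m n ≠ ∞ := fun n => ENNReal.rpow_ne_top_of_nonneg (by norm_num) (hfin n)
  have hm2 : ∀ n, ∫⁻ x, G n x ^ (2 : ℝ) = m n ^ (2 : ℝ) := fun n => by
    rw [hm]; simp only; rw [← ENNReal.rpow_mul]; norm_num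
  set M : ℝ≥0∞ := ∑ n ∈ S, m n ^ R with hM
  have hMeq : ∑ n ∈ S, (∫⁻ x, G n x ^ (2 : ℝ)) ^ (R / 2) = M := by
    refine Finset.sum_congr rfl fun n _ => ?_
    rw [hm2, ← ENNReal.rpow_mul, mul_div_cancel₀ _ two_ne_zero]
  rw [hMeq]
  have hMt : M ≠ ∞ := (ENNReal.sum_lt_top.2 fun n _ =>
    (ENNReal.rpow_ne_top_of_nonneg hR0.le (hmt n)).lt_top).ne
  rcases eq_or_ne M 0 with h0 | h0
  · rw [h0]; exact zero_le
  set A : ℤ → ℝ≥0∞ := fun n => if n ∈ S then m n ^ (R - 1) * M ^ (-(1 / r)) else 0 with hA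
  set g : ℤ → ℝ → ℝ≥0∞ := fun n x => (m n)⁻¹ * G n x with hg
  have hexp : (R - 1) * r = R := by
    have : r * R * (1 / r + 1 / R) = r * R := by rw [hc, mul_one]
    have e : r * R * (1 / r + 1 / R) = R + r := by field_simp
    linarith
  have h1 : ∑' n, A n ^ r ≤ 1 := by
    rw [tsum_eq_sum (s := S) fun n hn => by simp [hA, hn, hr]]
    calc ∑ n ∈ S, A n ^ r = ∑ n ∈ S, m n ^ R * M⁻¹ := by
          refine Finset.sum_congr rfl fun n hn => ?_
          simp only [hA, hn, if_true]
          rw [ENNReal.mul_rpow_of_nonneg _ _ hr.le, ← ENNReal.rpow_mul (m n), ← ENNReal.rpow_mul M, hexp,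
            neg_mul, one_div_mul_cancel hr.ne', ENNReal.rpow_neg_one]
      _ = M * M⁻¹ := by rw [← Finset.sum_mul]
      _ ≤ 1 := ENNReal.mul_inv_le_one M
  have h2 : UnitFamily g := by
    refine ⟨fun n => (hG n).const_mul _, fun n => ?_⟩
    calc ∫⁻ x, g n x ^ (2 : ℝ) = ∫⁻ x, ((m n)⁻¹) ^ (2 : ℝ) * G n x ^ (2 : ℝ) :=
          lintegral_congr fun x => ENNReal.mul_rpow_of_nonneg _ _ (by norm_num)
      _ = ((m n)⁻¹ * m n) ^ (2 : ℝ) := by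
          rw [lintegral_const_mul _ ((hG n).pow_const _), hm2,
            ENNReal.mul_rpow_of_nonneg _ _ (by norm_num)]
      _ ≤ 1 := ENNReal.rpow_le_one (by rw [mul_comm]; exact ENNReal.mul_inv_le_one _) (by norm_num)
  have h3 : ∀ n, m n ≤ ∫⁻ x, g n x * G' n x := by
    intro n
    calc m n ≤ (m n)⁻¹ * m n ^ (2 : ℝ) := by
          rcases eq_or_ne (m n) 0 with h | h
          · rw [h]; exact zero_le
          · rw [ENNReal.rpow_two, sq, ← mul_assoc, ENNReal.inv_mul_cancel h (hmt n), one_mul]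
      _ = ∫⁻ x, (m n)⁻¹ * G n x ^ (2 : ℝ) := by
          rw [lintegral_const_mul _ ((hG n).pow_const _), hm2]
      _ ≤ _ := by
          refine lintegral_mono fun x => ?_
          rw [ENNReal.rpow_two, sq, ← mul_assoc]
          exact mul_le_mul_right (hGG' n x) _
  have h4 : M ^ (1 / R) ≤ C := by
    calc M ^ (1 / R) = M * M ^ (-(1 / r)) := by
          conv_rhs => rw [← ENNReal.rpow_one M, ← ENNReal.rpow_mul, one_mul]
          rw [← ENNReal.rpow_add _ _ h0 hMt]
          congr 1; linarith
      _ = ∑ n ∈ S, A n * m n := by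
          rw [hM, Finset.sum_mul]
          refine Finset.sum_congr rfl fun n hn => ?_
          simp only [hA, hn, if_true]
          have : m n ^ R = m n ^ (R - 1) * m n := by
            conv_rhs => rw [← ENNReal.rpow_one (m n), ← ENNReal.rpow_mul, one_mul]
            rw [← ENNReal.rpow_add_of_nonneg _ _ (by linarith) one_pos.le]
            congr 1; ring
          rw [this]
          ring
      _ ≤ ∑ n ∈ S, A n * ∫⁻ x, g n x * G' n x :=
          Finset.sum_le_sum fun n _ => mul_le_mul_right (h3 n) _
      _ ≤ ∑' n, A n * ∫⁻ x, g n x * G' n x := ENNReal.sum_le_tsum S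
      _ ≤ C := H A g h1 h2
  calc M = (M ^ (1 / R)) ^ R := by
        rw [← ENNReal.rpow_mul, one_div_mul_cancel hR0.ne', ENNReal.rpow_one]
    _ ≤ C ^ R := ENNReal.rpow_le_rpow h4 hR0.le

/-- Duality for the mixed norm `ℓ^R L²`. -/
lemma dual_le {r R : ℝ} (hr : 0 < r) (hR : 1 < R) (hc : 1 / r + 1 / R = 1)
    {G : ℤ → ℝ → ℝ≥0∞} (hG : ∀ n, Measurable (G n)) {C : ℝ≥0∞}
    (H : ∀ (A : ℤ → ℝ≥0∞) (g : ℤ → ℝ → ℝ≥0∞), ∑' n, A n ^ r ≤ 1 → UnitFamily g →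
      ∑' n, A n * ∫⁻ x, g n x * G n x ≤ C) :
    ∑' n, (∫⁻ x, G n x ^ (2 : ℝ)) ^ (R / 2) ≤ C ^ R := by
  have hR0 : 0 < R := one_pos.trans hR
  -- The norm of G is not known to be finite, so G is cut off in size and in space, and the bound
  -- passes to the limit by monotone convergence.
  set T : ℕ → ℤ → ℝ → ℝ≥0∞ := fun k n x =>
    (Set.Icc (-(k : ℝ)) k).indicator (fun x => min (G n x) k) x with hT
  have hTm : ∀ k n, Measurable (T k n) := fun k n =>
    ((hG n).min measurable_const).indicator measurableSet_Icc
  have hTle : ∀ k n x, T k n x ≤ G n x := fun k n x =>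
    (Set.indicator_le_self' (fun _ _ => zero_le) x).trans (min_le_left _ _)
  have hmono : ∀ n x, Monotone fun k => T k n x := by
    intro n x k l hkl
    have h1 : (k : ℝ) ≤ l := by exact_mod_cast hkl
    have h2 : (k : ℝ≥0∞) ≤ l := by exact_mod_cast hkl
    calc T k n x ≤ (Set.Icc (-(l : ℝ)) l).indicator (fun x => min (G n x) k) x :=
          Set.indicator_le_indicator_of_subset (Set.Icc_subset_Icc (neg_le_neg h1) h1)
            (fun _ => zero_le) x
      _ ≤ _ := Set.indicator_le_indicator (min_le_min le_rfl h2)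
  have hfin : ∀ k n, ∫⁻ x, T k n x ^ (2 : ℝ) ≠ ∞ := by
    intro k n
    have : ∫⁻ x, T k n x ^ (2 : ℝ) ≤ ∫⁻ x in Set.Icc (-(k : ℝ)) k, (k : ℝ≥0∞) ^ (2 : ℝ) := by
      rw [← lintegral_indicator measurableSet_Icc]
      refine lintegral_mono fun x => ?_
      by_cases hx : x ∈ Set.Icc (-(k : ℝ)) k
      · simp only [hT, Set.indicator_of_mem hx]
        exact ENNReal.rpow_le_rpow (min_le_right _ _) (by norm_num)
      · simp [hT, Set.indicator_of_notMem hx]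
    refine ne_top_of_le_ne_top ?_ this
    rw [setLIntegral_const, Real.volume_Icc]
    finiteness
  have hlim : ∀ n x, Filter.Tendsto (fun k => T k n x) Filter.atTop (nhds (G n x)) := by
    intro n x
    have h1 : Filter.Tendsto (fun k : ℕ => min (G n x) (k : ℝ≥0∞)) Filter.atTop
        (nhds (min (G n x) ∞)) := tendsto_const_nhds.min ENNReal.tendsto_nat_nhds_top
    rw [min_eq_left le_top] at h1
    refine h1.congr' ?_
    obtain ⟨K, hK⟩ := exists_nat_ge |x|
    filter_upwards [Filter.eventually_ge_atTop K] with k hk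
    have : x ∈ Set.Icc (-(k : ℝ)) k := by
      rw [Set.mem_Icc, ← abs_le]
      exact hK.trans (by exact_mod_cast hk)
    simp only [hT, Set.indicator_of_mem this]
  have hI : ∀ n, Filter.Tendsto (fun k => ∫⁻ x, T k n x ^ (2 : ℝ)) Filter.atTop
      (nhds (∫⁻ x, G n x ^ (2 : ℝ))) := by
    intro n
    refine lintegral_tendsto_of_tendsto_of_monotone (fun k => ((hTm k n).pow_const _).aemeasurable)
      (Filter.Eventually.of_forall fun x k l hkl =>
        ENNReal.rpow_le_rpow (hmono n x hkl) (by norm_num))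
      (Filter.Eventually.of_forall fun x => (hlim n x).ennrpow_const _)
  rw [ENNReal.tsum_eq_iSup_sum]
  refine iSup_le fun S => ?_
  refine le_of_tendsto' (tendsto_finsetSum S fun n _ => (hI n).ennrpow_const (R / 2)) fun k => ?_
  exact dual_truncated_le hr hR hc (hTm k) (hTle k) (hfin k) H S

/-! ### The weighted trilinear estimate on the Fourier side -/

section Estimates

variable {q Q r R δ δ₁ ε θ' : ℝ}

/-- The correction term, which carries no resonance. -/
lemma exists_corr_form_le (X : Exponents q Q r R (1 / (1 / 2 + δ₁)) (1 / 2 - ε) θ')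
    (hδ : 0 ≤ δ) (h : δ < δ₁) (h₁ : δ₁ < 1 / 2) :
    ∃ C : ℝ≥0∞, C ≠ ∞ ∧ ∀ (κ : ℝ≥0∞) (A₀ A₁ A₂ A₃ : ℤ → ℝ≥0∞) (g₀ g₁ g₂ g₃ : ℤ → ℝ → ℝ≥0∞),
      Normalized Q r R δ κ A₀ A₁ A₂ A₃ g₀ g₁ g₂ g₃ →
      ∑' ξ : ℤ, jb ξ ^ (1 / 2 : ℝ) * ENNReal.ofReal |(ξ : ℝ)| *
        (jb ξ ^ (-(1 / 2) : ℝ) * jb ξ ^ (-(1 / 2) : ℝ) * jb (-ξ : ℤ) ^ (-(1 / 2) : ℝ)) *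
        (A₀ ξ * A₁ ξ * A₂ ξ * A₃ (-ξ)) *
        quadForm (wt (g₀ ξ)) (wt (g₁ ξ)) (wt (g₂ ξ)) (wt (g₃ (-ξ))) 0 ≤ C * κ := by
  obtain ⟨C, hC, H⟩ := exists_triConv_weighted_le hδ h h₁.le
  refine ⟨C, hC, fun κ A₀ A₁ A₂ A₃ g₀ g₁ g₂ g₃ D => ?_⟩
  -- Without resonance the form is bounded for each ξ by Cauchy–Schwarz alone, the weight of the
  -- output being discarded.
  have hform : ∀ ξ : ℤ, quadForm (wt (g₀ ξ)) (wt (g₁ ξ)) (wt (g₂ ξ)) (wt (g₃ (-ξ))) 0 ≤ C * κ := by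
    intro ξ
    set f : ℝ → ℝ≥0∞ := fun x => g₃ (-ξ) x * jb x ^ (-δ) with hf
    have hfm : Measurable f := (D.hg₃.measurable _).mul (measurable_jb_rpow _)
    have hwt : wt (g₃ (-ξ)) = fun x => f x * jb x ^ (-(1 / 2 - δ)) := by
      funext x
      rw [hf]
      simp only
      rw [wt, mul_assoc, ← jb_rpow_add]
      ring_nf
    set Y : ℝ → ℝ≥0∞ := triConv (fun x => g₁ ξ x ^ (2 : ℝ)) (fun x => g₂ ξ x ^ (2 : ℝ))
      (fun x => f x ^ (2 : ℝ)) with hY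
    have m₁ := (D.hg₁.measurable ξ).pow_const (2 : ℝ)
    have m₂ := (D.hg₂.measurable ξ).pow_const (2 : ℝ)
    have m₃ := hfm.pow_const (2 : ℝ)
    have hYm : Measurable Y := measurable_triConv m₁ m₂ m₃
    rw [quadForm_eq, hwt]
    calc _ ≤ ∫⁻ x, C * ((g₀ ξ x ^ (2 : ℝ)) ^ (1 / 2 : ℝ) * Y (0 - x) ^ (1 / 2 : ℝ)) := by
          refine lintegral_mono fun x => ?_
          calc _ ≤ g₀ ξ x * 1 * (C * 1 * Y (0 - x) ^ (1 / 2 : ℝ)) := by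
                refine mul_le_mul' (mul_le_mul' le_rfl (jb_rpow_le_one _ (by norm_num)))
                  ((H (g₁ ξ) (g₂ ξ) f (D.hg₁.measurable ξ) (D.hg₂.measurable ξ) hfm (0 - x)).trans ?_)
                exact mul_le_mul' (mul_le_mul' le_rfl (jb_rpow_le_one _ (by linarith))) le_rfl
            _ = _ := by
                rw [← ENNReal.rpow_mul]
                norm_num
                ring
      _ = C * ∫⁻ x, (g₀ ξ x ^ (2 : ℝ)) ^ (1 / 2 : ℝ) * Y (0 - x) ^ (1 / 2 : ℝ) :=
          lintegral_const_mul' _ _ hC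
      _ ≤ C * (1 ^ (1 / 2 : ℝ) * (κ ^ (2 : ℝ)) ^ (1 / 2 : ℝ)) := by
          gcongr
          refine (ENNReal.lintegral_mul_norm_pow_le (p := 1 / 2) (q := 1 / 2)
            ((D.hg₀.measurable ξ).pow_const _).aemeasurable
            (hYm.comp (measurable_const.sub measurable_id)).aemeasurable (by norm_num)
            (by norm_num) (by norm_num)).trans ?_
          gcongr
          · exact D.hg₀.le_one ξ
          · change ∫⁻ x, Y (0 - x) ≤ _
            rw [hY, lintegral_triConv m₁ m₂ m₃]
            calc _ ≤ 1 * 1 * κ ^ (2 : ℝ) := by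
                  gcongr
                  · exact D.hg₁.le_one ξ
                  · exact D.hg₂.le_one ξ
                  · exact D.gain₃ (-ξ)
              _ = _ := by rw [one_mul, one_mul]
      _ = C * κ := by rw [← ENNReal.rpow_mul]; norm_num
  -- All four frequencies are ±ξ, and the exponents cancel: 1/2 + 1 - 3/2 = 0. Then A₀ and A₃ are
  -- paired by Hölder, and A₁, A₂ are merely bounded.
  have hmult : ∀ ξ : ℤ, jb ξ ^ (1 / 2 : ℝ) * ENNReal.ofReal |(ξ : ℝ)| *
        (jb ξ ^ (-(1 / 2) : ℝ) * jb ξ ^ (-(1 / 2) : ℝ) * jb (-ξ : ℤ) ^ (-(1 / 2) : ℝ)) ≤ 1 := by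
    intro ξ
    calc _ ≤ jb ξ ^ (1 / 2 : ℝ) * jb ξ ^ (1 : ℝ) *
          (jb ξ ^ (-(1 / 2) : ℝ) * jb ξ ^ (-(1 / 2) : ℝ) * jb ξ ^ (-(1 / 2) : ℝ)) := by
          rw [ENNReal.rpow_one, Int.cast_neg, jb_neg]
          gcongr
          exact ENNReal.ofReal_le_ofReal (abs_le_bracket _)
      _ = 1 := by
          rw [← jb_rpow_add, ← jb_rpow_add, ← jb_rpow_add, ← jb_rpow_add]
          norm_num
  have hA₁ := le_one_of_tsum_rpow_le_one X.Q_pos D.hA₁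
  have hA₂ := le_one_of_tsum_rpow_le_one X.Q_pos D.hA₂
  have hr := X.r_pos
  have hR := X.R_pos
  calc _ ≤ ∑' ξ : ℤ, (A₀ ξ ^ r) ^ (1 / r) * (A₃ (-ξ) ^ R) ^ (1 / R) * (C * κ) := by
        refine ENNReal.tsum_le_tsum fun ξ => mul_le_mul' ?_ (hform ξ)
        rw [← ENNReal.rpow_mul, ← ENNReal.rpow_mul, mul_one_div_cancel hr.ne',
          mul_one_div_cancel hR.ne', ENNReal.rpow_one, ENNReal.rpow_one]
        calc _ ≤ 1 * (A₀ ξ * 1 * 1 * A₃ (-ξ)) := by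
              gcongr
              · exact hmult ξ
              · exact hA₁ ξ
              · exact hA₂ ξ
          _ = _ := by ring
    _ ≤ 1 ^ (1 / r) * 1 ^ (1 / R) * (C * κ) := by
        rw [ENNReal.tsum_mul_right]
        gcongr
        refine (tsum_rpow_mul_le _ _ (by positivity) (by positivity) X.hr).trans ?_
        gcongr
        · exact D.hA₀
        · rw [neg_injective_rpow_sum]; exact D.hA₃
    _ = _ := by simp

lemma triConv_const_mul {c₁ c₂ c₃ : ℝ≥0∞} (h₁ : c₁ ≠ ∞) (h₂ : c₂ ≠ ∞) (h₃ : c₃ ≠ ∞)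
    (a₁ a₂ a₃ : ℝ → ℝ≥0∞) (M : ℝ) :
    triConv (fun x => c₁ * a₁ x) (fun x => c₂ * a₂ x) (fun x => c₃ * a₃ x) M =
      c₁ * c₂ * c₃ * triConv a₁ a₂ a₃ M := by
  have inner : ∀ y, ∫⁻ z, c₂ * a₂ z * (c₃ * a₃ (M - y - z)) =
      c₂ * c₃ * ∫⁻ z, a₂ z * a₃ (M - y - z) := by
    intro y
    rw [← lintegral_const_mul' _ _ (ENNReal.mul_ne_top h₂ h₃)]
    exact lintegral_congr fun z => by ring
  unfold triConv
  simp_rw [inner]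
  rw [← lintegral_const_mul' _ _ (ENNReal.mul_ne_top (ENNReal.mul_ne_top h₁ h₂) h₃)]
  exact lintegral_congr fun y => by ring

/-- The majorant of the space-time Fourier transform of the trilinear operator, in the
modulation variables. -/
def majorant (F₁ F₂ F₃ : ℤ → ℝ → ℝ≥0∞) (ξ : ℤ) (x : ℝ) : ℝ≥0∞ :=
  ∑' p : NzPair, ENNReal.ofReal |((p.1.1 + p.1.2 - ξ : ℤ) : ℝ)| *
    triConv (F₁ (ξ - p.1.1)) (F₂ (ξ - p.1.2)) (F₃ (p.1.1 + p.1.2 - ξ))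
      (2 * ((p.1.1 : ℝ) * p.1.2) - x) +
  ENNReal.ofReal |(ξ : ℝ)| * triConv (F₁ ξ) (F₂ ξ) (F₃ (-ξ)) (0 - x)

lemma measurable_majorant {F₁ F₂ F₃ : ℤ → ℝ → ℝ≥0∞} (h₁ : ∀ n, Measurable (F₁ n))
    (h₂ : ∀ n, Measurable (F₂ n)) (h₃ : ∀ n, Measurable (F₃ n)) (ξ : ℤ) :
    Measurable (majorant F₁ F₂ F₃ ξ) := by
  have hm : ∀ N : ℝ, Measurable fun x : ℝ => N - x := fun N => measurable_const.sub measurable_id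
  refine Measurable.add (Measurable.tsum fun p => Measurable.const_mul ?_ _)
    (Measurable.const_mul ?_ _)
  · exact (measurable_triConv (h₁ _) (h₂ _) (h₃ _)).comp (hm _)
  · exact (measurable_triConv (h₁ _) (h₂ _) (h₃ _)).comp (hm 0)

/-- The square of the `L²`-norm with the weight `⟨x⟩^β`. -/
def sqNorm (β : ℝ) (f : ℝ → ℝ≥0∞) : ℝ≥0∞ := ∫⁻ x, (jb x ^ β * f x) ^ (2 : ℝ)

lemma measurable_sqNorm_integrand {β : ℝ} {f : ℝ → ℝ≥0∞} (hf : Measurable f) :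
    Measurable fun x => (jb x ^ β * f x) ^ (2 : ℝ) :=
  ((measurable_jb_rpow β).mul hf).pow_const _

/-- An input of the trilinear estimate: `A` carries the norms in the modulation, and `κ` is the
gain when the weight in the modulation is lowered by `δ`. -/
structure Admissible (δ : ℝ) (κ : ℝ≥0∞) (A : ℤ → ℝ≥0∞) (F : ℤ → ℝ → ℝ≥0∞) : Prop where
  measurable : ∀ n, Measurable (F n)
  ne_zero : ∀ n, A n ≠ 0
  ne_top : ∀ n, A n ≠ ∞
  norm_le : ∀ n : ℤ, sqNorm (1 / 2) (F n) ≤ (jb n ^ (-(1 / 2) : ℝ) * A n) ^ (2 : ℝ)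
  gain_le : ∀ n : ℤ, sqNorm (1 / 2 - δ) (F n) ≤ (κ * (jb n ^ (-(1 / 2) : ℝ) * A n)) ^ (2 : ℝ)

/-- The normalisation of an admissible input. -/
def normalize (A : ℤ → ℝ≥0∞) (F : ℤ → ℝ → ℝ≥0∞) (n : ℤ) (x : ℝ) : ℝ≥0∞ :=
  (jb n ^ (-(1 / 2) : ℝ) * A n)⁻¹ * (jb x ^ (1 / 2 : ℝ) * F n x)

namespace Admissible

variable {κ : ℝ≥0∞} {A : ℤ → ℝ≥0∞} {F : ℤ → ℝ → ℝ≥0∞} (D : Admissible δ κ A F)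
include D

lemma coeff_ne_zero (n : ℤ) : jb n ^ (-(1 / 2) : ℝ) * A n ≠ 0 :=
  mul_ne_zero (jb_rpow_ne_zero _ _) (D.ne_zero n)

lemma coeff_ne_top (n : ℤ) : jb n ^ (-(1 / 2) : ℝ) * A n ≠ ∞ :=
  ENNReal.mul_ne_top (jb_rpow_ne_top _ _) (D.ne_top n)

lemma coeff_inv_mul (n : ℤ) :
    (jb n ^ (-(1 / 2) : ℝ) * A n)⁻¹ * (jb n ^ (-(1 / 2) : ℝ) * A n) = 1 :=
  ENNReal.inv_mul_cancel (D.coeff_ne_zero n) (D.coeff_ne_top n)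

lemma measurable_normalize (n : ℤ) : Measurable (normalize A F n) :=
  ((measurable_jb_rpow _).mul (D.measurable n)).const_mul _

lemma unitFamily : UnitFamily (normalize A F) := by
  refine ⟨D.measurable_normalize, fun n => ?_⟩
  calc ∫⁻ x, normalize A F n x ^ (2 : ℝ)
      = ((jb n ^ (-(1 / 2) : ℝ) * A n)⁻¹) ^ (2 : ℝ) * sqNorm (1 / 2) (F n) := by
        unfold sqNorm
        rw [← lintegral_const_mul _ (measurable_sqNorm_integrand (D.measurable n))]
        exact lintegral_congr fun x => ENNReal.mul_rpow_of_nonneg _ _ (by norm_num)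
    _ ≤ ((jb n ^ (-(1 / 2) : ℝ) * A n)⁻¹) ^ (2 : ℝ) * (jb n ^ (-(1 / 2) : ℝ) * A n) ^ (2 : ℝ) := by
        gcongr; exact D.norm_le n
    _ = 1 := by
        rw [← ENNReal.mul_rpow_of_nonneg _ _ (by norm_num), D.coeff_inv_mul, ENNReal.one_rpow]

lemma gain (n : ℤ) : ∫⁻ x, (normalize A F n x * jb x ^ (-δ)) ^ (2 : ℝ) ≤ κ ^ (2 : ℝ) := by
  calc ∫⁻ x, (normalize A F n x * jb x ^ (-δ)) ^ (2 : ℝ)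
      = ((jb n ^ (-(1 / 2) : ℝ) * A n)⁻¹) ^ (2 : ℝ) * sqNorm (1 / 2 - δ) (F n) := by
        unfold sqNorm
        rw [← lintegral_const_mul _ (measurable_sqNorm_integrand (D.measurable n))]
        refine lintegral_congr fun x => ?_
        rw [← ENNReal.mul_rpow_of_nonneg _ _ (by norm_num), normalize, sub_eq_add_neg, jb_rpow_add]
        ring_nf
    _ ≤ ((jb n ^ (-(1 / 2) : ℝ) * A n)⁻¹) ^ (2 : ℝ) *
          (κ * (jb n ^ (-(1 / 2) : ℝ) * A n)) ^ (2 : ℝ) := by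
        gcongr; exact D.gain_le n
    _ = κ ^ (2 : ℝ) := by
        rw [← ENNReal.mul_rpow_of_nonneg _ _ (by norm_num), mul_left_comm, D.coeff_inv_mul, mul_one]

lemma eq_coeff_mul_wt (n : ℤ) :
    F n = fun x => jb n ^ (-(1 / 2) : ℝ) * A n * wt (normalize A F n) x := by
  funext x
  rw [wt, normalize, mul_assoc _ _ (jb x ^ (-(1 / 2) : ℝ)), ← mul_assoc,
    ENNReal.mul_inv_cancel (D.coeff_ne_zero n) (D.coeff_ne_top n), one_mul, mul_right_comm,
    ← jb_rpow_add]
  simp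

end Admissible

lemma triConv_eq_of_admissible {κ : ℝ≥0∞} {A₁ A₂ A₃ : ℤ → ℝ≥0∞} {F₁ F₂ F₃ : ℤ → ℝ → ℝ≥0∞}
    (D₁ : Admissible δ κ A₁ F₁) (D₂ : Admissible δ κ A₂ F₂) (D₃ : Admissible δ κ A₃ F₃)
    (k l m : ℤ) (M : ℝ) :
    triConv (F₁ k) (F₂ l) (F₃ m) M =
      (jb k ^ (-(1 / 2) : ℝ) * jb l ^ (-(1 / 2) : ℝ) * jb m ^ (-(1 / 2) : ℝ)) *
      (A₁ k * A₂ l * A₃ m) * triConv (wt (normalize A₁ F₁ k)) (wt (normalize A₂ F₂ l))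
        (wt (normalize A₃ F₃ m)) M := by
  conv_lhs => rw [D₁.eq_coeff_mul_wt k, D₂.eq_coeff_mul_wt l, D₃.eq_coeff_mul_wt m]
  rw [triConv_const_mul (D₁.coeff_ne_top k) (D₂.coeff_ne_top l) (D₃.coeff_ne_top m)]
  ring

/-- The trilinear estimate for the majorant. -/
lemma exists_majorant_le (X : Exponents q Q r R (1 / (1 / 2 + δ₁)) (1 / 2 - ε) θ')
    (hδ : 0 ≤ δ) (h : δ < δ₁) (h₁ : δ₁ < 1 / 2) (hε : 0 < ε) :
    ∃ C : ℝ≥0∞, C ≠ ∞ ∧ ∀ (κ : ℝ≥0∞) (A₁ A₂ A₃ : ℤ → ℝ≥0∞) (F₁ F₂ F₃ : ℤ → ℝ → ℝ≥0∞),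
      κ ≠ 0 → κ ≠ ∞ → Admissible δ κ A₁ F₁ → Admissible δ κ A₂ F₂ → Admissible δ κ A₃ F₃ →
      ∑' n, A₁ n ^ Q ≤ 1 → ∑' n, A₂ n ^ Q ≤ 1 → ∑' n, A₃ n ^ R ≤ 1 →
      ∑' ξ : ℤ, (∫⁻ x, (jb x ^ (-(1 / 2) : ℝ) * jb ξ ^ (1 / 2 : ℝ) *
        majorant F₁ F₂ F₃ ξ x) ^ (2 : ℝ)) ^ (R / 2) ≤ (C * κ) ^ R := by
  obtain ⟨C₁, hC₁, H₁⟩ := exists_nonres_form_le X hδ h h₁ hε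
  obtain ⟨C₂, hC₂, H₂⟩ := exists_corr_form_le X hδ h h₁
  refine ⟨C₁ + C₂, by finiteness,
    fun κ A₁ A₂ A₃ F₁ F₂ F₃ hκ0 hκ D₁ D₂ D₃ hA₁ hA₂ hA₃ => ?_⟩
  have hM := measurable_majorant D₁.measurable D₂.measurable D₃.measurable
  -- After dualising, the output weight ⟨x⟩^{-1/2} joins the test function, so the output becomes a
  -- fourth function of the same kind as the inputs.
  refine dual_le X.r_pos (one_lt_two.trans_le X.hR) X.hr
    (fun ξ => ((measurable_jb_rpow _).mul_const _).mul (hM ξ)) fun A₀ g₀ hA₀ hg₀ => ?_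
  have D : Normalized Q r R δ κ A₀ A₁ A₂ A₃ g₀ (normalize A₁ F₁) (normalize A₂ F₂)
      (normalize A₃ F₃) :=
    ⟨hκ0, hκ, hA₀, hA₁, hA₂, hA₃, hg₀, D₁.unitFamily, D₂.unitFamily, D₃.unitFamily, D₁.gain,
      D₂.gain, D₃.gain⟩
  have hm : ∀ N : ℝ, Measurable fun x : ℝ => N - x := fun N => measurable_const.sub measurable_id
  have htm : ∀ (k l m : ℤ) (N : ℝ),
      Measurable fun x => triConv (F₁ k) (F₂ l) (F₃ m) (N - x) := fun k l m N =>
    (measurable_triConv (D₁.measurable k) (D₂.measurable l) (D₃.measurable m)).comp (hm N)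
  have hgm : ∀ ξ, Measurable (wt (g₀ ξ)) := fun ξ => measurable_wt (hg₀.measurable ξ)
  have term : ∀ (ξ k l m : ℤ) (N : ℝ), ∫⁻ x, wt (g₀ ξ) x * triConv (F₁ k) (F₂ l) (F₃ m) (N - x) =
      (jb k ^ (-(1 / 2) : ℝ) * jb l ^ (-(1 / 2) : ℝ) * jb m ^ (-(1 / 2) : ℝ)) *
      (A₁ k * A₂ l * A₃ m) * quadForm (wt (g₀ ξ)) (wt (normalize A₁ F₁ k))
        (wt (normalize A₂ F₂ l)) (wt (normalize A₃ F₃ m)) N := by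
    intro ξ k l m N
    rw [quadForm_eq, ← lintegral_const_mul]
    · refine lintegral_congr fun x => ?_
      rw [triConv_eq_of_admissible D₁ D₂ D₃]
      ring
    · exact (hgm ξ).mul ((measurable_triConv (measurable_wt (D₁.measurable_normalize k))
        (measurable_wt (D₂.measurable_normalize l))
        (measurable_wt (D₃.measurable_normalize m))).comp (hm N))
  have hgt : ∀ (ξ k l m : ℤ) (N : ℝ),
      Measurable fun x => wt (g₀ ξ) x * triConv (F₁ k) (F₂ l) (F₃ m) (N - x) :=
    fun ξ k l m N => (hgm ξ).mul (htm k l m N)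
  have inner : ∀ ξ : ℤ, A₀ ξ * ∫⁻ x, g₀ ξ x * (jb x ^ (-(1 / 2) : ℝ) * jb ξ ^ (1 / 2 : ℝ) *
        majorant F₁ F₂ F₃ ξ x) =
      ∑' p : NzPair, jb ξ ^ (1 / 2 : ℝ) *
        ENNReal.ofReal |((p.1.1 + p.1.2 - ξ : ℤ) : ℝ)| *
        (jb (ξ - p.1.1 : ℤ) ^ (-(1 / 2) : ℝ) * jb (ξ - p.1.2 : ℤ) ^ (-(1 / 2) : ℝ) *
          jb (p.1.1 + p.1.2 - ξ : ℤ) ^ (-(1 / 2) : ℝ)) *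
        (A₀ ξ * A₁ (ξ - p.1.1) * A₂ (ξ - p.1.2) * A₃ (p.1.1 + p.1.2 - ξ)) *
        quadForm (wt (g₀ ξ)) (wt (normalize A₁ F₁ (ξ - p.1.1))) (wt (normalize A₂ F₂ (ξ - p.1.2)))
          (wt (normalize A₃ F₃ (p.1.1 + p.1.2 - ξ))) (2 * ((p.1.1 : ℝ) * p.1.2)) +
      jb ξ ^ (1 / 2 : ℝ) * ENNReal.ofReal |(ξ : ℝ)| *
        (jb ξ ^ (-(1 / 2) : ℝ) * jb ξ ^ (-(1 / 2) : ℝ) * jb (-ξ : ℤ) ^ (-(1 / 2) : ℝ)) *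
        (A₀ ξ * A₁ ξ * A₂ ξ * A₃ (-ξ)) *
        quadForm (wt (g₀ ξ)) (wt (normalize A₁ F₁ ξ)) (wt (normalize A₂ F₂ ξ))
          (wt (normalize A₃ F₃ (-ξ))) 0 := by
    intro ξ
    calc _ = A₀ ξ * ∫⁻ x, (∑' p : NzPair, jb ξ ^ (1 / 2 : ℝ) *
            ENNReal.ofReal |((p.1.1 + p.1.2 - ξ : ℤ) : ℝ)| * (wt (g₀ ξ) x *
            triConv (F₁ (ξ - p.1.1)) (F₂ (ξ - p.1.2)) (F₃ (p.1.1 + p.1.2 - ξ))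
              (2 * ((p.1.1 : ℝ) * p.1.2) - x)) +
            jb ξ ^ (1 / 2 : ℝ) * ENNReal.ofReal |(ξ : ℝ)| * (wt (g₀ ξ) x *
              triConv (F₁ ξ) (F₂ ξ) (F₃ (-ξ)) (0 - x))) := by
          congr 1
          refine lintegral_congr fun x => ?_
          rw [majorant, wt, mul_add, mul_add, ← ENNReal.tsum_mul_left, ← ENNReal.tsum_mul_left]
          congr 1
          · refine tsum_congr fun p => by ring
          · ring
      _ = _ := by
          rw [lintegral_add_right _ ((hgt _ _ _ _ _).const_mul _), lintegral_tsum
            (fun p => ((hgt _ _ _ _ _).const_mul _).aemeasurable),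
            lintegral_const_mul _ (hgt _ _ _ _ _), term, mul_add,
            ← ENNReal.tsum_mul_left]
          congr 1
          · refine tsum_congr fun p => ?_
            rw [lintegral_const_mul _ (hgt _ _ _ _ _), term]
            ring
          · ring
  refine le_trans (le_of_eq (tsum_congr inner)) ?_
  rw [ENNReal.tsum_add, add_mul]
  exact add_le_add (H₁ κ _ _ _ _ _ _ _ _ D) (H₂ κ _ _ _ _ _ _ _ _ D)

lemma majorant_const_mul {c₁ c₂ c₃ : ℝ≥0∞} (h₁ : c₁ ≠ ∞) (h₂ : c₂ ≠ ∞) (h₃ : c₃ ≠ ∞)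
    (F₁ F₂ F₃ : ℤ → ℝ → ℝ≥0∞) (ξ : ℤ) (x : ℝ) :
    majorant (fun n x => c₁ * F₁ n x) (fun n x => c₂ * F₂ n x) (fun n x => c₃ * F₃ n x) ξ x =
      c₁ * c₂ * c₃ * majorant F₁ F₂ F₃ ξ x := by
  unfold majorant
  rw [mul_add, ← ENNReal.tsum_mul_left]
  congr 1
  · refine tsum_congr fun p => ?_
    rw [triConv_const_mul h₁ h₂ h₃]
    ring
  · rw [triConv_const_mul h₁ h₂ h₃]
    ring

lemma sqNorm_const_mul {β : ℝ} {c : ℝ≥0∞} {f : ℝ → ℝ≥0∞} (hf : Measurable f) :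
    sqNorm β (fun x => c * f x) = c ^ (2 : ℝ) * sqNorm β f := by
  unfold sqNorm
  rw [← lintegral_const_mul _ (measurable_sqNorm_integrand hf)]
  refine lintegral_congr fun x => ?_
  rw [mul_left_comm, ENNReal.mul_rpow_of_nonneg _ _ (by norm_num)]

/-- The norm of the space `X^{1/2,1/2}_{p',2}` on the Fourier side in the modulation variables. -/
def inNorm (p : ℝ) (F : ℤ → ℝ → ℝ≥0∞) : ℝ≥0∞ :=
  (∑' n : ℤ, (jb n ^ (1 / 2 : ℝ) * sqNorm (1 / 2) (F n) ^ (1 / 2 : ℝ)) ^ p) ^ (1 / p)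

/-- The norm of the space `X^{1/2,-1/2}_{p',2}` on the Fourier side in the modulation
variables. -/
def outNorm (p : ℝ) (G : ℤ → ℝ → ℝ≥0∞) : ℝ≥0∞ :=
  (∑' n : ℤ, (jb n ^ (1 / 2 : ℝ) * sqNorm (-(1 / 2)) (G n) ^ (1 / 2 : ℝ)) ^ p) ^ (1 / p)

lemma outNorm_const_mul {p : ℝ} (hp : 0 < p) {c : ℝ≥0∞} {G : ℤ → ℝ → ℝ≥0∞}
    (hG : ∀ n, Measurable (G n)) : outNorm p (fun n x => c * G n x) = c * outNorm p G := by
  have e : c = (c ^ p) ^ (1 / p) := by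
    rw [← ENNReal.rpow_mul, mul_one_div_cancel hp.ne', ENNReal.rpow_one]
  unfold outNorm
  conv_rhs => rw [e]
  rw [← ENNReal.mul_rpow_of_nonneg _ _ (by positivity), ← ENNReal.tsum_mul_left]
  congr 1
  refine tsum_congr fun n => ?_
  have half : (0 : ℝ) ≤ 1 / 2 := by norm_num
  have e2 : (c ^ (2 : ℝ)) ^ (1 / 2 : ℝ) = c := by rw [← ENNReal.rpow_mul]; norm_num
  rw [sqNorm_const_mul (hG n), ← ENNReal.mul_rpow_of_nonneg _ _ hp.le,
    ENNReal.mul_rpow_of_nonneg _ _ half, e2, mul_left_comm]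

/-- An input of finite norm is, up to a factor arbitrarily close to its norm, admissible. -/
lemma exists_admissible {p : ℝ} (hp : 0 < p) {κ : ℝ≥0∞} {F : ℤ → ℝ → ℝ≥0∞}
    (hF : ∀ n, Measurable (F n))
    (hgain : ∀ n, sqNorm (1 / 2 - δ) (F n) ≤ κ ^ (2 : ℝ) * sqNorm (1 / 2) (F n)) {M : ℝ≥0∞}
    (hM : inNorm p F < M) (hMt : M ≠ ∞) :
    ∃ A : ℤ → ℝ≥0∞, ∑' n, A n ^ p ≤ 1 ∧ Admissible δ κ A (fun n x => M⁻¹ * F n x) := by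
  set N : ℤ → ℝ≥0∞ := fun n => jb n ^ (1 / 2 : ℝ) * sqNorm (1 / 2) (F n) ^ (1 / 2 : ℝ) with hN
  set S : ℝ≥0∞ := ∑' n, N n ^ p with hS
  have hM0 : M ≠ 0 := (zero_le.trans_lt hM).ne'
  have hSM : S < M ^ p := by
    have := ENNReal.rpow_lt_rpow hM hp
    rwa [inNorm, ← ENNReal.rpow_mul, one_div_mul_cancel hp.ne', ENNReal.rpow_one] at this
  have hMp : M ^ p ≠ ∞ := ENNReal.rpow_ne_top_of_nonneg hp.le hMt
  -- A positive summable perturbation keeps every coefficient nonzero, so that one can divide by it;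
  -- the gap between norm and M leaves room for it.
  obtain ⟨η, hη, hηs⟩ := ENNReal.exists_pos_sum_of_countable (ε := M ^ p - S)
    (tsub_pos_of_lt hSM).ne' ℤ
  have hB : ∑' n, (N n ^ p + η n) ≤ M ^ p := by
    rw [ENNReal.tsum_add]
    calc S + ∑' n, (η n : ℝ≥0∞) ≤ S + (M ^ p - S) := add_le_add_right hηs.le _
      _ = M ^ p := add_tsub_cancel_of_le hSM.le
  have hBt : ∀ n, N n ^ p + η n ≠ ∞ := fun n =>
    ne_top_of_le_ne_top hMp ((ENNReal.le_tsum n).trans hB)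
  set B : ℤ → ℝ≥0∞ := fun n => (N n ^ p + η n) ^ (1 / p) with hBdef
  have hNB : ∀ n, N n ≤ B n := by
    intro n
    calc N n = (N n ^ p) ^ (1 / p) := by
          rw [← ENNReal.rpow_mul, mul_one_div_cancel hp.ne', ENNReal.rpow_one]
      _ ≤ _ := ENNReal.rpow_le_rpow le_self_add (by positivity)
  have hsq : ∀ n : ℤ, sqNorm (1 / 2) (F n) ≤ (jb n ^ (-(1 / 2) : ℝ) * B n) ^ (2 : ℝ) := by
    intro n
    calc sqNorm (1 / 2) (F n) = (jb n ^ (-(1 / 2) : ℝ) * N n) ^ (2 : ℝ) := by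
          rw [hN]
          simp only
          rw [← mul_assoc, ← jb_rpow_add, ENNReal.mul_rpow_of_nonneg _ _ (by norm_num),
            ← ENNReal.rpow_mul (sqNorm _ _)]
          norm_num
      _ ≤ _ := by gcongr; exact hNB n
  have hnorm : ∀ n : ℤ, sqNorm (1 / 2) (fun x => M⁻¹ * F n x) ≤
      (jb n ^ (-(1 / 2) : ℝ) * (M⁻¹ * B n)) ^ (2 : ℝ) := by
    intro n
    rw [sqNorm_const_mul (hF n), mul_left_comm, ENNReal.mul_rpow_of_nonneg M⁻¹ _ (by norm_num)]
    exact mul_le_mul_right (hsq n) _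
  refine ⟨fun n => M⁻¹ * B n, ?_, fun n => (hF n).const_mul _, fun n => ?_, fun n => ?_, hnorm,
    fun n => ?_⟩
  · calc ∑' n, (M⁻¹ * B n) ^ p = ∑' n, (M ^ p)⁻¹ * (N n ^ p + η n) := by
          refine tsum_congr fun n => ?_
          rw [ENNReal.mul_rpow_of_nonneg _ _ hp.le, ENNReal.inv_rpow, hBdef]
          simp only
          rw [← ENNReal.rpow_mul, one_div_mul_cancel hp.ne', ENNReal.rpow_one]
      _ ≤ (M ^ p)⁻¹ * M ^ p := by
          rw [ENNReal.tsum_mul_left]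
          exact mul_le_mul_right hB _
      _ ≤ 1 := by rw [mul_comm]; exact ENNReal.mul_inv_le_one _
  · refine mul_ne_zero (ENNReal.inv_ne_zero.2 hMt) ?_
    have : (N n ^ p + η n) ≠ 0 := by
      have := (hη n).ne'
      simp [this]
    exact (ENNReal.rpow_pos (pos_iff_ne_zero.2 this) (hBt n)).ne'
  · exact ENNReal.mul_ne_top (ENNReal.inv_ne_top.2 hM0)
      (ENNReal.rpow_ne_top_of_nonneg (by positivity) (hBt n))
  · rw [ENNReal.mul_rpow_of_nonneg κ _ (by norm_num)]
    refine le_trans ?_ (mul_le_mul_right (hnorm n) _)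
    rw [sqNorm_const_mul (hF n), sqNorm_const_mul (hF n), mul_left_comm]
    exact mul_le_mul_right (hgain n) _

/-- The trilinear estimate on the Fourier side. -/
theorem exists_outNorm_majorant_le (X : Exponents q Q r R (1 / (1 / 2 + δ₁)) (1 / 2 - ε) θ')
    (hδ : 0 ≤ δ) (h : δ < δ₁) (h₁ : δ₁ < 1 / 2) (hε : 0 < ε) :
    ∃ C : ℝ≥0∞, C ≠ ∞ ∧ ∀ (κ : ℝ≥0∞) (F₁ F₂ F₃ : ℤ → ℝ → ℝ≥0∞), κ ≠ 0 → κ ≠ ∞ →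
      (∀ n, Measurable (F₁ n)) → (∀ n, Measurable (F₂ n)) → (∀ n, Measurable (F₃ n)) →
      (∀ n, sqNorm (1 / 2 - δ) (F₁ n) ≤ κ ^ (2 : ℝ) * sqNorm (1 / 2) (F₁ n)) →
      (∀ n, sqNorm (1 / 2 - δ) (F₂ n) ≤ κ ^ (2 : ℝ) * sqNorm (1 / 2) (F₂ n)) →
      (∀ n, sqNorm (1 / 2 - δ) (F₃ n) ≤ κ ^ (2 : ℝ) * sqNorm (1 / 2) (F₃ n)) →
      inNorm Q F₁ ≠ ∞ → inNorm Q F₂ ≠ ∞ → inNorm R F₃ ≠ ∞ →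
      outNorm R (majorant F₁ F₂ F₃) ≤ C * κ * inNorm Q F₁ * inNorm Q F₂ * inNorm R F₃ := by
  obtain ⟨C, hC, H⟩ := exists_majorant_le X hδ h h₁ hε
  refine ⟨C, hC, fun κ F₁ F₂ F₃ hκ0 hκ m₁ m₂ m₃ g₁ g₂ g₃ n₁ n₂ n₃ => ?_⟩
  have hR := X.R_pos
  have key : ∀ M₁ M₂ M₃ : ℝ≥0∞, inNorm Q F₁ < M₁ → inNorm Q F₂ < M₂ → inNorm R F₃ < M₃ →
      M₁ ≠ ∞ → M₂ ≠ ∞ → M₃ ≠ ∞ →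
      outNorm R (majorant F₁ F₂ F₃) ≤ C * κ * M₁ * M₂ * M₃ := by
    intro M₁ M₂ M₃ l₁ l₂ l₃ t₁ t₂ t₃
    obtain ⟨A₁, hA₁, D₁⟩ := exists_admissible X.Q_pos m₁ g₁ l₁ t₁
    obtain ⟨A₂, hA₂, D₂⟩ := exists_admissible X.Q_pos m₂ g₂ l₂ t₂
    obtain ⟨A₃, hA₃, D₃⟩ := exists_admissible X.R_pos m₃ g₃ l₃ t₃
    have z₁ := (zero_le.trans_lt l₁).ne'
    have z₂ := (zero_le.trans_lt l₂).ne'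
    have z₃ := (zero_le.trans_lt l₃).ne'
    have hle := H κ A₁ A₂ A₃ _ _ _ hκ0 hκ D₁ D₂ D₃ hA₁ hA₂ hA₃
    have hm := measurable_majorant m₁ m₂ m₃
    have h1 : outNorm R (fun n x => M₁⁻¹ * M₂⁻¹ * M₃⁻¹ * majorant F₁ F₂ F₃ n x) ≤ C * κ := by
      unfold outNorm
      refine (ENNReal.rpow_le_rpow (le_trans (le_of_eq ?_) hle) (by positivity)).trans
        (le_of_eq ?_)
      · refine tsum_congr fun ξ => ?_
        have e : R / 2 = 1 / 2 * R := by ring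
        rw [e, ENNReal.rpow_mul, mul_comm]
        congr 1
        have e2 : jb ξ ^ (1 / 2 : ℝ) = ((jb ξ ^ (1 / 2 : ℝ)) ^ (2 : ℝ)) ^ (1 / 2 : ℝ) := by
          rw [← ENNReal.rpow_mul (jb ξ ^ (1 / 2 : ℝ))]; norm_num
        conv_lhs => rw [e2]
        rw [← ENNReal.mul_rpow_of_nonneg _ _ (by norm_num), sqNorm, mul_comm,
          ← lintegral_const_mul _ (measurable_sqNorm_integrand ((hm ξ).const_mul _))]
        congr 1
        refine lintegral_congr fun x => ?_
        rw [majorant_const_mul (ENNReal.inv_ne_top.2 z₁) (ENNReal.inv_ne_top.2 z₂)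
          (ENNReal.inv_ne_top.2 z₃), ← ENNReal.mul_rpow_of_nonneg _ _ (by norm_num)]
        ring_nf
      · rw [← ENNReal.rpow_mul, mul_one_div_cancel hR.ne', ENNReal.rpow_one]
    rw [outNorm_const_mul hR hm] at h1
    calc outNorm R (majorant F₁ F₂ F₃)
        = (M₁ * M₁⁻¹) * (M₂ * M₂⁻¹) * (M₃ * M₃⁻¹) * outNorm R (majorant F₁ F₂ F₃) := by
          rw [ENNReal.mul_inv_cancel z₁ t₁, ENNReal.mul_inv_cancel z₂ t₂,
            ENNReal.mul_inv_cancel z₃ t₃, one_mul, one_mul, one_mul]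
      _ = M₁ * M₂ * M₃ * (M₁⁻¹ * M₂⁻¹ * M₃⁻¹ * outNorm R (majorant F₁ F₂ F₃)) := by ring
      _ ≤ M₁ * M₂ * M₃ * (C * κ) := mul_le_mul_right h1 _
      _ = _ := by ring
  lift C to ℝ≥0 using hC
  lift κ to ℝ≥0 using hκ
  generalize inNorm Q F₁ = N₁ at *
  generalize inNorm Q F₂ = N₂ at *
  generalize inNorm R F₃ = N₃ at *
  lift N₁ to ℝ≥0 using n₁
  lift N₂ to ℝ≥0 using n₂
  lift N₃ to ℝ≥0 using n₃
  -- The bound holds for all M strictly above the norms; let M decrease to them.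
  have hcont : Filter.Tendsto (fun η : ℝ≥0 => ((C * κ * (N₁ + η) * (N₂ + η) * (N₃ + η) : ℝ≥0) : ℝ≥0∞))
      (nhdsWithin 0 (Set.Ioi 0)) (nhds ((C * κ * (N₁ + 0) * (N₂ + 0) * (N₃ + 0) : ℝ≥0) : ℝ≥0∞)) := by
    have : Continuous fun η : ℝ≥0 =>
        ((C * κ * (N₁ + η) * (N₂ + η) * (N₃ + η) : ℝ≥0) : ℝ≥0∞) := by fun_prop
    exact (this.tendsto 0).mono_left nhdsWithin_le_nhds
  have := ge_of_tendsto (b := outNorm R (majorant F₁ F₂ F₃)) hcont (by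
    filter_upwards [self_mem_nhdsWithin] with η hη
    have hη' : 0 < η := hη
    have := key (N₁ + η : ℝ≥0) (N₂ + η : ℝ≥0) (N₃ + η : ℝ≥0)
      (by exact_mod_cast lt_add_of_pos_right _ hη') (by exact_mod_cast lt_add_of_pos_right _ hη')
      (by exact_mod_cast lt_add_of_pos_right _ hη') ENNReal.coe_ne_top ENNReal.coe_ne_top
      ENNReal.coe_ne_top
    exact_mod_cast this)
  simpa using this

end Estimates

end

/-! ### The Fourier transform on `L¹ ∩ L²` -/

section Fourier

open FourierTransform SchwartzMap

lemma integral_schwartz_smul_fourier {f : ℝ → ℂ} (hf : Integrable f) (φ : 𝓢(ℝ, ℂ)) :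
    ∫ x, φ x • 𝓕 f x = ∫ x, 𝓕 φ x • f x := by
  have := VectorFourier.integral_fourierIntegral_smul_eq_flip (L := innerₗ ℝ) (f := (φ : ℝ → ℂ))
    (g := f) Real.continuous_fourierChar continuous_inner (φ.integrable (μ := volume)) hf
  simp only [flip_innerₗ] at this
  exact this.symm

lemma ae_eq_of_integral_schwartz_smul_eq {f g : ℝ → ℂ} (hf : LocallyIntegrable f)
    (hg : LocallyIntegrable g) (h : ∀ φ : 𝓢(ℝ, ℂ), ∫ x, φ x • f x = ∫ x, φ x • g x) :
    f =ᵐ[volume] g := by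
  refine ae_eq_of_integral_contDiff_smul_eq hf hg fun φ hφ hc => ?_
  have h1 : HasCompactSupport fun x => (φ x : ℂ) := hc.comp_left (g := fun x : ℝ => (x : ℂ)) rfl
  have h2 : ContDiff ℝ (⊤ : ℕ∞) fun x => (φ x : ℂ) := Complex.ofRealCLM.contDiff.comp hφ
  simp only [Complex.real_smul]
  exact h (h1.toSchwartzMap h2)

lemma continuous_fourier_of_integrable {f : ℝ → ℂ} (hf : Integrable f) : Continuous (𝓕 f) :=
  VectorFourier.fourierIntegral_continuous Real.continuous_fourierChar continuous_inner hf

/-- The two definitions of the Fourier transform agree on `L¹ ∩ L²`. -/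
lemma fourier_ae_eq_fourier_toLp {f : ℝ → ℂ} (hf : Integrable f) (hf₂ : MemLp f 2) :
    𝓕 f =ᵐ[volume] (𝓕 (hf₂.toLp f) : Lp ℂ 2 (volume : Measure ℝ)) := by
  refine ae_eq_of_integral_schwartz_smul_eq (continuous_fourier_of_integrable hf).locallyIntegrable
    ((Lp.memLp _).locallyIntegrable one_le_two) fun φ => ?_
  rw [← Lp.toTemperedDistribution_apply, ← Lp.fourier_toTemperedDistribution_eq,
    TemperedDistribution.fourier_apply, Lp.toTemperedDistribution_apply,
    integral_schwartz_smul_fourier hf]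
  refine integral_congr_ae ?_
  filter_upwards [hf₂.coeFn_toLp] with x hx
  rw [hx]

/-- The L² inverse transform of 𝓕 f and f itself have the same integrals against Schwartz functions,
hence agree almost everywhere. -/
lemma memLp_two_of_fourier {f : ℝ → ℂ} (hf : Integrable f) (hf₂ : MemLp (𝓕 f) 2) :
    MemLp f 2 := by
  set W : Lp ℂ 2 (volume : Measure ℝ) := 𝓕⁻ (hf₂.toLp (𝓕 f)) with hW
  have : f =ᵐ[volume] W := by
    refine ae_eq_of_integral_schwartz_smul_eq hf.locallyIntegrable
      ((Lp.memLp W).locallyIntegrable one_le_two) fun φ => ?_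
    rw [← Lp.toTemperedDistribution_apply, hW, ← Lp.fourierInv_toTemperedDistribution_eq,
      TemperedDistribution.fourierInv_apply, Lp.toTemperedDistribution_apply]
    calc ∫ x, φ x • f x = ∫ x, 𝓕 (𝓕⁻ φ) x • f x := by rw [fourier_fourierInv_eq]
      _ = ∫ x, (𝓕⁻ φ) x • 𝓕 f x := (integral_schwartz_smul_fourier hf _).symm
      _ = _ := by
          refine integral_congr_ae ?_
          filter_upwards [hf₂.coeFn_toLp] with x hx
          rw [hx]
  exact (memLp_congr_ae this).2 (Lp.memLp W)

/-- Plancherel's theorem on `L¹ ∩ L²`. -/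
lemma eLpNorm_fourier {f : ℝ → ℂ} (hf : Integrable f) (hf₂ : MemLp f 2) :
    eLpNorm (𝓕 f) 2 volume = eLpNorm f 2 volume := by
  rw [eLpNorm_congr_ae (fourier_ae_eq_fourier_toLp hf hf₂), ← eLpNorm_congr_ae hf₂.coeFn_toLp,
    ← Lp.enorm_def, ← Lp.enorm_def, ← ofReal_norm, ← ofReal_norm, Lp.norm_fourier_eq]

lemma fourier_eq_integral (f : ℝ → ℂ) (τ : ℝ) :
    𝓕 f τ = ∫ t : ℝ, Complex.exp (-(2 * Real.pi * t * τ * Complex.I)) * f t := by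
  rw [Real.fourier_eq']
  refine integral_congr_ae (Filter.Eventually.of_forall fun t => ?_)
  simp only [smul_eq_mul, RCLike.inner_apply, conj_trivial]
  congr 2
  push_cast
  ring

/-- Parseval: the transform of fg at τ is the inner product of f with e^{2πitτ} times the conjugate
of g, and the transform of the latter at s is the conjugate of 𝓕 g (τ - s). -/
lemma enorm_fourier_mul_le {f g : ℝ → ℂ} (hf : Integrable f) (hf₂ : MemLp f 2)
    (hg : Integrable g) (hg₂ : MemLp g 2) (τ : ℝ) :
    ‖𝓕 (fun t => f t * g t) τ‖ₑ ≤ ∫⁻ s, ‖𝓕 f s‖ₑ * ‖𝓕 g (τ - s)‖ₑ := by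
  set e : ℝ → ℂ := fun t => Complex.exp (2 * Real.pi * t * τ * Complex.I) with he
  set G : ℝ → ℂ := fun t => e t * (starRingEnd ℂ) (g t) with hG
  have hec : Continuous e := by rw [he]; fun_prop
  have hen : ∀ t, ‖e t‖ = 1 := fun t => by
    rw [he]
    simp only
    rw [show (2 * Real.pi * t * τ * Complex.I : ℂ) = ((2 * Real.pi * t * τ : ℝ) : ℂ) * Complex.I by
      push_cast; ring]
    exact Complex.norm_exp_ofReal_mul_I _
  have hGn : ∀ t, ‖G t‖ = ‖g t‖ := fun t => by rw [hG]; simp [hen]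
  have hGm : AEStronglyMeasurable G :=
    hec.aestronglyMeasurable.mul (Complex.continuous_conj.comp_aestronglyMeasurable hg.1)
  have hGi : Integrable G := hg.mono hGm (Filter.Eventually.of_forall fun t => (hGn t).le)
  have hG₂ : MemLp G 2 := hg₂.mono hGm (Filter.Eventually.of_forall fun t => (hGn t).le)
  have hGF : ∀ s, 𝓕 G s = (starRingEnd ℂ) (𝓕 g (τ - s)) := by
    intro s
    rw [fourier_eq_integral, fourier_eq_integral, ← integral_conj]
    refine integral_congr_ae (Filter.Eventually.of_forall fun t => ?_)
    simp only [hG, he, map_mul]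
    rw [← mul_assoc, ← Complex.exp_add, ← Complex.exp_conj]
    congr 2
    simp only [map_neg, map_mul, Complex.conj_ofReal, Complex.conj_I, Complex.ofReal_sub, map_ofNat,
      map_sub]
    ring
  have h1 : 𝓕 (fun t => f t * g t) τ = inner ℂ (hG₂.toLp G) (hf₂.toLp f) := by
    rw [L2.inner_def, fourier_eq_integral]
    refine integral_congr_ae ?_
    filter_upwards [hf₂.coeFn_toLp, hG₂.coeFn_toLp] with t h1 h2
    rw [h1, h2, RCLike.inner_apply, hG]
    simp only [map_mul, Complex.conj_conj, he]
    rw [← Complex.exp_conj]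
    simp only [map_mul, Complex.conj_ofReal, Complex.conj_I, map_ofNat, mul_neg]
    ring
  rw [h1, ← Lp.inner_fourier_eq, L2.inner_def]
  refine (enorm_integral_le_lintegral_enorm _).trans (le_of_eq (lintegral_congr_ae ?_))
  filter_upwards [fourier_ae_eq_fourier_toLp hf hf₂, fourier_ae_eq_fourier_toLp hGi hG₂]
    with s h1 h2
  rw [← h1, ← h2, RCLike.inner_apply, enorm_mul, hGF, RCLike.conj_conj]

end Fourier

/-! ### The Fourier transform in time -/

lemma fourierT_eq_fourier (f : ℝ → ℂ) (τ : ℝ) :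
    fourierT f τ = ((Real.sqrt (2 * Real.pi))⁻¹ : ℂ) *
      FourierTransform.fourier f (τ / (2 * Real.pi)) := by
  rw [fourierT, fourier_eq_integral]
  congr 1
  refine integral_congr_ae (Filter.Eventually.of_forall fun t => ?_)
  simp only
  rw [mul_comm]
  congr 2
  have : (Real.pi : ℂ) ≠ 0 := by exact_mod_cast Real.pi_ne_zero
  push_cast
  field_simp

lemma continuous_fourierT {f : ℝ → ℂ} (hf : Integrable f) : Continuous (fourierT f) := by
  have : fourierT f = fun τ => ((Real.sqrt (2 * Real.pi))⁻¹ : ℂ) *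
      FourierTransform.fourier f (τ / (2 * Real.pi)) := funext (fourierT_eq_fourier f)
  rw [this]
  exact continuous_const.mul ((continuous_fourier_of_integrable hf).comp (by fun_prop))

lemma lintegral_comp_mul_right {a : ℝ} (ha : 0 < a) {f : ℝ → ℝ≥0∞} (hf : Measurable f) :
    ∫⁻ x, f (x * a) = ENNReal.ofReal a⁻¹ * ∫⁻ x, f x := by
  have h := lintegral_map hf (measurable_id.mul_const a) (μ := volume)
  have e := Real.map_volume_mul_right ha.ne'
  simp only [id] at h
  rw [e, lintegral_smul_measure, abs_of_pos (inv_pos.2 ha)] at h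
  exact h.symm

lemma lintegral_comp_div_two_pi {f : ℝ → ℝ≥0∞} (hf : Measurable f) :
    ∫⁻ x, f (x / (2 * Real.pi)) = ENNReal.ofReal (2 * Real.pi) * ∫⁻ x, f x := by
  have := lintegral_comp_mul_right (a := (2 * Real.pi)⁻¹) (by positivity) hf
  rw [inv_inv] at this
  simpa [div_eq_mul_inv] using this

/-- The size of the normalising constant of the Fourier transform. -/
lemma enorm_fourier_const :
    ‖((Real.sqrt (2 * Real.pi))⁻¹ : ℂ)‖ₑ = ENNReal.ofReal ((Real.sqrt (2 * Real.pi))⁻¹) := by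
  rw [← Complex.ofReal_inv, ← ofReal_norm, Complex.norm_real, Real.norm_of_nonneg (by positivity)]

/-- The constant is the one making `fourierT` unitary: it compensates the rescaling by 2π. -/
lemma fourier_const_sq : ENNReal.ofReal ((Real.sqrt (2 * Real.pi))⁻¹) ^ (2 : ℝ) *
    ENNReal.ofReal (2 * Real.pi) = 1 := by
  rw [ENNReal.ofReal_rpow_of_nonneg (by positivity) (by norm_num),
    ← ENNReal.ofReal_mul (by positivity), Real.rpow_two, inv_pow,
    Real.sq_sqrt (by positivity), inv_mul_cancel₀ (by positivity), ENNReal.ofReal_one]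

lemma fourier_const_le_one : ENNReal.ofReal ((Real.sqrt (2 * Real.pi))⁻¹) ≤ 1 := by
  rw [ENNReal.ofReal_le_one]
  refine inv_le_one_of_one_le₀ ?_
  rw [Real.one_le_sqrt]
  linarith [Real.pi_gt_three]

lemma lintegral_enorm_sq_eq (f : ℝ → ℂ) :
    ∫⁻ x, ‖f x‖ₑ ^ (2 : ℝ) = eLpNorm f 2 volume ^ (2 : ℝ) := by
  rw [eLpNorm_eq_lintegral_rpow_enorm_toReal (by norm_num) (by norm_num), ← ENNReal.rpow_mul]
  norm_num

lemma memLp_two_iff {f : ℝ → ℂ} :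
    MemLp f 2 ↔ AEStronglyMeasurable f volume ∧ ∫⁻ x, ‖f x‖ₑ ^ (2 : ℝ) < ∞ := by
  rw [lintegral_enorm_sq_eq, MemLp]
  refine and_congr_right fun _ => ⟨fun h => ENNReal.rpow_lt_top_of_nonneg (by norm_num) h.ne,
    fun h => ?_⟩
  by_contra hc
  rw [not_lt, top_le_iff] at hc
  rw [hc] at h
  simp at h

lemma lintegral_fourierT_sq_eq (f : ℝ → ℂ) (hf : Integrable f) :
    ∫⁻ τ, ‖fourierT f τ‖ₑ ^ (2 : ℝ) =
      ∫⁻ τ, ‖FourierTransform.fourier f τ‖ₑ ^ (2 : ℝ) := by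
  have hm : Measurable fun τ => ‖FourierTransform.fourier f τ‖ₑ ^ (2 : ℝ) :=
    (continuous_fourier_of_integrable hf).measurable.enorm.pow_const _
  calc _ = ∫⁻ τ, ENNReal.ofReal ((Real.sqrt (2 * Real.pi))⁻¹) ^ (2 : ℝ) *
        ‖FourierTransform.fourier f (τ / (2 * Real.pi))‖ₑ ^ (2 : ℝ) := by
        refine lintegral_congr fun τ => ?_
        rw [fourierT_eq_fourier, enorm_mul, enorm_fourier_const,
          ENNReal.mul_rpow_of_nonneg _ _ (by norm_num)]
    _ = _ := by
        rw [lintegral_const_mul' _ _ (by finiteness), lintegral_comp_div_two_pi hm, ← mul_assoc,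
          fourier_const_sq, one_mul]

/-- Plancherel's theorem for the Fourier transform in time. -/
lemma lintegral_fourierT_sq {f : ℝ → ℂ} (hf : Integrable f) (hf₂ : MemLp f 2) :
    ∫⁻ τ, ‖fourierT f τ‖ₑ ^ (2 : ℝ) = ∫⁻ t, ‖f t‖ₑ ^ (2 : ℝ) := by
  rw [lintegral_fourierT_sq_eq f hf, lintegral_enorm_sq_eq, lintegral_enorm_sq_eq,
    eLpNorm_fourier hf hf₂]

lemma memLp_two_of_fourierT {f : ℝ → ℂ} (hf : Integrable f)
    (h : ∫⁻ τ, ‖fourierT f τ‖ₑ ^ (2 : ℝ) < ∞) : MemLp f 2 := by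
  rw [lintegral_fourierT_sq_eq f hf] at h
  exact memLp_two_of_fourier hf (memLp_two_iff.2
    ⟨(continuous_fourier_of_integrable hf).aestronglyMeasurable, h⟩)

lemma enorm_fourierT_mul_le {f g : ℝ → ℂ} (hf : Integrable f) (hf₂ : MemLp f 2)
    (hg : Integrable g) (hg₂ : MemLp g 2) (τ : ℝ) :
    ‖fourierT (fun t => f t * g t) τ‖ₑ ≤ ∫⁻ s, ‖fourierT f s‖ₑ * ‖fourierT g (τ - s)‖ₑ := by
  set c := ENNReal.ofReal ((Real.sqrt (2 * Real.pi))⁻¹) with hc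
  have hct : c ≠ ∞ := by rw [hc]; finiteness
  set Φ : ℝ → ℝ≥0∞ := fun s => ‖FourierTransform.fourier f s‖ₑ *
    ‖FourierTransform.fourier g (τ / (2 * Real.pi) - s)‖ₑ with hΦ
  have hΦm : Measurable Φ := (continuous_fourier_of_integrable hf).measurable.enorm.mul
    ((continuous_fourier_of_integrable hg).measurable.enorm.comp
      (measurable_const.sub measurable_id))
  calc _ = c * ‖FourierTransform.fourier (fun t => f t * g t) (τ / (2 * Real.pi))‖ₑ := by
        rw [fourierT_eq_fourier, enorm_mul, enorm_fourier_const]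
    _ ≤ c * ∫⁻ s, Φ s := by
        gcongr
        exact enorm_fourier_mul_le hf hf₂ hg hg₂ _
    -- The true convolution identity has a further factor (2π)^{-1/2}, which is given away here.
    _ ≤ 1 * ∫⁻ s, Φ s := by gcongr; exact fourier_const_le_one
    _ = c ^ (2 : ℝ) * ∫⁻ s, Φ (s / (2 * Real.pi)) := by
        rw [lintegral_comp_div_two_pi hΦm, ← mul_assoc, fourier_const_sq]
    _ = _ := by
        rw [← lintegral_const_mul' _ _ (by finiteness)]
        refine lintegral_congr fun s => ?_
        rw [fourierT_eq_fourier, fourierT_eq_fourier, enorm_mul, enorm_mul, enorm_fourier_const,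
          hΦ, ← hc, ENNReal.rpow_two, sub_div]
        ring

lemma fourierT_conj (f : ℝ → ℂ) (τ : ℝ) :
    fourierT (fun t => (starRingEnd ℂ) (f t)) τ = (starRingEnd ℂ) (fourierT f (-τ)) := by
  rw [fourierT, fourierT, map_mul, ← integral_conj, map_inv₀, Complex.conj_ofReal]
  congr 1
  refine integral_congr_ae (Filter.Eventually.of_forall fun t => ?_)
  simp only [map_mul]
  rw [← Complex.exp_conj]
  congr 2
  simp

lemma lintegral_conv_eq_triConv {a₁ a₂ a₃ : ℝ → ℝ≥0∞} (h₁ : Measurable a₁) (h₂ : Measurable a₂)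
    (h₃ : Measurable a₃) (M : ℝ) :
    ∫⁻ s, (∫⁻ y, a₁ y * a₂ (s - y)) * a₃ (M - s) = triConv a₁ a₂ a₃ M := by
  calc _ = ∫⁻ s, ∫⁻ y, a₁ y * a₂ (s - y) * a₃ (M - s) := by
        refine lintegral_congr fun s => ?_
        rw [lintegral_mul_const (f := fun y => a₁ y * a₂ (s - y)) _
          (h₁.mul (h₂.comp (measurable_const.sub measurable_id)))]
    _ = ∫⁻ y, ∫⁻ s, a₁ y * a₂ (s - y) * a₃ (M - s) := by
        refine lintegral_lintegral_swap (Measurable.aemeasurable ?_)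
        fun_prop
    _ = _ := by
        refine lintegral_congr fun y => ?_
        rw [← lintegral_add_right_eq_self _ y, ← lintegral_const_mul]
        · refine lintegral_congr fun z => ?_
          rw [add_sub_cancel_right, sub_sub, add_comm y z, mul_assoc]
        · fun_prop

/-- Two applications of the bound for products. The second requires fg to be in L², which is not
automatic for f and g in L². -/
lemma enorm_fourierT_mul_mul_le {f g h : ℝ → ℂ} (hf : Integrable f) (hf₂ : MemLp f 2)
    (hg : Integrable g) (hg₂ : MemLp g 2) (hh : Integrable h) (hh₂ : MemLp h 2)
    (hfg : MemLp (fun t => f t * g t) 2) (τ : ℝ) :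
    ‖fourierT (fun t => f t * g t * h t) τ‖ₑ ≤
      triConv (fun s => ‖fourierT f s‖ₑ) (fun s => ‖fourierT g s‖ₑ) (fun s => ‖fourierT h s‖ₑ) τ := by
  refine (enorm_fourierT_mul_le (hf₂.integrable_mul hg₂) hfg hh hh₂ τ).trans ?_
  rw [← lintegral_conv_eq_triConv (continuous_fourierT hf).measurable.enorm
    (continuous_fourierT hg).measurable.enorm (continuous_fourierT hh).measurable.enorm]
  exact lintegral_mono fun s => mul_le_mul_left (enorm_fourierT_mul_le hf hf₂ hg hg₂ s) _

/-- The change of variables between the time frequencies and the reflected modulations; the shifts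
add up to the resonance function. -/
lemma triConv_reflect (a₁ a₂ a₃ : ℝ → ℝ≥0∞) (α β γ M : ℝ) :
    triConv (fun x => a₁ (-α - x)) (fun x => a₂ (-β - x)) (fun x => a₃ (γ - x)) M =
      triConv a₁ a₂ a₃ (-M - α - β + γ) := by
  unfold triConv
  rw [← lintegral_sub_left_eq_self _ (-α)]
  refine lintegral_congr fun y => ?_
  rw [← lintegral_sub_left_eq_self _ (-β)]
  simp only [sub_sub_cancel]
  congr 1
  refine lintegral_congr fun z => ?_
  ring_nf

/-- The product of two functions in `H^{1/2}` is square integrable. -/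
lemma memLp_two_mul {f g : ℝ → ℂ} (hf : Integrable f) (hf₂ : MemLp f 2)
    (hg : Integrable g) (hg₂ : MemLp g 2) {α β : ℝ}
    (hfα : sqNorm (1 / 2) (fun x => ‖fourierT f (-α - x)‖ₑ) ≠ ∞)
    (hgβ : sqNorm (1 / 2) (fun x => ‖fourierT g (-β - x)‖ₑ) ≠ ∞) :
    MemLp (fun t => f t * g t) 2 := by
  have key : ∀ {f : ℝ → ℂ} {α : ℝ}, sqNorm (1 / 2) (fun x => ‖fourierT f (-α - x)‖ₑ) =
      ∫⁻ s, (jb (-α - s) ^ (1 / 2 : ℝ) * ‖fourierT f s‖ₑ) ^ (2 : ℝ) := by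
    intro f α
    rw [← lintegral_sub_left_eq_self _ (-α), sqNorm]
    refine lintegral_congr fun x => by simp only [sub_sub_cancel]
  have hJm : ∀ α : ℝ, Measurable fun s : ℝ => jb (-α - s) := fun α =>
    measurable_jb.comp (measurable_const.sub measurable_id)
  have hJ : ∀ α : ℝ, ∫⁻ s, jb (-α - s) ^ (-2 : ℝ) = ∫⁻ s, jb s ^ (-2 : ℝ) := fun α =>
    lintegral_sub_left_eq_self (fun s => jb s ^ (-2 : ℝ)) (-α)
  have hK : ∫⁻ s, jb s ^ (-2 : ℝ) < ∞ := lintegral_jb_rpow_lt_top one_lt_two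
  set K := ∫⁻ s, jb s ^ (-2 : ℝ)
  rw [key] at hfα hgβ
  set A : ℝ → ℝ≥0∞ := fun s => (jb (-α - s) ^ (1 / 2 : ℝ) * ‖fourierT f s‖ₑ) ^ (2 : ℝ) with hA
  set B : ℝ → ℝ≥0∞ := fun s => (jb (-β - s) ^ (1 / 2 : ℝ) * ‖fourierT g s‖ₑ) ^ (2 : ℝ) with hB
  have hAm : Measurable A :=
    (((hJm α).pow_const _).mul (continuous_fourierT hf).measurable.enorm).pow_const _
  have hBm : Measurable B :=
    (((hJm β).pow_const _).mul (continuous_fourierT hg).measurable.enorm).pow_const _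
  -- Cauchy–Schwarz against the weights: the product of two shifted ⟨·⟩^{-1} is integrable uniformly
  -- in τ, and the convolution of the integrable functions A and B is integrable.
  have hpt : ∀ τ, ‖fourierT (fun t => f t * g t) τ‖ₑ ^ (2 : ℝ) ≤
      (K + K) * ∫⁻ s, A s * B (τ - s) := by
    intro τ
    have hm : Measurable fun s : ℝ => τ - s := measurable_const.sub measurable_id
    have h1 : ∫⁻ s, ‖fourierT f s‖ₑ * ‖fourierT g (τ - s)‖ₑ ≤
        (K + K) ^ (1 / 2 : ℝ) * (∫⁻ s, A s * B (τ - s)) ^ (1 / 2 : ℝ) := by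
      have e : ∀ (x : ℝ) (y : ℝ≥0∞), y = (jb x ^ (-1 : ℝ)) ^ (1 / 2 : ℝ) *
          ((jb x ^ (1 / 2 : ℝ) * y) ^ (2 : ℝ)) ^ (1 / 2 : ℝ) := by
        intro x y
        rw [← ENNReal.rpow_mul, ← ENNReal.rpow_mul, mul_one_div_cancel two_ne_zero,
          ENNReal.rpow_one, ← mul_assoc, ← jb_rpow_add]
        norm_num
      calc _ = ∫⁻ s, (jb (-α - s) ^ (-1 : ℝ) * jb (-β - (τ - s)) ^ (-1 : ℝ)) ^ (1 / 2 : ℝ) *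
            (A s * B (τ - s)) ^ (1 / 2 : ℝ) := by
            refine lintegral_congr fun s => ?_
            rw [ENNReal.mul_rpow_of_nonneg _ _ (by norm_num),
              ENNReal.mul_rpow_of_nonneg (A s) _ (by norm_num)]
            conv_lhs => rw [e (-α - s) ‖fourierT f s‖ₑ, e (-β - (τ - s)) ‖fourierT g (τ - s)‖ₑ]
            ring
        _ ≤ (∫⁻ s, jb (-α - s) ^ (-1 : ℝ) * jb (-β - (τ - s)) ^ (-1 : ℝ)) ^ (1 / 2 : ℝ) *
            (∫⁻ s, A s * B (τ - s)) ^ (1 / 2 : ℝ) :=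
            ENNReal.lintegral_mul_norm_pow_le
              (((hJm α).pow_const _).mul (((hJm β).comp hm).pow_const _)).aemeasurable
              (hAm.mul (hBm.comp hm)).aemeasurable (by norm_num) (by norm_num) (by norm_num)
        _ ≤ _ := by
            gcongr
            calc _ ≤ ∫⁻ s, (jb (-α - s) ^ (-2 : ℝ) + jb (-β - (τ - s)) ^ (-2 : ℝ)) := by
                  refine lintegral_mono fun s => ?_
                  have amgm : ∀ x y : ℝ≥0∞, x * y ≤ x * x + y * y := by
                    intro x y
                    rcases le_total x y with h | h
                    · exact (mul_le_mul_left h _).trans le_add_self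
                    · exact (mul_le_mul_right h _).trans le_self_add
                  refine (amgm _ _).trans (le_of_eq ?_)
                  rw [← jb_rpow_add, ← jb_rpow_add]
                  norm_num
              _ = K + K := by
                  rw [lintegral_add_left ((hJm α).pow_const _), hJ,
                    lintegral_sub_left_eq_self (fun s => jb (-β - s) ^ (-2 : ℝ)) τ, hJ]
    calc _ ≤ ((K + K) ^ (1 / 2 : ℝ) * (∫⁻ s, A s * B (τ - s)) ^ (1 / 2 : ℝ)) ^ (2 : ℝ) := by
          gcongr
          exact (enorm_fourierT_mul_le hf hf₂ hg hg₂ τ).trans h1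
      _ = _ := by
          rw [ENNReal.mul_rpow_of_nonneg _ _ (by norm_num), ← ENNReal.rpow_mul, ← ENNReal.rpow_mul]
          norm_num
  refine memLp_two_of_fourierT (hf₂.integrable_mul hg₂) ?_
  calc _ ≤ ∫⁻ τ, (K + K) * ∫⁻ s, A s * B (τ - s) := lintegral_mono hpt
    _ = (K + K) * ((∫⁻ s, A s) * ∫⁻ s, B s) := by
        rw [lintegral_const_mul _ (measurable_conv hAm hBm)]
        congr 1
        rw [lintegral_lintegral_swap (by fun_prop), ← lintegral_mul_const _ hAm]
        refine lintegral_congr fun s => ?_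
        rw [lintegral_const_mul (f := fun τ => B (τ - s)) _ (by fun_prop),
          lintegral_sub_right_eq_self B s]
    _ < ∞ := by
        have := hK.ne
        exact (by finiteness : _ ≠ ∞).lt_top

/-- Functions supported in a short time interval gain from lowering the weight. -/
lemma sqNorm_gain {δ T : ℝ} (hδ : 0 ≤ δ) (hδ' : δ ≤ 1 / 2) (hT : 0 < T) {h : ℝ → ℝ≥0∞}
    (hm : Measurable h) (hfin : ∫⁻ x, h x ^ (2 : ℝ) ≠ ∞)
    (hle : ∀ x, h x ^ (2 : ℝ) ≤ ENNReal.ofReal (T / Real.pi) * ∫⁻ x, h x ^ (2 : ℝ)) :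
    sqNorm (1 / 2 - δ) h ≤ (4 * ENNReal.ofReal (T ^ δ)) ^ (2 : ℝ) * sqNorm (1 / 2) h := by
  -- With this radius the pointwise bound `hle` gives the interval [-a, a] at most (T/π)·2a = 1/2 of
  -- the mass. The inner part is then bounded by the outer part, where ⟨x⟩ ≥ ⟨a⟩, and ⟨a⟩^{-1} ≤ 2T.
  set a : ℝ := Real.pi / (4 * T) with ha
  have ha0 : 0 < a := by positivity
  set S : Set ℝ := Set.Icc (-a) a with hS
  have hSm : MeasurableSet S := measurableSet_Icc
  set I := ∫⁻ x, h x ^ (2 : ℝ) with hI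
  set s := ∫⁻ x in S, h x ^ (2 : ℝ) with hs
  set b := ∫⁻ x in Sᶜ, h x ^ (2 : ℝ) with hb
  have hsum : s + b = I := lintegral_add_compl _ hSm
  have hst : s ≠ ∞ := ne_top_of_le_ne_top hfin (hsum ▸ le_self_add)
  have hs1 : 2 * s ≤ I := by
    have h1 : s ≤ ENNReal.ofReal (1 / 2) * I := by
      calc s ≤ ∫⁻ x in S, ENNReal.ofReal (T / Real.pi) * I := lintegral_mono fun x => hle x
        _ = ENNReal.ofReal (T / Real.pi * (a - -a)) * I := by
            rw [setLIntegral_const, hS, Real.volume_Icc, mul_right_comm,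
              ENNReal.ofReal_mul (by positivity)]
        _ = _ := by
            congr 2
            rw [ha]
            field_simp
            norm_num
    calc 2 * s ≤ 2 * (ENNReal.ofReal (1 / 2) * I) := by gcongr
      _ = I := by
          rw [← mul_assoc, ← ENNReal.ofReal_ofNat, ← ENNReal.ofReal_mul (by norm_num)]
          norm_num
  have hsb : s ≤ b := by
    rw [← hsum, two_mul] at hs1
    exact (ENNReal.add_le_add_iff_left hst).1 hs1
  have hin : ∀ x ∈ S, jb x ≤ jb a := fun x hx => jb_le_jb (by
    rw [abs_of_pos ha0, abs_le]; exact hx)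
  have hout : ∀ x ∈ Sᶜ, jb a ≤ jb x := fun x hx => jb_le_jb (by
    rw [abs_of_pos ha0]
    by_contra hc
    exact hx (abs_le.1 (not_le.1 hc).le))
  have e0 : ∀ (x β : ℝ) (y : ℝ≥0∞), (jb x ^ β * y) ^ (2 : ℝ) = jb x ^ (2 * β) * y ^ (2 : ℝ) := by
    intro x β y
    rw [ENNReal.mul_rpow_of_nonneg _ _ (by norm_num), ← ENNReal.rpow_mul, mul_comm β]
  set b₁ := ∫⁻ x in Sᶜ, (jb x ^ (1 / 2 : ℝ) * h x) ^ (2 : ℝ) with hb₁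
  have hbb : jb a ^ (1 - 2 * δ) * b ≤ jb a ^ (-(2 * δ)) * b₁ := by
    rw [sub_eq_add_neg, add_comm, jb_rpow_add, mul_assoc]
    refine mul_le_mul_right ?_ _
    rw [hb, ← lintegral_const_mul _ (hm.pow_const _)]
    refine setLIntegral_mono (measurable_sqNorm_integrand hm) fun x hx => ?_
    rw [e0, mul_one_div_cancel two_ne_zero, ENNReal.rpow_one, ENNReal.rpow_one]
    exact mul_le_mul_left (hout x hx) _
  have p1 : ∫⁻ x in S, (jb x ^ (1 / 2 - δ) * h x) ^ (2 : ℝ) ≤ jb a ^ (-(2 * δ)) * b₁ := by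
    calc _ ≤ ∫⁻ x in S, jb a ^ (1 - 2 * δ) * h x ^ (2 : ℝ) := by
          refine setLIntegral_mono ((hm.pow_const _).const_mul _) fun x hx => ?_
          rw [e0, show 2 * (1 / 2 - δ) = 1 - 2 * δ by ring]
          exact mul_le_mul_left (ENNReal.rpow_le_rpow (hin x hx) (by linarith)) _
      _ = jb a ^ (1 - 2 * δ) * s := lintegral_const_mul _ (hm.pow_const _)
      _ ≤ jb a ^ (1 - 2 * δ) * b := by gcongr
      _ ≤ _ := hbb
  have p2 : ∫⁻ x in Sᶜ, (jb x ^ (1 / 2 - δ) * h x) ^ (2 : ℝ) ≤ jb a ^ (-(2 * δ)) * b₁ := by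
    rw [hb₁, ← lintegral_const_mul _ (measurable_sqNorm_integrand hm)]
    refine setLIntegral_mono ((measurable_sqNorm_integrand hm).const_mul _) fun x hx => ?_
    rw [e0, e0, ← mul_assoc, show 2 * (1 / 2 - δ) = -(2 * δ) + 2 * (1 / 2) by ring, jb_rpow_add]
    exact mul_le_mul_left (mul_le_mul_left
      (rpow_neg_le_rpow_neg (hout x hx) (by positivity)) _) _
  have hja : 2 * jb a ^ (-(2 * δ)) ≤ (4 * ENNReal.ofReal (T ^ δ)) ^ (2 : ℝ) := by
    have h2 : (2 * T)⁻¹ ≤ bracket a := by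
      refine le_trans ?_ ((le_abs_self a).trans (abs_le_bracket a))
      rw [ha, inv_eq_one_div, div_le_div_iff₀ (by positivity) (by positivity)]
      nlinarith [Real.pi_gt_three]
    rw [jb_rpow, ← ENNReal.ofReal_ofNat, ← ENNReal.ofReal_ofNat (4),
      ← ENNReal.ofReal_mul (by norm_num), ← ENNReal.ofReal_mul (by norm_num),
      ENNReal.ofReal_rpow_of_nonneg (by positivity) (by norm_num)]
    refine ENNReal.ofReal_le_ofReal ?_
    have h3 : bracket a ^ (-(2 * δ)) ≤ (2 * T) ^ (2 * δ) := by
      rw [Real.rpow_neg (bracket_pos a).le, ← Real.inv_rpow (bracket_pos a).le]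
      refine Real.rpow_le_rpow (inv_nonneg.2 (bracket_pos a).le) ?_ (by positivity)
      rw [inv_le_comm₀ (bracket_pos a) (by positivity)]
      exact h2
    have h4 : (2 * T) ^ (2 * δ) = (2 : ℝ) ^ (2 * δ) * (T ^ δ) ^ 2 := by
      rw [Real.mul_rpow (by norm_num) hT.le, ← Real.rpow_natCast, ← Real.rpow_mul hT.le]
      congr 2
      push_cast
      ring
    have h5 : (2 : ℝ) ^ (2 * δ) ≤ 2 := by
      calc (2 : ℝ) ^ (2 * δ) ≤ 2 ^ (1 : ℝ) :=
            Real.rpow_le_rpow_of_exponent_le (by norm_num) (by linarith)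
        _ = 2 := Real.rpow_one 2
    rw [Real.rpow_two, mul_pow]
    have h6 : 0 ≤ (T ^ δ) ^ 2 := by positivity
    nlinarith
  calc sqNorm (1 / 2 - δ) h = (∫⁻ x in S, (jb x ^ (1 / 2 - δ) * h x) ^ (2 : ℝ)) +
        ∫⁻ x in Sᶜ, (jb x ^ (1 / 2 - δ) * h x) ^ (2 : ℝ) := (lintegral_add_compl _ hSm).symm
    _ ≤ jb a ^ (-(2 * δ)) * b₁ + jb a ^ (-(2 * δ)) * b₁ := add_le_add p1 p2
    _ = 2 * jb a ^ (-(2 * δ)) * b₁ := by ring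
    _ ≤ _ := mul_le_mul' hja (setLIntegral_le_lintegral _ _)

/-- Cauchy–Schwarz on a time interval of length 2T, followed by Plancherel; the constant is 2T/(2π).
-/
lemma enorm_fourierT_sq_le {f : ℝ → ℂ} {T : ℝ} (hT : 0 < T) (hf : Integrable f)
    (hf₂ : MemLp f 2) (hs : ∀ᵐ t, T < |t| → f t = 0) (τ : ℝ) :
    ‖fourierT f τ‖ₑ ^ (2 : ℝ) ≤
      ENNReal.ofReal (T / Real.pi) * ∫⁻ τ, ‖fourierT f τ‖ₑ ^ (2 : ℝ) := by
  rw [lintegral_fourierT_sq hf hf₂]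
  set c := ENNReal.ofReal ((Real.sqrt (2 * Real.pi))⁻¹) with hc
  have hfm : AEMeasurable (fun t => ‖f t‖ₑ) := hf.1.enorm
  set S : Set ℝ := Set.Icc (-T) T with hS
  have hSm : MeasurableSet S := measurableSet_Icc
  have h1 : ∫⁻ t, ‖f t‖ₑ ≤ ENNReal.ofReal (2 * T) ^ (1 / 2 : ℝ) *
      (∫⁻ t, ‖f t‖ₑ ^ (2 : ℝ)) ^ (1 / 2 : ℝ) := by
    calc ∫⁻ t, ‖f t‖ₑ = ∫⁻ t, (S.indicator (fun _ => (1 : ℝ≥0∞)) t) ^ (1 / 2 : ℝ) *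
          (‖f t‖ₑ ^ (2 : ℝ)) ^ (1 / 2 : ℝ) := by
          refine lintegral_congr_ae ?_
          filter_upwards [hs] with t ht
          rw [← ENNReal.rpow_mul, mul_one_div_cancel two_ne_zero, ENNReal.rpow_one]
          by_cases h : t ∈ S
          · simp [Set.indicator_of_mem h]
          · rw [Set.indicator_of_notMem h, ht (by
              by_contra hc
              exact h (abs_le.1 (not_lt.1 hc)))]
            simp
      _ ≤ (∫⁻ t, S.indicator (fun _ => (1 : ℝ≥0∞)) t) ^ (1 / 2 : ℝ) *
          (∫⁻ t, ‖f t‖ₑ ^ (2 : ℝ)) ^ (1 / 2 : ℝ) :=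
          ENNReal.lintegral_mul_norm_pow_le (measurable_const.indicator hSm).aemeasurable
            (hfm.pow_const _) (by norm_num) (by norm_num) (by norm_num)
      _ = _ := by
          rw [lintegral_indicator hSm, setLIntegral_const, hS, Real.volume_Icc, one_mul]
          ring_nf
  have h2 : ‖fourierT f τ‖ₑ ≤ c * ∫⁻ t, ‖f t‖ₑ := by
    rw [fourierT, enorm_mul, enorm_fourier_const]
    refine mul_le_mul_right ((enorm_integral_le_lintegral_enorm _).trans (le_of_eq ?_)) _
    refine lintegral_congr fun t => ?_
    rw [enorm_mul]
    have : ‖Complex.exp (-(Complex.I * t * τ))‖ₑ = 1 := by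
      rw [← ofReal_norm, show -(Complex.I * t * τ) = ((-(t * τ) : ℝ) : ℂ) * Complex.I by
        push_cast; ring, Complex.norm_exp_ofReal_mul_I, ENNReal.ofReal_one]
    rw [this, mul_one]
  calc _ ≤ (c * (ENNReal.ofReal (2 * T) ^ (1 / 2 : ℝ) *
        (∫⁻ t, ‖f t‖ₑ ^ (2 : ℝ)) ^ (1 / 2 : ℝ))) ^ (2 : ℝ) := by
        gcongr
        exact h2.trans (mul_le_mul_right h1 _)
    _ = c ^ (2 : ℝ) * ENNReal.ofReal (2 * T) * ∫⁻ t, ‖f t‖ₑ ^ (2 : ℝ) := by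
        rw [ENNReal.mul_rpow_of_nonneg _ _ (by norm_num),
          ENNReal.mul_rpow_of_nonneg _ _ (by norm_num), ← ENNReal.rpow_mul, ← ENNReal.rpow_mul,
          one_div_mul_cancel two_ne_zero, ENNReal.rpow_one, ENNReal.rpow_one, mul_assoc]
    _ = _ := by
        congr 1
        have : ENNReal.ofReal (2 * T) = ENNReal.ofReal (2 * Real.pi) * ENNReal.ofReal (T / Real.pi) := by
          rw [← ENNReal.ofReal_mul (by positivity)]
          congr 1
          field_simp
        rw [this, ← mul_assoc, fourier_const_sq, one_mul]

/-! ### The Fourier coefficients in space -/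

/-- The complex conjugate of a function on `ℝ × 𝕋`. -/
def conjFn (u : ℝ × ℝ → ℂ) (z : ℝ × ℝ) : ℂ := (starRingEnd ℂ) (u z)

lemma fourierX_conjFn (u : ℝ × ℝ → ℂ) (t : ℝ) (n : ℤ) :
    fourierX (conjFn u) t n = (starRingEnd ℂ) (fourierX u t (-n)) := by
  have h : (0 : ℝ) ≤ 2 * Real.pi := by positivity
  rw [fourierX, fourierX, map_mul, intervalIntegral.integral_of_le h,
    intervalIntegral.integral_of_le h, ← integral_conj, map_inv₀, Complex.conj_ofReal]
  congr 1
  refine integral_congr_ae (Filter.Eventually.of_forall fun x => ?_)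
  simp only [map_mul, conjFn]
  rw [← Complex.exp_conj]
  congr 2
  simp

lemma volume_restrict_strip : (volume : Measure (ℝ × ℝ)).restrict
    (Set.univ ×ˢ Set.Ioc (0 : ℝ) (2 * Real.pi)) =
      (volume : Measure ℝ).prod (volume.restrict (Set.Ioc (0 : ℝ) (2 * Real.pi))) := by
  rw [Measure.volume_eq_prod, ← Measure.prod_restrict, Measure.restrict_univ]

lemma MemL2.conjFn {u : ℝ × ℝ → ℂ} (hu : MemL2 u) : MemL2 (conjFn u) :=
  ⟨fun t x => congrArg (starRingEnd ℂ) (hu.1 t x),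
    hu.2.mono (Complex.continuous_conj.comp_aestronglyMeasurable hu.2.1)
      (Filter.Eventually.of_forall fun z => by simp [DNLS.conjFn])⟩

lemma TimeSupported.conjFn {T : ℝ} {u : ℝ × ℝ → ℂ} (hu : TimeSupported T u) :
    TimeSupported T (conjFn u) := by
  filter_upwards [hu] with z hz h
  simp [DNLS.conjFn, hz h]

/-- Cauchy–Schwarz in x over one period for almost every t, then Tonelli. -/
lemma memLp_fourierX {u : ℝ × ℝ → ℂ} (hu : MemL2 u) (n : ℤ) :
    MemLp (fun t => fourierX u t n) 2 := by
  have h2π : (0 : ℝ) ≤ 2 * Real.pi := by positivity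
  set μ := (volume : Measure ℝ).restrict (Set.Ioc (0 : ℝ) (2 * Real.pi)) with hμ
  have hu2 : MemLp u 2 (volume.prod μ) := volume_restrict_strip ▸ hu.2
  have hex : ∀ x : ℝ, ‖Complex.exp (-(Complex.I * x * n))‖ₑ = 1 := fun x => by
    rw [← ofReal_norm, show -(Complex.I * x * n) = ((-(x * n) : ℝ) : ℂ) * Complex.I by
      push_cast; ring, Complex.norm_exp_ofReal_mul_I, ENNReal.ofReal_one]
  have hF : AEStronglyMeasurable (fun z : ℝ × ℝ => u z * Complex.exp (-(Complex.I * z.2 * n)))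
      (volume.prod μ) := by
    refine hu2.1.mul (Continuous.aestronglyMeasurable ?_)
    fun_prop
  have heq : (fun t => fourierX u t n) = fun t => ((Real.sqrt (2 * Real.pi))⁻¹ : ℂ) *
      ∫ x, u (t, x) * Complex.exp (-(Complex.I * x * n)) ∂μ := by
    funext t
    rw [fourierX, intervalIntegral.integral_of_le h2π]
  rw [heq, memLp_two_iff]
  refine ⟨hF.integral_prod_right'.const_mul _, ?_⟩
  have hμu : μ Set.univ = ENNReal.ofReal (2 * Real.pi) := by simp [hμ]
  calc _ ≤ ∫⁻ t, ENNReal.ofReal (2 * Real.pi) * ∫⁻ x, ‖u (t, x)‖ₑ ^ (2 : ℝ) ∂μ := by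
        refine lintegral_mono_ae ?_
        filter_upwards [hu2.1.prodMk_left] with t ht
        have h1 : ∫⁻ x, ‖u (t, x)‖ₑ ∂μ ≤ ENNReal.ofReal (2 * Real.pi) ^ (1 / 2 : ℝ) *
            (∫⁻ x, ‖u (t, x)‖ₑ ^ (2 : ℝ) ∂μ) ^ (1 / 2 : ℝ) := by
          calc _ = ∫⁻ x, (1 : ℝ≥0∞) ^ (1 / 2 : ℝ) * (‖u (t, x)‖ₑ ^ (2 : ℝ)) ^ (1 / 2 : ℝ) ∂μ := by
                refine lintegral_congr fun x => ?_
                rw [← ENNReal.rpow_mul]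
                norm_num
            _ ≤ (∫⁻ _, 1 ∂μ) ^ (1 / 2 : ℝ) *
                (∫⁻ x, ‖u (t, x)‖ₑ ^ (2 : ℝ) ∂μ) ^ (1 / 2 : ℝ) :=
                ENNReal.lintegral_mul_norm_pow_le aemeasurable_const (ht.enorm.pow_const _)
                  (by norm_num) (by norm_num) (by norm_num)
            _ = _ := by rw [lintegral_one, hμu]
        calc _ ≤ (1 * ∫⁻ x, ‖u (t, x)‖ₑ ∂μ) ^ (2 : ℝ) := by
              rw [enorm_mul, enorm_fourier_const]
              gcongr
              · exact fourier_const_le_one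
              · refine (enorm_integral_le_lintegral_enorm _).trans (le_of_eq ?_)
                refine lintegral_congr fun x => ?_
                rw [enorm_mul, hex, mul_one]
          _ ≤ (ENNReal.ofReal (2 * Real.pi) ^ (1 / 2 : ℝ) *
                (∫⁻ x, ‖u (t, x)‖ₑ ^ (2 : ℝ) ∂μ) ^ (1 / 2 : ℝ)) ^ (2 : ℝ) := by
              rw [one_mul]
              gcongr
          _ = _ := by
              rw [ENNReal.mul_rpow_of_nonneg _ _ (by norm_num), ← ENNReal.rpow_mul,
                ← ENNReal.rpow_mul]
              norm_num
    _ = ENNReal.ofReal (2 * Real.pi) * ∫⁻ z, ‖u z‖ₑ ^ (2 : ℝ) ∂(volume.prod μ) := by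
        rw [lintegral_const_mul' _ _ (by finiteness),
          lintegral_prod _ (hu2.1.enorm.pow_const _)]
    _ < ∞ := by
        have := hu2.2
        rw [eLpNorm_eq_lintegral_rpow_enorm_toReal (by norm_num) (by norm_num)] at this
        refine ENNReal.mul_lt_top (by finiteness) ?_
        have h2 := (ENNReal.rpow_lt_top_iff_of_pos (by norm_num)).1 this
        simpa using h2

lemma fourierX_eq_zero {T : ℝ} {u : ℝ × ℝ → ℂ} (hs : TimeSupported T u) (n : ℤ) :
    ∀ᵐ t, T < |t| → fourierX u t n = 0 := by
  have h2π : (0 : ℝ) ≤ 2 * Real.pi := by positivity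
  have h := Measure.ae_ae_of_ae_prod (μ := (volume : Measure ℝ)) (ν := (volume : Measure ℝ)) hs
  filter_upwards [h] with t ht hT
  rw [fourierX, intervalIntegral.integral_of_le h2π, integral_eq_zero_of_ae, mul_zero]
  refine ae_restrict_of_ae ?_
  filter_upwards [ht] with x hx
  simp [hx hT]

lemma integrable_of_support {T : ℝ} {f : ℝ → ℂ} (hf : MemLp f 2)
    (hs : ∀ᵐ t, T < |t| → f t = 0) : Integrable f := by
  have h1 : IntegrableOn f (Set.Icc (-T) T) :=
    (hf.restrict _).integrable one_le_two
  have h2 : f =ᵐ[volume] (Set.Icc (-T) T).indicator f := by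
    filter_upwards [hs] with t ht
    by_cases h : t ∈ Set.Icc (-T) T
    · rw [Set.indicator_of_mem h]
    · rw [Set.indicator_of_notMem h, ht (by
        by_contra hc
        exact h (abs_le.1 (not_lt.1 hc)))]
  exact ((integrable_indicator_iff measurableSet_Icc).2 h1).congr h2.symm

lemma integrable_fourierX {T : ℝ} {u : ℝ × ℝ → ℂ} (hu : MemL2 u) (hs : TimeSupported T u)
    (n : ℤ) : Integrable fun t => fourierX u t n :=
  integrable_of_support (memLp_fourierX hu n) (fourierX_eq_zero hs n)

/-! ### The norms in the modulation variables -/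

lemma sqNorm_reflect (β : ℝ) (h : ℝ → ℝ≥0∞) : sqNorm β (fun x => h (-x)) = sqNorm β h := by
  unfold sqNorm
  rw [← lintegral_sub_left_eq_self _ 0]
  refine lintegral_congr fun x => ?_
  simp only [zero_sub, jb_neg, neg_neg]

/-- The translation x = τ + ξ² turns the modulation weight into ⟨x⟩^b, and the frequency weight is
constant in τ. -/
lemma eLpNorm_weighted {ξ : ℤ} (b : ℝ) (f : ℝ → ℂ) :
    eLpNorm (fun τ : ℝ =>
      ((bracket (τ + (ξ : ℝ) ^ 2) ^ b * bracket (ξ : ℝ) ^ (1 / 2 : ℝ) : ℝ) : ℂ) * f τ) 2 volume =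
      jb ξ ^ (1 / 2 : ℝ) * sqNorm b (fun x => ‖f (x - (ξ : ℝ) ^ 2)‖ₑ) ^ (1 / 2 : ℝ) := by
  have e1 : jb ξ ^ (1 / 2 : ℝ) = ((jb ξ ^ (1 / 2 : ℝ)) ^ (2 : ℝ)) ^ (1 / 2 : ℝ) := by
    rw [← ENNReal.rpow_mul (jb ξ ^ (1 / 2 : ℝ))]; norm_num
  conv_rhs => rw [e1]
  rw [← ENNReal.mul_rpow_of_nonneg _ _ (by norm_num), sqNorm, ← lintegral_const_mul' _ _
    (ENNReal.rpow_ne_top_of_nonneg (by norm_num) (jb_rpow_ne_top _ _)),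
    eLpNorm_eq_lintegral_rpow_enorm_toReal (by norm_num) (by norm_num),
    ← lintegral_sub_right_eq_self _ ((ξ : ℝ) ^ 2)]
  simp only [ENNReal.toReal_ofNat]
  congr 1
  refine lintegral_congr fun x => ?_
  rw [← ENNReal.mul_rpow_of_nonneg _ _ (by norm_num), sub_add_cancel, enorm_mul, ← ofReal_norm,
    Complex.norm_real, Real.norm_of_nonneg (by
      have := bracket_pos x; have := bracket_pos ξ; positivity),
    ENNReal.ofReal_mul (by have := bracket_pos x; positivity), ← jb_rpow, ← jb_rpow]
  ring_nf

lemma conjExponent_ofReal {q Q : ℝ} (hq : 1 < q) (h : 1 / q + 1 / Q = 1) :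
    (ENNReal.ofReal q).conjExponent = ENNReal.ofReal Q := by
  have hq0 : 0 < q := by linarith
  have hQ : Q = 1 + (q - 1)⁻¹ := by
    have h1 : 1 / Q = (q - 1) / q := by
      have : (q - 1) / q = 1 - 1 / q := by field_simp
      linarith
    have h2 : Q = q / (q - 1) := by
      rw [← one_div_one_div Q, h1, one_div_div]
    rw [h2]
    have : q - 1 ≠ 0 := by linarith
    field_simp
    ring
  have hpos : 0 < q - 1 := by linarith
  rw [ENNReal.conjExponent, hQ, ENNReal.ofReal_add one_pos.le (by positivity), ENNReal.ofReal_one,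
    ENNReal.ofReal_inv_of_pos hpos, ENNReal.ofReal_sub _ one_pos.le, ENNReal.ofReal_one]

lemma xNorm_eq {r R : ℝ} (hr : 1 < r) (hR : 0 < R) (h : 1 / r + 1 / R = 1) (b : ℝ)
    (f : ℤ → ℝ → ℂ) :
    xNorm (1 / 2) b (ENNReal.ofReal r) 2 f =
      (∑' n : ℤ, (jb n ^ (1 / 2 : ℝ) *
        sqNorm b (fun x => ‖f n (x - (n : ℝ) ^ 2)‖ₑ) ^ (1 / 2 : ℝ)) ^ R) ^ (1 / R) := by
  have h2 : (2 : ℝ≥0∞).conjExponent = 2 := by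
    have := conjExponent_ofReal (q := 2) (Q := 2) one_lt_two (by norm_num)
    simpa using this
  unfold xNorm
  rw [h2, conjExponent_ofReal hr h]
  simp_rw [eLpNorm_weighted]
  rw [eLpNorm_eq_lintegral_rpow_enorm_toReal (by simpa using hR) (by finiteness),
    ENNReal.toReal_ofReal hR.le, lintegral_count]
  simp only [enorm_eq_self]

section

/-! ### The majorant of the trilinear operator -/

/-- The size of `ℱ u` in terms of the modulation. -/
def inputSize (u : ℝ × ℝ → ℂ) (n : ℤ) (x : ℝ) : ℝ≥0∞ := ‖fourierTX u n (-(n : ℝ) ^ 2 - x)‖ₑ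

/-- The size of the transform of the complex conjugate of `u` in terms of the modulation. -/
def conjInputSize (u : ℝ × ℝ → ℂ) (n : ℤ) (x : ℝ) : ℝ≥0∞ :=
  ‖fourierTX (conjFn u) n ((n : ℝ) ^ 2 - x)‖ₑ

/-- Conjugation in physical space reflects both the frequency and the modulation, so the conjugated
input has the norms of the input itself. -/
lemma conjInputSize_eq (u : ℝ × ℝ → ℂ) (n : ℤ) :
    conjInputSize u n = fun x => inputSize u (-n) (-x) := by
  funext x
  rw [conjInputSize, inputSize, fourierTX, fourierTX]
  simp_rw [fourierX_conjFn]
  rw [fourierT_conj, ← ofReal_norm, RCLike.norm_conj, ofReal_norm]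
  push_cast
  ring_nf

lemma sqNorm_conjInputSize (β : ℝ) (u : ℝ × ℝ → ℂ) (n : ℤ) :
    sqNorm β (conjInputSize u n) = sqNorm β (inputSize u (-n)) := by
  rw [conjInputSize_eq, sqNorm_reflect]

lemma xNorm_fourierTX {q Q : ℝ} (hq : 1 < q) (hQ : 0 < Q) (h : 1 / q + 1 / Q = 1)
    (u : ℝ × ℝ → ℂ) :
    xNorm (1 / 2) (1 / 2) (ENNReal.ofReal q) 2 (fourierTX u) = inNorm Q (inputSize u) := by
  rw [xNorm_eq hq hQ h, inNorm]
  congr 1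
  refine tsum_congr fun n => ?_
  rw [← sqNorm_reflect _ (inputSize u n)]
  have e : ∀ x : ℝ, -(n : ℝ) ^ 2 - -x = x - (n : ℝ) ^ 2 := fun x => by ring
  simp only [inputSize, e]

lemma inNorm_conjInputSize (R : ℝ) (u : ℝ × ℝ → ℂ) :
    inNorm R (conjInputSize u) = inNorm R (inputSize u) := by
  unfold inNorm
  rw [← (Equiv.neg ℤ).tsum_eq]
  congr 1
  refine tsum_congr fun n => ?_
  rw [sqNorm_conjInputSize]
  simp [jb_neg]

lemma sqNorm_ne_top_of_tsum {R β : ℝ} (hR : 0 < R) {F : ℤ → ℝ → ℝ≥0∞}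
    (h : (∑' n : ℤ, (jb n ^ (1 / 2 : ℝ) * sqNorm β (F n) ^ (1 / 2 : ℝ)) ^ R) ^ (1 / R) ≠ ∞)
    (n : ℤ) : sqNorm β (F n) ≠ ∞ := by
  intro hn
  refine h ?_
  have h1 : (∑' n : ℤ, (jb n ^ (1 / 2 : ℝ) * sqNorm β (F n) ^ (1 / 2 : ℝ)) ^ R) = ∞ := by
    refine top_unique (le_trans (le_of_eq ?_) (ENNReal.le_tsum n))
    rw [hn, ENNReal.top_rpow_of_pos (by norm_num), ENNReal.mul_top (jb_rpow_ne_zero _ _),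
      ENNReal.top_rpow_of_pos hR]
  rw [h1, ENNReal.top_rpow_of_pos (by positivity)]

section

variable {T : ℝ} {u u₁ u₂ u₃ : ℝ × ℝ → ℂ}

lemma continuous_fourierTX (hu : MemL2 u) (hs : TimeSupported T u) (n : ℤ) :
    Continuous (fourierTX u n) :=
  continuous_fourierT (integrable_fourierX hu hs n)

lemma measurable_inputSize (hu : MemL2 u) (hs : TimeSupported T u) (n : ℤ) :
    Measurable (inputSize u n) :=
  ((continuous_fourierTX hu hs n).measurable.comp (measurable_const.sub measurable_id)).enorm

lemma measurable_conjInputSize (hu : MemL2 u) (hs : TimeSupported T u) (n : ℤ) :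
    Measurable (conjInputSize u n) := by
  rw [conjInputSize_eq]
  exact (measurable_inputSize hu hs _).comp measurable_neg

lemma sqNorm_inputSize_gain {δ : ℝ} (hδ : 0 ≤ δ) (hδ' : δ ≤ 1 / 2) (hT : 0 < T) (hu : MemL2 u)
    (hs : TimeSupported T u) (n : ℤ) :
    sqNorm (1 / 2 - δ) (inputSize u n) ≤
      (4 * ENNReal.ofReal (T ^ δ)) ^ (2 : ℝ) * sqNorm (1 / 2) (inputSize u n) := by
  have hi := integrable_fourierX hu hs n
  have h2 := memLp_fourierX hu n
  have e : ∫⁻ x, inputSize u n x ^ (2 : ℝ) = ∫⁻ τ, ‖fourierTX u n τ‖ₑ ^ (2 : ℝ) :=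
    lintegral_sub_left_eq_self (fun τ => ‖fourierTX u n τ‖ₑ ^ (2 : ℝ)) (-(n : ℝ) ^ 2)
  refine sqNorm_gain hδ hδ' hT (measurable_inputSize hu hs n) ?_ fun x => ?_
  · rw [e]
    unfold fourierTX
    rw [lintegral_fourierT_sq hi h2]
    exact (memLp_two_iff.1 h2).2.ne
  · rw [e]
    exact enorm_fourierT_sq_le hT hi h2 (fourierX_eq_zero hs n) _

lemma sqNorm_conjInputSize_gain {δ : ℝ} (hδ : 0 ≤ δ) (hδ' : δ ≤ 1 / 2) (hT : 0 < T)
    (hu : MemL2 u) (hs : TimeSupported T u) (n : ℤ) :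
    sqNorm (1 / 2 - δ) (conjInputSize u n) ≤
      (4 * ENNReal.ofReal (T ^ δ)) ^ (2 : ℝ) * sqNorm (1 / 2) (conjInputSize u n) := by
  rw [sqNorm_conjInputSize, sqNorm_conjInputSize]
  exact sqNorm_inputSize_gain hδ hδ' hT hu hs _

lemma fourierT_const_mul (c : ℂ) (f : ℝ → ℂ) (τ : ℝ) :
    fourierT (fun t => c * f t) τ = c * fourierT f τ := by
  simp only [fourierT, mul_assoc]
  rw [integral_const_mul]
  ring

lemma cubicTerm_eq (u₁ u₂ u₃ : ℝ × ℝ → ℂ) (k l η m : ℤ) :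
    cubicTerm u₁ u₂ u₃ k l η m = fun t => (Complex.I * η) *
      (fourierX u₁ t k * fourierX u₂ t l * fourierX (conjFn u₃) t m) := by
  funext t
  rw [cubicTerm, show (fun z => (starRingEnd ℂ) (u₃ z)) = conjFn u₃ from rfl]
  ring

/-- The functions to which the trilinear estimate applies. -/
structure IsInput (T : ℝ) (u : ℝ × ℝ → ℂ) : Prop where
  memL2 : MemL2 u
  supported : TimeSupported T u
  ne_top : ∀ n, sqNorm (1 / 2) (inputSize u n) ≠ ∞

lemma IsInput.integrable (h : IsInput T u) (n : ℤ) : Integrable fun t => fourierX u t n :=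
  integrable_fourierX h.memL2 h.supported n

lemma IsInput.integrable_conj (h : IsInput T u) (n : ℤ) :
    Integrable fun t => fourierX (conjFn u) t n :=
  integrable_fourierX h.memL2.conjFn h.supported.conjFn n

lemma IsInput.memLp_mul (h₁ : IsInput T u₁) (h₂ : IsInput T u₂) (k l : ℤ) :
    MemLp (fun t => fourierX u₁ t k * fourierX u₂ t l) 2 :=
  memLp_two_mul (h₁.integrable k) (memLp_fourierX h₁.memL2 k)
    (h₂.integrable l) (memLp_fourierX h₂.memL2 l) (α := (k : ℝ) ^ 2) (β := (l : ℝ) ^ 2)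
    (h₁.ne_top k) (h₂.ne_top l)

lemma integrable_cubicTerm (h₁ : IsInput T u₁) (h₂ : IsInput T u₂) (h₃ : IsInput T u₃)
    (k l η m : ℤ) : Integrable (cubicTerm u₁ u₂ u₃ k l η m) := by
  rw [cubicTerm_eq]
  exact ((h₁.memLp_mul h₂ k l).integrable_mul (memLp_fourierX h₃.memL2.conjFn m)).const_mul _

/-- The bound for triple products in modulation variables; `hM` is where the resonance function of
the frequencies enters. -/
lemma enorm_fourierT_cubicTerm_le (h₁ : IsInput T u₁) (h₂ : IsInput T u₂) (h₃ : IsInput T u₃)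
    (k l η m : ℤ) {τ M : ℝ} (hM : -M - (k : ℝ) ^ 2 - (l : ℝ) ^ 2 + (m : ℝ) ^ 2 = τ) :
    ‖fourierT (cubicTerm u₁ u₂ u₃ k l η m) τ‖ₑ ≤ ENNReal.ofReal |(η : ℝ)| *
      triConv (inputSize u₁ k) (inputSize u₂ l) (conjInputSize u₃ m) M := by
  have e : ‖Complex.I * (η : ℂ)‖ₑ = ENNReal.ofReal |(η : ℝ)| := by
    rw [← ofReal_norm, norm_mul, Complex.norm_I, one_mul, Complex.norm_intCast]
  rw [cubicTerm_eq, fourierT_const_mul, enorm_mul, e]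
  refine mul_le_mul_right ?_ _
  refine (enorm_fourierT_mul_mul_le (h₁.integrable k) (memLp_fourierX h₁.memL2 k)
    (h₂.integrable l) (memLp_fourierX h₂.memL2 l) (h₃.integrable_conj m)
    (memLp_fourierX h₃.memL2.conjFn m) (h₁.memLp_mul h₂ k l) τ).trans (le_of_eq ?_)
  rw [← hM, ← triConv_reflect]
  rfl

/-- The nonresonant frequencies in terms of the differences to the output frequency. -/
def nonResonantEquiv (ξ : ℤ) : NonResonant ξ ≃ NzPair where
  toFun k := ⟨(ξ - k.1.1, ξ - k.1.2), sub_ne_zero.2 k.2.1.symm, sub_ne_zero.2 k.2.2.symm⟩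
  invFun p := ⟨(ξ - p.1.1, ξ - p.1.2), by simpa using p.2⟩
  left_inv k := by simp
  right_inv p := by simp

lemma tsum_add_le_majorant (h₁ : IsInput T u₁) (h₂ : IsInput T u₂) (h₃ : IsInput T u₃)
    (ξ : ℤ) (τ : ℝ) :
    (∑' k : NonResonant ξ, ‖fourierT (nonresTerm u₁ u₂ u₃ ξ k) τ‖ₑ) +
        ‖fourierT (corrTerm u₁ u₂ u₃ ξ) τ‖ₑ ≤
      majorant (inputSize u₁) (inputSize u₂) (conjInputSize u₃) ξ (τ + (ξ : ℝ) ^ 2) := by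
  refine add_le_add ?_ (enorm_fourierT_cubicTerm_le h₁ h₂ h₃ ξ ξ ξ (-ξ) (by push_cast; ring))
  rw [← (nonResonantEquiv ξ).symm.tsum_eq]
  refine ENNReal.tsum_le_tsum fun p => ?_
  have e : ξ - (ξ - p.1.1) - (ξ - p.1.2) = p.1.1 + p.1.2 - ξ := by ring
  have e' : nonresTerm u₁ u₂ u₃ ξ ((nonResonantEquiv ξ).symm p) =
      cubicTerm u₁ u₂ u₃ (ξ - p.1.1) (ξ - p.1.2) (p.1.1 + p.1.2 - ξ) (p.1.1 + p.1.2 - ξ) := by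
    rw [← e]
    rfl
  rw [e']
  exact enorm_fourierT_cubicTerm_le h₁ h₂ h₃ _ _ _ _ (by push_cast; ring)

lemma enorm_trilinearFourier_le (h₁ : IsInput T u₁) (h₂ : IsInput T u₂) (h₃ : IsInput T u₃)
    (ξ : ℤ) (τ : ℝ) :
    ‖trilinearFourier u₁ u₂ u₃ ξ τ‖ₑ ≤
      majorant (inputSize u₁) (inputSize u₂) (conjInputSize u₃) ξ (τ + (ξ : ℝ) ^ 2) := by
  have hc : ‖((2 * Real.pi)⁻¹ : ℂ)‖ₑ ≤ 1 := by
    rw [← ofReal_norm, ENNReal.ofReal_le_one, norm_inv]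
    refine inv_le_one_of_one_le₀ ?_
    rw [norm_mul, Complex.norm_real, Real.norm_of_nonneg Real.pi_pos.le]
    norm_num
    linarith [Real.pi_gt_three]
  refine le_trans ?_ (tsum_add_le_majorant h₁ h₂ h₃ ξ τ)
  refine (enorm_add_le _ _).trans (add_le_add ?_ ?_)
  · rw [enorm_mul]
    exact (mul_le_mul' hc enorm_tsum_le_tsum_enorm).trans (one_mul _).le
  · rw [enorm_mul]
    exact (mul_le_mul_left hc _).trans (one_mul _).le

/-- A finite weighted L² norm forces the majorant to be finite almost everywhere, and the majorant
dominates the sum of the absolute values. -/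
lemma ae_tsum_ne_top (h₁ : IsInput T u₁) (h₂ : IsInput T u₂) (h₃ : IsInput T u₃) (ξ : ℤ)
    (h : sqNorm (-(1 / 2))
      (majorant (inputSize u₁) (inputSize u₂) (conjInputSize u₃) ξ) ≠ ∞) :
    ∀ᵐ τ : ℝ, ∑' k : NonResonant ξ, ‖fourierT (nonresTerm u₁ u₂ u₃ ξ k) τ‖ₑ ≠ ∞ := by
  have hm := measurable_majorant (fun n => measurable_inputSize h₁.memL2 h₁.supported n)
    (fun n => measurable_inputSize h₂.memL2 h₂.supported n)
    (fun n => measurable_conjInputSize h₃.memL2 h₃.supported n) ξ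
  have h0 := ae_lt_top (measurable_sqNorm_integrand hm) h
  have h0' := (measurePreserving_add_right (volume : Measure ℝ)
    ((ξ : ℝ) ^ 2)).quasiMeasurePreserving.ae h0
  filter_upwards [h0'] with τ hτ hk
  have h3 : majorant (inputSize u₁) (inputSize u₂) (conjInputSize u₃) ξ (τ + (ξ : ℝ) ^ 2) = ∞ := by
    refine top_unique (le_trans ?_ (tsum_add_le_majorant h₁ h₂ h₃ ξ τ))
    rw [hk, top_add]
  rw [h3, ENNReal.mul_top (jb_rpow_ne_zero _ _), ENNReal.top_rpow_of_pos (by norm_num)] at hτ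
  exact lt_irrefl _ hτ

lemma summable_of_tsum_enorm_ne_top {ι : Type*} {f : ι → ℂ} (h : ∑' i, ‖f i‖ₑ ≠ ∞) :
    Summable f :=
  Summable.of_nnnorm (ENNReal.tsum_coe_ne_top_iff_summable.1 h)

/-- The series is an almost everywhere limit of finite sums, each continuous because its terms are
transforms of integrable functions. -/
lemma aestronglyMeasurable_trilinearFourier (h₁ : IsInput T u₁) (h₂ : IsInput T u₂)
    (h₃ : IsInput T u₃) (ξ : ℤ)
    (h : ∀ᵐ τ : ℝ, Summable fun k : NonResonant ξ => fourierT (nonresTerm u₁ u₂ u₃ ξ k) τ) :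
    AEStronglyMeasurable (trilinearFourier u₁ u₂ u₃ ξ) := by
  have hc : ∀ k l η m : ℤ, Continuous (fourierT (cubicTerm u₁ u₂ u₃ k l η m)) :=
    fun k l η m => continuous_fourierT (integrable_cubicTerm h₁ h₂ h₃ k l η m)
  refine AEStronglyMeasurable.add (AEStronglyMeasurable.const_mul ?_ _)
    ((hc ξ ξ ξ (-ξ)).aestronglyMeasurable.const_mul _)
  refine aestronglyMeasurable_of_tendsto_ae Filter.atTop
    (f := fun (s : Finset (NonResonant ξ)) τ => ∑ k ∈ s, fourierT (nonresTerm u₁ u₂ u₃ ξ k) τ)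
    (fun s => ?_) ?_
  · exact (continuous_finsetSum s fun k _ => hc _ _ _ _).aestronglyMeasurable
  · filter_upwards [h] with τ hτ
    exact hτ.hasSum

lemma xNorm_trilinearFourier_le {r R : ℝ} (hr : 1 < r) (hR : 0 < R) (h : 1 / r + 1 / R = 1)
    (h₁ : IsInput T u₁) (h₂ : IsInput T u₂) (h₃ : IsInput T u₃) :
    xNorm (1 / 2) (-1 / 2) (ENNReal.ofReal r) 2 (trilinearFourier u₁ u₂ u₃) ≤
      outNorm R (majorant (inputSize u₁) (inputSize u₂) (conjInputSize u₃)) := by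
  rw [xNorm_eq hr hR h, outNorm, neg_div]
  refine ENNReal.rpow_le_rpow (ENNReal.tsum_le_tsum fun n => ?_) (by positivity)
  refine ENNReal.rpow_le_rpow (mul_le_mul_right ?_ _) hR.le
  refine ENNReal.rpow_le_rpow (lintegral_mono fun x => ?_) (by norm_num)
  refine ENNReal.rpow_le_rpow (mul_le_mul_right ?_ _) (by norm_num)
  have := enorm_trilinearFourier_le h₁ h₂ h₃ n (x - (n : ℝ) ^ 2)
  rwa [sub_add_cancel] at this

end

end

/-! ### ### Choice of the exponents and the gain in T -/

lemma one_div_add_one_div_conjExponent {q : ℝ} (hq : 1 < q) :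
    1 / q + 1 / Real.conjExponent q = 1 := by
  simpa using (Real.HolderConjugate.conjExponent hq).inv_add_inv_eq_one

lemma one_div_conjExponent {q : ℝ} (hq : 1 < q) : 1 / Real.conjExponent q = 1 - 1 / q := by
  linarith [one_div_add_one_div_conjExponent hq]

/-- For `4/3 < q ≤ r ≤ 2` and `δ < 1/q'` there are admissible exponents. -/
lemma exists_exponents {q r δ : ℝ} (hq : 4 / 3 < q) (hqr : q ≤ r) (hr : r ≤ 2)
    (hδ : δ < 1 / Real.conjExponent q) :
    ∃ δ₁ ε θ' : ℝ, δ < δ₁ ∧ δ₁ < 1 / 2 ∧ 0 < ε ∧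
      Exponents q (Real.conjExponent q) r (Real.conjExponent r) (1 / (1 / 2 + δ₁)) (1 / 2 - ε) θ' := by
  have hq1 : 1 < q := by linarith
  have hr1 : 1 < r := by linarith
  have eQ := one_div_conjExponent hq1
  have eR := one_div_conjExponent hr1
  have hq3 : 1 / q < 3 / 4 := by
    rw [div_lt_div_iff₀ (by linarith) (by norm_num)]; linarith
  have hq2 : 1 / 2 ≤ 1 / q := one_div_le_one_div_of_le (by linarith) (by linarith)
  have hr2 : 1 / 2 ≤ 1 / r := one_div_le_one_div_of_le (by linarith) (by linarith)
  have hqr' : 1 / r ≤ 1 / q := one_div_le_one_div_of_le (by linarith) hqr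
  have hQ0 : 0 < Real.conjExponent q := (Real.HolderConjugate.conjExponent hq1).symm.pos
  have hR0 : 0 < Real.conjExponent r := (Real.HolderConjugate.conjExponent hr1).symm.pos
  set Q := Real.conjExponent q with hQ
  set R := Real.conjExponent r with hR
  set x := 1 / Q with hx
  -- The bound δ₁ > 1/2 - 1/q' gives t ≤ q, and δ₁ < 1/q' is needed for the critical frequency sum.
  -- The interval is nonempty because q > 4/3 means 1/q' > 1/4, and because δ < 1/q'.
  obtain ⟨δ₁, hδ₁, hδ₁'⟩ : ∃ δ₁, max δ (max (1 / 2 - x) 0) < δ₁ ∧ δ₁ < x :=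
    exists_between (max_lt hδ (max_lt (by linarith) (by linarith)))
  obtain ⟨a1, a2⟩ := max_lt_iff.1 hδ₁
  obtain ⟨a2, a3⟩ := max_lt_iff.1 a2
  have hQ2 : 2 ≤ Q := by
    rw [← one_div_le_one_div (by positivity) two_pos]; linarith
  have hR2 : 2 ≤ R := by
    rw [← one_div_le_one_div (by positivity) two_pos]; linarith
  -- The gap 1/q' - δ₁ is shared out: ε = gap/8 makes θ = 1/2 - ε, and θ' = 1/2 - 2ε lies strictly
  -- below it.
  refine ⟨δ₁, (x - δ₁) / 8, 1 / 2 - (x - δ₁) / 4, a1, by linarith, by linarith, ?_⟩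
  exact
  { hq := by linarith
    hr := by linarith
    one_lt_t := by rw [lt_div_iff₀ (by linarith)]; linarith
    t_lt_two := by rw [div_lt_iff₀ (by linarith)]; linarith
    t_lt_q := by
      rw [div_le_iff₀ (by linarith)]
      have : 1 ≤ q * (1 / q) := by rw [mul_one_div_cancel (by linarith)]
      nlinarith
    q_le_r := hqr
    hQ := hQ2
    hR := hR2
    theta_lt := by linarith
    theta_le := by linarith
    ht := by rw [one_div_one_div]; linarith
    htheta := by linarith }

/-- The trilinear estimate for functions supported in a short time interval. -/
theorem exists_outNorm_majorant_inputSize_le {q r δ : ℝ} (hq : 4 / 3 < q) (hqr : q ≤ r)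
    (hr : r ≤ 2) (hδ₀ : 0 ≤ δ) (hδ : δ < 1 / Real.conjExponent q) :
    ∃ C : ℝ≥0∞, C ≠ ∞ ∧ ∀ T : ℝ, 0 < T → ∀ u₁ u₂ u₃ : ℝ × ℝ → ℂ,
      MemL2 u₁ → MemL2 u₂ → MemL2 u₃ →
      TimeSupported T u₁ → TimeSupported T u₂ → TimeSupported T u₃ →
      xNorm (1 / 2) (1 / 2) (ENNReal.ofReal q) 2 (fourierTX u₁) ≠ ∞ →
      xNorm (1 / 2) (1 / 2) (ENNReal.ofReal q) 2 (fourierTX u₂) ≠ ∞ →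
      xNorm (1 / 2) (1 / 2) (ENNReal.ofReal r) 2 (fourierTX u₃) ≠ ∞ →
      IsInput T u₁ ∧ IsInput T u₂ ∧ IsInput T u₃ ∧
      outNorm (Real.conjExponent r)
          (majorant (inputSize u₁) (inputSize u₂) (conjInputSize u₃)) ≤
        C * ENNReal.ofReal (T ^ δ) *
          xNorm (1 / 2) (1 / 2) (ENNReal.ofReal q) 2 (fourierTX u₁) *
          xNorm (1 / 2) (1 / 2) (ENNReal.ofReal q) 2 (fourierTX u₂) *
          xNorm (1 / 2) (1 / 2) (ENNReal.ofReal r) 2 (fourierTX u₃) := by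
  obtain ⟨δ₁, ε, θ', h1, h2, h3, X⟩ := exists_exponents hq hqr hr hδ
  obtain ⟨C, hC, H⟩ := exists_outNorm_majorant_le X hδ₀ h1 h2 h3
  have hq1 : 1 < q := by linarith
  have hr1 : 1 < r := by linarith
  have hQ0 : 0 < Real.conjExponent q := (Real.HolderConjugate.conjExponent hq1).symm.pos
  have hR0 : 0 < Real.conjExponent r := (Real.HolderConjugate.conjExponent hr1).symm.pos
  have eq := one_div_add_one_div_conjExponent hq1
  have er := one_div_add_one_div_conjExponent hr1
  refine ⟨C * 4, by finiteness, fun T hT u₁ u₂ u₃ m₁ m₂ m₃ s₁ s₂ s₃ => ?_⟩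
  rw [xNorm_fourierTX hq1 hQ0 eq, xNorm_fourierTX hq1 hQ0 eq, xNorm_fourierTX hr1 hR0 er]
  intro n₁ n₂ n₃
  refine ⟨⟨m₁, s₁, sqNorm_ne_top_of_tsum hQ0 n₁⟩, ⟨m₂, s₂, sqNorm_ne_top_of_tsum hQ0 n₂⟩,
    ⟨m₃, s₃, sqNorm_ne_top_of_tsum hR0 n₃⟩, ?_⟩
  have hTδ : 0 < T ^ δ := Real.rpow_pos_of_pos hT δ
  have hδ' : δ ≤ 1 / 2 := by linarith
  have key := H (4 * ENNReal.ofReal (T ^ δ)) (inputSize u₁) (inputSize u₂) (conjInputSize u₃)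
    (mul_ne_zero (by norm_num) (by simpa using hTδ)) (by finiteness)
    (measurable_inputSize m₁ s₁) (measurable_inputSize m₂ s₂) (measurable_conjInputSize m₃ s₃)
    (sqNorm_inputSize_gain hδ₀ hδ' hT m₁ s₁) (sqNorm_inputSize_gain hδ₀ hδ' hT m₂ s₂)
    (sqNorm_conjInputSize_gain hδ₀ hδ' hT m₃ s₃) n₁ n₂ (by rwa [inNorm_conjInputSize])
  rw [inNorm_conjInputSize] at key
  refine key.trans (le_of_eq ?_)
  ring

/-! ### Smooth functions -/

lemma IsSchwartz.exists_bound {u : ℝ × ℝ → ℂ} (hu : IsSchwartz u) (γ : ℕ) :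
    ∃ C : ℝ, 0 ≤ C ∧ ∀ t x : ℝ, ‖iteratedDeriv γ (fun x' => u (t, x')) x‖ ≤ C := by
  obtain ⟨C, hC⟩ := hu.decay 0 0 γ
  have h : ∀ t x : ℝ, ‖iteratedDeriv γ (fun x' => u (t, x')) x‖ ≤ C := fun t x => by
    simpa using hC t x
  exact ⟨C, (norm_nonneg _).trans (h 0 0), h⟩

lemma IsSchwartz.memL2 {T : ℝ} {u : ℝ × ℝ → ℂ} (hu : IsSchwartz u) (hs : TimeSupported T u) :
    MemL2 u := by
  refine ⟨hu.periodic, ?_⟩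
  obtain ⟨C, hC0, hC⟩ := hu.exists_bound 0
  set S : Set (ℝ × ℝ) := Set.univ ×ˢ Set.Ioc (0 : ℝ) (2 * Real.pi) with hS
  set K : Set (ℝ × ℝ) := Set.Icc (-T) T ×ˢ Set.Icc (0 : ℝ) (2 * Real.pi) with hK
  have hKm : MeasurableSet K := measurableSet_Icc.prod measurableSet_Icc
  have hSm : MeasurableSet S := MeasurableSet.univ.prod measurableSet_Ioc
  have hfin : volume.restrict S K < ∞ :=
    (Measure.restrict_apply_le _ _).trans_lt (isCompact_Icc.prod isCompact_Icc).measure_lt_top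
  have : MemLp (K.indicator fun _ => (C : ℝ)) 2 (volume.restrict S) :=
    memLp_indicator_const 2 hKm C (Or.inr hfin.ne)
  refine this.mono hu.smooth.continuous.aestronglyMeasurable ?_
  filter_upwards [ae_restrict_of_ae hs, ae_restrict_mem hSm] with z hz hzS
  by_cases h : T < |z.1|
  · simp [hz h]
  · have hzK : z ∈ K := ⟨abs_le.1 (not_lt.1 h), Set.Ioc_subset_Icc_self hzS.2⟩
    rw [Set.indicator_of_mem hzK, Real.norm_of_nonneg hC0]
    simpa using hC z.1 z.2

/-- Two integrations by parts at once: the integrand is the derivative of (g' + in g)e^{-inx}, which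
is periodic. -/
lemma integral_exp_of_periodic {g : ℝ → ℂ} (hg : ContDiff ℝ 2 g)
    (hp : Function.Periodic g (2 * Real.pi)) (n : ℤ) :
    ∫ x in (0 : ℝ)..(2 * Real.pi),
      (iteratedDeriv 2 g x + (n : ℂ) ^ 2 * g x) * Complex.exp (-(Complex.I * x * n)) = 0 := by
  have hg1 : ContDiff ℝ 1 (deriv g) := by
    have := (contDiff_succ_iff_deriv (n := 1) (f := g)).1 (hg.of_le (by norm_num [one_add_one_eq_two]))
    exact this.2.2
  have hd : ∀ x, HasDerivAt g (deriv g x) x := fun x =>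
    (hg.differentiable (by norm_num) x).hasDerivAt
  have hd2 : ∀ x, HasDerivAt (deriv g) (iteratedDeriv 2 g x) x := fun x => by
    rw [iteratedDeriv_succ, iteratedDeriv_one]
    exact (hg1.differentiable (by norm_num) x).hasDerivAt
  have he : ∀ x : ℝ, HasDerivAt (fun x : ℝ => Complex.exp (-(Complex.I * x * n)))
      (Complex.exp (-(Complex.I * x * n)) * (-(Complex.I * n))) x := fun x => by
    have h1 : HasDerivAt (fun x : ℝ => -(Complex.I * (x : ℂ) * n)) (-(Complex.I * n)) x := by
      have := (((hasDerivAt_id x).ofReal_comp).const_mul Complex.I).mul_const (n : ℂ)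
      simpa using this.fun_neg
    exact h1.cexp
  set Φ : ℝ → ℂ := fun x => (deriv g x + Complex.I * n * g x) * Complex.exp (-(Complex.I * x * n))
    with hΦ
  have hΦd : ∀ x, HasDerivAt Φ
      ((iteratedDeriv 2 g x + (n : ℂ) ^ 2 * g x) * Complex.exp (-(Complex.I * x * n))) x :=
    fun x => by
      refine (((hd2 x).fun_add ((hd x).const_mul (Complex.I * n))).fun_mul (he x)).congr_deriv ?_
      linear_combination (-(n : ℂ) ^ 2 * g x * Complex.exp (-(Complex.I * x * n))) * Complex.I_sq
  have hc : Continuous fun x : ℝ =>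
      (iteratedDeriv 2 g x + (n : ℂ) ^ 2 * g x) * Complex.exp (-(Complex.I * x * n)) := by
    have := hg.continuous
    have := hg.continuous_iteratedDeriv 2 le_rfl
    fun_prop
  rw [intervalIntegral.integral_eq_sub_of_hasDerivAt (fun x _ => hΦd x)
    (hc.intervalIntegrable _ _), sub_eq_zero]
  have hp' : deriv g (2 * Real.pi) = deriv g 0 := by
    have h1 := deriv_comp_add_const (f := g) (2 * Real.pi) 0
    rw [zero_add] at h1
    rw [← h1]
    congr 1
    funext x
    exact hp x
  have hex : Complex.exp (-(Complex.I * ((2 * Real.pi : ℝ) : ℂ) * n)) = 1 := by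
    rw [Complex.exp_eq_one_iff]
    exact ⟨-n, by push_cast; ring⟩
  have h0 : g (2 * Real.pi) = g 0 := by simpa using hp 0
  simp only [hΦ, hp', h0, hex]
  simp

lemma norm_integral_exp_le {g : ℝ → ℂ} {C : ℝ} (h : ∀ x, ‖g x‖ ≤ C) (n : ℤ) :
    ‖∫ x in (0 : ℝ)..(2 * Real.pi), g x * Complex.exp (-(Complex.I * x * n))‖ ≤
      C * (2 * Real.pi) := by
  have := intervalIntegral.norm_integral_le_of_norm_le_const (a := 0) (b := 2 * Real.pi)
    (f := fun x : ℝ => g x * Complex.exp (-(Complex.I * x * n))) (C := C) fun x _ => ?_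
  · rwa [sub_zero, abs_of_pos (by positivity)] at this
  · rw [norm_mul, show -(Complex.I * x * n) = ((-(x * n) : ℝ) : ℂ) * Complex.I by
      push_cast; ring, Complex.norm_exp_ofReal_mul_I, mul_one]
    exact h x

/-- The Fourier coefficients of a smooth function decay quadratically. -/
lemma IsSchwartz.exists_norm_fourierX_le {u : ℝ × ℝ → ℂ} (hu : IsSchwartz u) :
    ∃ C : ℝ, 0 ≤ C ∧ ∀ (t : ℝ) (n : ℤ), ‖fourierX u t n‖ ≤ C * (1 + (n : ℝ) ^ 2)⁻¹ := by
  obtain ⟨C₀, h₀, H₀⟩ := hu.exists_bound 0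
  obtain ⟨C₂, h₂, H₂⟩ := hu.exists_bound 2
  refine ⟨(C₀ + C₂) * (2 * Real.pi), by positivity, fun t n => ?_⟩
  set g : ℝ → ℂ := fun x => u (t, x) with hgdef
  have hg : ContDiff ℝ 2 g :=
    (hu.smooth.comp (contDiff_prodMk_right t)).of_le (by norm_cast)
  have hc := hg.continuous
  have hc2 := hg.continuous_iteratedDeriv 2 le_rfl
  set I := ∫ x in (0 : ℝ)..(2 * Real.pi), g x * Complex.exp (-(Complex.I * x * n)) with hI
  have h1 : ‖I‖ ≤ C₀ * (2 * Real.pi) :=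
    norm_integral_exp_le (fun x => by simpa using H₀ t x) n
  have h3 : (n : ℂ) ^ 2 * I = -∫ x in (0 : ℝ)..(2 * Real.pi),
      iteratedDeriv 2 g x * Complex.exp (-(Complex.I * x * n)) := by
    rw [eq_neg_iff_add_eq_zero, ← integral_exp_of_periodic hg (fun x => hu.periodic t x) n, hI,
      ← intervalIntegral.integral_const_mul, ← intervalIntegral.integral_add
        (Continuous.intervalIntegrable (by fun_prop) _ _)
        (Continuous.intervalIntegrable (by fun_prop) _ _)]
    congr 1
    funext x
    ring
  have h4 : (n : ℝ) ^ 2 * ‖I‖ ≤ C₂ * (2 * Real.pi) := by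
    have := norm_integral_exp_le (H₂ t) n
    rw [← norm_neg, ← h3, norm_mul, norm_pow, Complex.norm_intCast, sq_abs] at this
    exact this
  have hk : ‖((Real.sqrt (2 * Real.pi))⁻¹ : ℂ)‖ ≤ 1 := by
    rw [← Complex.ofReal_inv, Complex.norm_real, Real.norm_of_nonneg (by positivity)]
    exact ENNReal.ofReal_le_one.1 fourier_const_le_one
  have hpos : 0 < 1 + (n : ℝ) ^ 2 := by positivity
  rw [← div_eq_mul_inv, le_div_iff₀ hpos, fourierX, norm_mul]
  calc _ ≤ 1 * ‖I‖ * (1 + (n : ℝ) ^ 2) := by gcongr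
    _ = ‖I‖ + (n : ℝ) ^ 2 * ‖I‖ := by ring
    _ ≤ _ := by linarith

lemma summable_inv_one_add_sq : Summable fun n : ℤ => (1 + (n : ℝ) ^ 2)⁻¹ := by
  refine Summable.of_norm_bounded_eventually (Real.summable_one_div_int_pow.2 one_lt_two) ?_
  filter_upwards [(Set.finite_singleton (0 : ℤ)).compl_mem_cofinite] with n hn
  have hn0 : (n : ℝ) ≠ 0 := by exact_mod_cast hn
  rw [Real.norm_of_nonneg (by positivity), one_div]
  exact inv_anti₀ (by positivity) (by linarith)

/-- The nonresonant terms are dominated by a summable sequence, uniformly in time. -/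
lemma exists_norm_nonresTerm_le {u₁ u₂ u₃ : ℝ × ℝ → ℂ} (h₁ : IsSchwartz u₁) (h₂ : IsSchwartz u₂)
    (h₃ : IsSchwartz u₃) (ξ : ℤ) :
    ∃ b : NonResonant ξ → ℝ, Summable b ∧ ∀ k t, ‖nonresTerm u₁ u₂ u₃ ξ k t‖ ≤ b k := by
  obtain ⟨C₁, c₁, H₁⟩ := h₁.exists_norm_fourierX_le
  obtain ⟨C₂, c₂, H₂⟩ := h₂.exists_norm_fourierX_le
  obtain ⟨C₃, c₃, H₃⟩ := h₃.exists_norm_fourierX_le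
  have hsum : Summable fun k : ℤ × ℤ => (1 + (k.1 : ℝ) ^ 2)⁻¹ * (1 + (k.2 : ℝ) ^ 2)⁻¹ :=
    summable_inv_one_add_sq.mul_of_nonneg summable_inv_one_add_sq
      (fun n => by positivity) (fun n => by positivity)
  refine ⟨fun k => C₁ * C₂ * C₃ * ((1 + (k.1.1 : ℝ) ^ 2)⁻¹ * (1 + (k.1.2 : ℝ) ^ 2)⁻¹),
    (hsum.subtype _).mul_left _, fun k t => ?_⟩
  set m : ℤ := ξ - k.1.1 - k.1.2 with hm
  have h4 : ‖fourierX (conjFn u₃) t m‖ ≤ C₃ * (1 + (m : ℝ) ^ 2)⁻¹ := by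
    rw [fourierX_conjFn, RCLike.norm_conj]
    simpa using H₃ t (-m)
  -- The derivative is absorbed by the decay of the third coefficient; the other two provide
  -- summability over the pairs.
  have h5 : |(m : ℝ)| * (1 + (m : ℝ) ^ 2)⁻¹ ≤ 1 := by
    rw [← div_eq_mul_inv, div_le_one (by positivity)]
    nlinarith [sq_nonneg (|(m : ℝ)| - 1), sq_abs (m : ℝ)]
  rw [nonresTerm, cubicTerm_eq]
  rw [norm_mul, norm_mul, norm_mul, norm_mul, Complex.norm_I, one_mul, Complex.norm_intCast]
  calc _ ≤ |(m : ℝ)| * (C₁ * (1 + (k.1.1 : ℝ) ^ 2)⁻¹ * (C₂ * (1 + (k.1.2 : ℝ) ^ 2)⁻¹) *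
        (C₃ * (1 + (m : ℝ) ^ 2)⁻¹)) := by
        gcongr
        · exact H₁ t _
        · exact H₂ t _
    _ = (|(m : ℝ)| * (1 + (m : ℝ) ^ 2)⁻¹) *
        (C₁ * C₂ * C₃ * ((1 + (k.1.1 : ℝ) ^ 2)⁻¹ * (1 + (k.1.2 : ℝ) ^ 2)⁻¹)) := by ring
    _ ≤ _ := mul_le_of_le_one_left (by positivity) h5

lemma fourierT_add {f g : ℝ → ℂ} (hf : Integrable f) (hg : Integrable g) (τ : ℝ) :
    fourierT (fun t => f t + g t) τ = fourierT f τ + fourierT g τ := by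
  have he : ∀ {f : ℝ → ℂ}, Integrable f →
      Integrable fun t : ℝ => f t * Complex.exp (-(Complex.I * t * τ)) := fun {f} hf => by
    refine hf.mul_bdd (c := 1) (Continuous.aestronglyMeasurable (by fun_prop)) ?_
    refine Filter.Eventually.of_forall fun t => ?_
    rw [show -(Complex.I * t * τ) = ((-(t * τ) : ℝ) : ℂ) * Complex.I by push_cast; ring,
      Complex.norm_exp_ofReal_mul_I]
  simp only [fourierT, add_mul]
  rw [integral_add (he hf) (he hg), mul_add]

/-- The Fourier transform in time of a uniformly summable series of functions supported in a
bounded time interval. -/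
lemma fourierT_tsum {ι : Type*} [Countable ι] {F : ι → ℝ → ℂ} {b : ι → ℝ} {T : ℝ}
    (hm : ∀ i, AEStronglyMeasurable (F i)) (hb : Summable b) (hle : ∀ i t, ‖F i t‖ ≤ b i)
    (hs : ∀ i, ∀ᵐ t, T < |t| → F i t = 0) :
    Integrable (fun t => ∑' i, F i t) ∧
      ∀ τ, fourierT (fun t => ∑' i, F i t) τ = ∑' i, fourierT (F i) τ := by
  have hfin : volume (Set.Icc (-T) T) < ∞ := isCompact_Icc.measure_lt_top
  have hind : ∀ c : ℝ, Integrable ((Set.Icc (-T) T).indicator fun _ => c) := fun c =>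
    (integrable_indicator_iff measurableSet_Icc).2 (integrableOn_const hfin.ne)
  have hFle : ∀ i, ∀ᵐ t, ‖F i t‖ ≤ (Set.Icc (-T) T).indicator (fun _ => b i) t := fun i => by
    filter_upwards [hs i] with t ht
    by_cases h : T < |t|
    · rw [ht h, norm_zero]
      exact Set.indicator_nonneg (fun _ _ => (norm_nonneg _).trans (hle i t)) _
    · have htK : t ∈ Set.Icc (-T) T := abs_le.1 (not_lt.1 h)
      rw [Set.indicator_of_mem htK]
      exact hle i t
  have hsum : ∀ t, Summable fun i => F i t := fun t => Summable.of_norm_bounded hb (hle · t)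
  refine ⟨?_, fun τ => ?_⟩
  · refine (hind (∑' i, b i)).mono' ?_ ?_
    · refine aestronglyMeasurable_of_tendsto_ae Filter.atTop
        (f := fun (s : Finset ι) t => ∑ i ∈ s, F i t)
        (fun s => Finset.aestronglyMeasurable_fun_sum s fun i _ => hm i)
        (Filter.Eventually.of_forall fun t => (hsum t).hasSum)
    · filter_upwards [ae_all_iff.2 hs] with t ht
      by_cases h : T < |t|
      · rw [tsum_congr fun i => ht i h, tsum_zero, norm_zero]
        exact Set.indicator_nonneg (fun _ _ => tsum_nonneg fun i => (norm_nonneg _).trans (hle i t)) _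
      · have htK : t ∈ Set.Icc (-T) T := abs_le.1 (not_lt.1 h)
        rw [Set.indicator_of_mem htK]
        exact tsum_of_norm_bounded hb.hasSum (hle · t)
  · set G : ι → ℝ → ℂ := fun i t => F i t * Complex.exp (-(Complex.I * t * τ)) with hG
    have hGn : ∀ i t, ‖G i t‖ = ‖F i t‖ := fun i t => by
      rw [hG, norm_mul, show -(Complex.I * t * τ) = ((-(t * τ) : ℝ) : ℂ) * Complex.I by
        push_cast; ring, Complex.norm_exp_ofReal_mul_I, mul_one]
    have hGi : ∀ i, Integrable (G i) := fun i => by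
      refine (hind (b i)).mono' ((hm i).mul (Continuous.aestronglyMeasurable (by fun_prop))) ?_
      simpa only [hGn] using hFle i
    have hGs : Summable fun i => ∫ t, ‖G i t‖ := by
      refine Summable.of_nonneg_of_le (fun i => integral_nonneg fun t => norm_nonneg _) (fun i => ?_)
        (hb.mul_left (volume.real (Set.Icc (-T) T)))
      calc ∫ t, ‖G i t‖ ≤ ∫ t, (Set.Icc (-T) T).indicator (fun _ => b i) t := by
            refine integral_mono_ae (hGi i).norm (hind _) ?_
            filter_upwards [hFle i] with t ht
            rwa [hGn]
        _ = _ := by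
            rw [integral_indicator measurableSet_Icc, setIntegral_const, smul_eq_mul]
    have key := (hasSum_integral_of_summable_integral_norm hGi hGs).tsum_eq
    simp only [fourierT]
    rw [tsum_mul_left]
    congr 1
    rw [key]
    refine integral_congr_ae (Filter.Eventually.of_forall fun t => ?_)
    simp only [hG]
    rw [tsum_mul_right]

lemma aestronglyMeasurable_cubicTerm {u₁ u₂ u₃ : ℝ × ℝ → ℂ} (h₁ : MemL2 u₁) (h₂ : MemL2 u₂)
    (h₃ : MemL2 u₃) (k l η m : ℤ) : AEStronglyMeasurable (cubicTerm u₁ u₂ u₃ k l η m) := by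
  rw [cubicTerm_eq]
  exact (((memLp_fourierX h₁ k).1.mul (memLp_fourierX h₂ l).1).mul
    (memLp_fourierX h₃.conjFn m).1).const_mul _

lemma cubicTerm_eq_zero {T : ℝ} {u₁ u₂ u₃ : ℝ × ℝ → ℂ} (h₁ : TimeSupported T u₁)
    (k l η m : ℤ) : ∀ᵐ t, T < |t| → cubicTerm u₁ u₂ u₃ k l η m t = 0 := by
  filter_upwards [fourierX_eq_zero h₁ k] with t ht hT
  simp [cubicTerm, ht hT]

/-- For smooth functions the Fourier transform in time may be applied term by term. -/
theorem fourierT_trilinearHat {T : ℝ} {u₁ u₂ u₃ : ℝ × ℝ → ℂ} (h₁ : IsSchwartz u₁)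
    (h₂ : IsSchwartz u₂) (h₃ : IsSchwartz u₃) (s₁ : TimeSupported T u₁) (s₂ : TimeSupported T u₂)
    (s₃ : TimeSupported T u₃) (ξ : ℤ) (τ : ℝ) :
    fourierT (fun t => trilinearHat u₁ u₂ u₃ t ξ) τ = trilinearFourier u₁ u₂ u₃ ξ τ := by
  have m₁ := h₁.memL2 s₁
  have m₂ := h₂.memL2 s₂
  have m₃ := h₃.memL2 s₃
  obtain ⟨b, hb, hle⟩ := exists_norm_nonresTerm_le h₁ h₂ h₃ ξ
  obtain ⟨hi, he⟩ := fourierT_tsum (F := nonresTerm u₁ u₂ u₃ ξ) (T := T)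
    (fun k => aestronglyMeasurable_cubicTerm m₁ m₂ m₃ _ _ _ _) hb hle
    (fun k => cubicTerm_eq_zero s₁ _ _ _ _)
  -- No finiteness of X-norms is assumed here, so the product of the first two coefficients is put
  -- into L² through the boundedness of one of them.
  have hc : Integrable (corrTerm u₁ u₂ u₃ ξ) := by
    obtain ⟨C₁, c₁, H₁⟩ := h₁.exists_norm_fourierX_le
    unfold corrTerm
    rw [cubicTerm_eq]
    refine Integrable.const_mul ?_ _
    have h4 : MemLp (fun t => fourierX u₁ t ξ * fourierX u₂ t ξ) 2 :=
      (memLp_fourierX m₂ ξ).of_le_mul (c := C₁ * (1 + (ξ : ℝ) ^ 2)⁻¹)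
        ((memLp_fourierX m₁ ξ).1.mul (memLp_fourierX m₂ ξ).1)
        (Filter.Eventually.of_forall fun t => by
          rw [norm_mul]
          exact mul_le_mul_of_nonneg_right (H₁ t ξ) (norm_nonneg _))
    exact h4.integrable_mul (memLp_fourierX m₃.conjFn (-ξ))
  unfold trilinearHat trilinearFourier
  rw [fourierT_add (hi.const_mul _) (hc.const_mul _), fourierT_const_mul, fourierT_const_mul, he]

/-! ### Functions of vanishing norm -/

/-- The weights are at least one, so the transform vanishes in L², and Plancherel carries this back
to time. -/
lemma fourierX_ae_eq_zero {T Q : ℝ} {u : ℝ × ℝ → ℂ} (hQ : 0 < Q) (hu : MemL2 u)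
    (hs : TimeSupported T u) (h : inNorm Q (inputSize u) = 0) (n : ℤ) :
    ∀ᵐ t, fourierX u t n = 0 := by
  have h1 : sqNorm (1 / 2) (inputSize u n) = 0 := by
    rw [inNorm, ENNReal.rpow_eq_zero_iff_of_pos (by positivity), ENNReal.tsum_eq_zero] at h
    have := h n
    rw [ENNReal.rpow_eq_zero_iff_of_pos hQ, mul_eq_zero] at this
    exact (ENNReal.rpow_eq_zero_iff_of_pos (by norm_num)).1
      (this.resolve_left (jb_rpow_ne_zero _ _))
  have h2 : ∫⁻ τ, ‖fourierTX u n τ‖ₑ ^ (2 : ℝ) ≤ sqNorm (1 / 2) (inputSize u n) := by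
    rw [← lintegral_sub_left_eq_self _ (-(n : ℝ) ^ 2)]
    refine lintegral_mono fun x => ENNReal.rpow_le_rpow ?_ (by norm_num)
    exact le_mul_of_one_le_left' (ENNReal.one_le_rpow (one_le_jb x) (by norm_num))
  have h3 : ∫⁻ t, ‖fourierX u t n‖ₑ ^ (2 : ℝ) = 0 := by
    rw [← lintegral_fourierT_sq (integrable_fourierX hu hs n) (memLp_fourierX hu n)]
    exact le_antisymm (h2.trans h1.le) zero_le
  rw [lintegral_eq_zero_iff' ((memLp_fourierX hu n).1.enorm.pow_const _)] at h3
  filter_upwards [h3] with t ht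
  simpa using ht

lemma xNorm_trilinearFourier_eq_zero {s b : ℝ} {r p : ℝ≥0∞} {u₁ u₂ u₃ : ℝ × ℝ → ℂ}
    (h : (∀ n, ∀ᵐ t, fourierX u₁ t n = 0) ∨ (∀ n, ∀ᵐ t, fourierX u₂ t n = 0) ∨
      ∀ n, ∀ᵐ t, fourierX u₃ t n = 0) :
    xNorm s b r p (trilinearFourier u₁ u₂ u₃) = 0 := by
  have hc : ∀ k l η m : ℤ, cubicTerm u₁ u₂ u₃ k l η m =ᵐ[volume] 0 := by
    intro k l η m
    rw [cubicTerm_eq]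
    rcases h with h | h | h
    · filter_upwards [h k] with t ht
      simp [ht]
    · filter_upwards [h l] with t ht
      simp [ht]
    · filter_upwards [h (-m)] with t ht
      simp [fourierX_conjFn, ht]
  have hF : ∀ k l η m τ, fourierT (cubicTerm u₁ u₂ u₃ k l η m) τ = 0 := by
    intro k l η m τ
    rw [fourierT, integral_eq_zero_of_ae, mul_zero]
    filter_upwards [hc k l η m] with t ht
    simp [ht]
  have h0 : trilinearFourier u₁ u₂ u₃ = fun _ _ => 0 := by
    funext ξ τ
    have h1 : ∀ k, fourierT (nonresTerm u₁ u₂ u₃ ξ k) τ = 0 := fun k => hF _ _ _ _ τ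
    have h2 : fourierT (corrTerm u₁ u₂ u₃ ξ) τ = 0 := hF _ _ _ _ τ
    rw [trilinearFourier, tsum_congr h1, h2, tsum_zero, mul_zero, add_zero]
  simp [h0, xNorm]

end DNLS

end

/-! ### ### The main theorem -/

theorem mainTheorem3 (q r δ : ℝ) (hq : 4 / 3 < q) (hqr : q ≤ r) (hr : r ≤ 2)
    (hδ₀ : 0 ≤ δ) (hδ : δ < 1 / Real.conjExponent q) :
    ∃ C : ℝ≥0, ∀ T : ℝ, 0 < T → T ≤ 1 →
      -- smooth arguments, where the operator is given by its series at each time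
      (∀ u₁ u₂ u₃ : ℝ × ℝ → ℂ,
        DNLS.IsSchwartz u₁ → DNLS.IsSchwartz u₂ → DNLS.IsSchwartz u₃ →
        DNLS.TimeSupported T u₁ → DNLS.TimeSupported T u₂ → DNLS.TimeSupported T u₃ →
        (∀ (t : ℝ) (ξ : ℤ),
          Summable (fun k : DNLS.NonResonant ξ => DNLS.nonresTerm u₁ u₂ u₃ ξ k t)) ∧
        (∀ (ξ : ℤ) (τ : ℝ),
          DNLS.fourierT (fun t => DNLS.trilinearHat u₁ u₂ u₃ t ξ) τ =
            DNLS.trilinearFourier u₁ u₂ u₃ ξ τ) ∧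
        DNLS.xNorm (1 / 2) (-1 / 2) (ENNReal.ofReal r) 2
            (fun ξ τ => DNLS.fourierT (fun t => DNLS.trilinearHat u₁ u₂ u₃ t ξ) τ) ≤
          (C : ℝ≥0∞) * ENNReal.ofReal (T ^ δ) *
            DNLS.xNorm (1 / 2) (1 / 2) (ENNReal.ofReal q) 2 (DNLS.fourierTX u₁) *
            DNLS.xNorm (1 / 2) (1 / 2) (ENNReal.ofReal q) 2 (DNLS.fourierTX u₂) *
            DNLS.xNorm (1 / 2) (1 / 2) (ENNReal.ofReal r) 2 (DNLS.fourierTX u₃)) ∧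
      -- arbitrary elements of the spaces
      (∀ u₁ u₂ u₃ : ℝ × ℝ → ℂ,
        DNLS.MemL2 u₁ → DNLS.MemL2 u₂ → DNLS.MemL2 u₃ →
        DNLS.TimeSupported T u₁ → DNLS.TimeSupported T u₂ → DNLS.TimeSupported T u₃ →
        DNLS.MemX (1 / 2) (1 / 2) (ENNReal.ofReal q) 2 (DNLS.fourierTX u₁) →
        DNLS.MemX (1 / 2) (1 / 2) (ENNReal.ofReal q) 2 (DNLS.fourierTX u₂) →
        DNLS.MemX (1 / 2) (1 / 2) (ENNReal.ofReal r) 2 (DNLS.fourierTX u₃) →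
        (∀ (ξ : ℤ) (k : DNLS.NonResonant ξ),
          Integrable (DNLS.nonresTerm u₁ u₂ u₃ ξ k) volume) ∧
        (∀ ξ : ℤ, Integrable (DNLS.corrTerm u₁ u₂ u₃ ξ) volume) ∧
        (∀ ξ : ℤ, ∀ᵐ τ : ℝ,
          Summable (fun k : DNLS.NonResonant ξ =>
            DNLS.fourierT (DNLS.nonresTerm u₁ u₂ u₃ ξ k) τ)) ∧
        DNLS.MemX (1 / 2) (-1 / 2) (ENNReal.ofReal r) 2 (DNLS.trilinearFourier u₁ u₂ u₃) ∧
        DNLS.xNorm (1 / 2) (-1 / 2) (ENNReal.ofReal r) 2 (DNLS.trilinearFourier u₁ u₂ u₃) ≤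
          (C : ℝ≥0∞) * ENNReal.ofReal (T ^ δ) *
            DNLS.xNorm (1 / 2) (1 / 2) (ENNReal.ofReal q) 2 (DNLS.fourierTX u₁) *
            DNLS.xNorm (1 / 2) (1 / 2) (ENNReal.ofReal q) 2 (DNLS.fourierTX u₂) *
            DNLS.xNorm (1 / 2) (1 / 2) (ENNReal.ofReal r) 2 (DNLS.fourierTX u₃)) := by
  obtain ⟨C, hC, H⟩ := DNLS.exists_outNorm_majorant_inputSize_le hq hqr hr hδ₀ hδ
  have hq1 : 1 < q := by linarith
  have hr1 : 1 < r := by linarith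
  have hQ0 : 0 < Real.conjExponent q := (Real.HolderConjugate.conjExponent hq1).symm.pos
  have hR0 : 0 < Real.conjExponent r := (Real.HolderConjugate.conjExponent hr1).symm.pos
  have eq := DNLS.one_div_add_one_div_conjExponent hq1
  have er := DNLS.one_div_add_one_div_conjExponent hr1
  -- Adding one makes the constant nonzero, so that the right-hand side is infinite when one norm is
  -- infinite and none vanishes.
  refine ⟨C.toNNReal + 1, fun T hT _ => ?_⟩
  have hCle : C ≤ ((C.toNNReal + 1 : ℝ≥0) : ℝ≥0∞) := by
    rw [ENNReal.coe_add, ENNReal.coe_toNNReal hC]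
    exact le_self_add
  refine ⟨fun u₁ u₂ u₃ h₁ h₂ h₃ s₁ s₂ s₃ => ?_, fun u₁ u₂ u₃ m₁ m₂ m₃ s₁ s₂ s₃ n₁ n₂ n₃ => ?_⟩
  · have m₁ := h₁.memL2 s₁
    have m₂ := h₂.memL2 s₂
    have m₃ := h₃.memL2 s₃
    refine ⟨fun t ξ => ?_, DNLS.fourierT_trilinearHat h₁ h₂ h₃ s₁ s₂ s₃, ?_⟩
    · obtain ⟨b, hb, hle⟩ := DNLS.exists_norm_nonresTerm_le h₁ h₂ h₃ ξ
      exact Summable.of_norm_bounded hb fun k => hle k t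
    · rw [show (fun ξ τ => DNLS.fourierT (fun t => DNLS.trilinearHat u₁ u₂ u₃ t ξ) τ) =
        DNLS.trilinearFourier u₁ u₂ u₃ from
          funext fun ξ => funext fun τ => DNLS.fourierT_trilinearHat h₁ h₂ h₃ s₁ s₂ s₃ ξ τ]
      -- Finiteness of the norms of smooth functions is not needed: an infinite norm makes the
      -- estimate trivial, except for products 0 · ∞, and a vanishing norm makes the operator
      -- vanish.
      by_cases hz : DNLS.xNorm (1 / 2) (1 / 2) (ENNReal.ofReal q) 2 (DNLS.fourierTX u₁) = 0 ∨
          DNLS.xNorm (1 / 2) (1 / 2) (ENNReal.ofReal q) 2 (DNLS.fourierTX u₂) = 0 ∨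
          DNLS.xNorm (1 / 2) (1 / 2) (ENNReal.ofReal r) 2 (DNLS.fourierTX u₃) = 0
      · rw [DNLS.xNorm_fourierTX hq1 hQ0 eq, DNLS.xNorm_fourierTX hq1 hQ0 eq,
          DNLS.xNorm_fourierTX hr1 hR0 er] at hz
        rw [DNLS.xNorm_trilinearFourier_eq_zero (hz.imp (DNLS.fourierX_ae_eq_zero hQ0 m₁ s₁)
          (Or.imp (DNLS.fourierX_ae_eq_zero hQ0 m₂ s₂) (DNLS.fourierX_ae_eq_zero hR0 m₃ s₃)))]
        exact zero_le
      obtain ⟨z₁, z₂, z₃⟩ := not_or.1 hz |>.imp_right not_or.1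
      have z₀ : ((C.toNNReal + 1 : ℝ≥0) : ℝ≥0∞) * ENNReal.ofReal (T ^ δ) ≠ 0 := by
        refine mul_ne_zero ?_ (by simpa using Real.rpow_pos_of_pos hT δ)
        rw [ENNReal.coe_ne_zero]
        positivity
      by_cases n₁ : DNLS.xNorm (1 / 2) (1 / 2) (ENNReal.ofReal q) 2 (DNLS.fourierTX u₁) = ∞
      · rw [n₁, ENNReal.mul_top z₀, ENNReal.top_mul z₂, ENNReal.top_mul z₃]
        exact le_top
      by_cases n₂ : DNLS.xNorm (1 / 2) (1 / 2) (ENNReal.ofReal q) 2 (DNLS.fourierTX u₂) = ∞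
      · rw [n₂, ENNReal.mul_top (mul_ne_zero z₀ z₁), ENNReal.top_mul z₃]
        exact le_top
      by_cases n₃ : DNLS.xNorm (1 / 2) (1 / 2) (ENNReal.ofReal r) 2 (DNLS.fourierTX u₃) = ∞
      · rw [n₃, ENNReal.mul_top (mul_ne_zero (mul_ne_zero z₀ z₁) z₂)]
        exact le_top
      obtain ⟨i₁, i₂, i₃, hle⟩ := H T hT u₁ u₂ u₃ m₁ m₂ m₃ s₁ s₂ s₃ n₁ n₂ n₃
      refine (DNLS.xNorm_trilinearFourier_le hr1 hR0 er i₁ i₂ i₃).trans (hle.trans ?_)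
      gcongr
  · obtain ⟨i₁, i₂, i₃, hle⟩ := H T hT u₁ u₂ u₃ m₁ m₂ m₃ s₁ s₂ s₃ n₁.2.ne n₂.2.ne n₃.2.ne
    have hx := (DNLS.xNorm_trilinearFourier_le hr1 hR0 er i₁ i₂ i₃).trans hle
    have hfin : C * ENNReal.ofReal (T ^ δ) *
        DNLS.xNorm (1 / 2) (1 / 2) (ENNReal.ofReal q) 2 (DNLS.fourierTX u₁) *
        DNLS.xNorm (1 / 2) (1 / 2) (ENNReal.ofReal q) 2 (DNLS.fourierTX u₂) *
        DNLS.xNorm (1 / 2) (1 / 2) (ENNReal.ofReal r) 2 (DNLS.fourierTX u₃) < ∞ :=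
      ENNReal.mul_lt_top (ENNReal.mul_lt_top (ENNReal.mul_lt_top (ENNReal.mul_lt_top hC.lt_top
        ENNReal.ofReal_lt_top) n₁.2) n₂.2) n₃.2
    -- The convergence of the series is read off from the estimate for the majorant, which therefore
    -- precedes it.
    have hsum : ∀ ξ : ℤ, ∀ᵐ τ : ℝ, Summable fun k : DNLS.NonResonant ξ =>
        DNLS.fourierT (DNLS.nonresTerm u₁ u₂ u₃ ξ k) τ := fun ξ => by
      filter_upwards [DNLS.ae_tsum_ne_top i₁ i₂ i₃ ξ
        (DNLS.sqNorm_ne_top_of_tsum hR0 (hle.trans_lt hfin).ne ξ)] with τ hτ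
      exact DNLS.summable_of_tsum_enorm_ne_top hτ
    refine ⟨fun ξ k => DNLS.integrable_cubicTerm i₁ i₂ i₃ _ _ _ _,
      fun ξ => DNLS.integrable_cubicTerm i₁ i₂ i₃ _ _ _ _, hsum,
      ⟨fun ξ => DNLS.aestronglyMeasurable_trilinearFourier i₁ i₂ i₃ ξ (hsum ξ),
        hx.trans_lt hfin⟩, hx.trans ?_⟩
    gcongr
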